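/- **Setting.** Let $M$ be a 4-dimensional smooth (Hausdorff, second countable) manifold with a smooth Lorentzian metric $g_{ij}$ and a smooth 1-form $A=A_i\,dx^i$; let $F_{ij}=\partial_iA_j-\partial_jA_i$, let $\gamma^i_{jk}$, $r_{ij}$, $r$ be the Christoffel symbols, Ricci tensor and Ricci scalar of $g$, and let $c,k>0$. Fix a chart $(x^i)$ of $M$, with fibre coordinates $y^i$ on $TM$, and a compact set $\Delta$ contained in the domain of the chart. Write $\cdot_i$ for $\partial/\partial y^i$, and $\|y\|=\sqrt{g_{ij}(x)y^iy^j}$ (principal complex square root, so $\|y\|$ is imaginary where $g_{ij}y^iy^j<0$). For $\alpha\in\mathbb R$ put $2B^i=-\alpha\|y\|F^i{}_jy^j$, $2G^i=\gamma^i_{jk}y^jy^k+2B^i$, $B^i_j=B^i_{\cdot j}$, $G^i_j=G^i_{\cdot j}$, $G^i_{jk}=G^i_{\cdot jk}$, $\delta_i=\partial_{x^i}-G^j_i\,\partial_{y^j}$, and let $D$ be the connection on $TM$ with $D_{\delta_k}\delta_j=G^i_{jk}\delta_i$, $D_{\delta_k}\partial_{y^j}=G^i_{jk}\partial_{y^i}$,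 $D_{\partial_{y^k}}\delta_j=D_{\partial_{y^k}}\partial_{y^j}=0$. Its Ricci tensor and Ricci scalar are $$R_{jl}=\delta_iG^i_{jl}-\delta_lG^i_{ji}+G^h_{jl}G^i_{hi}-G^h_{ji}G^i_{hl},\qquad R=g^{jl}R_{jl}.$$ Let $v_{ij}(x)$ be positive definite with $\det v=|\det g|$, let $\tilde\Delta_x=\{y: v_{ij}y^iy^j\le\sqrt{2/\pi^2}\}$ (a ball of $v$-volume $1$), $d\Omega=\sqrt{-\det g\,\det v}\;d^4x\,d^4y$, and fix $\alpha$ with $\tfrac{3\alpha^2}{2}=\tfrac{k}{c^4}$. Put $$S_{fg}=-\frac{c^3}{16\pi k}\int_\Delta\int_{\tilde\Delta_x}R\,d\Omega .$$ Let finitely many point particles have masses $m_a>0$, charges $q_a$ and $C^1$ worldlines $x_a(t)$, $t$ in a compact interval, with $g(\dot x_a,\dot x_a)>0$ while in $\Delta$, and put (integrals over the parts of the worldlines in $\Delta$) $$S_m=-\sum_a m_ac\int\sqrt{g_{ij}\dot x_a^i\dot x_a^j}\,dt,\qquad S_i=-\sum_a\frac{q_a}{c}\int A_k\dot x_a^k\,dt,\qquad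 S=S_{fg}+S_m+S_i .$$ The matter stress-energy tensor is the distribution $$\overset{m}{T}_{ij}\sqrt{-g}\,d^4x=\sum_a m_ac^2\int\frac{\dot x_{a,i}\,\dot x_{a,j}}{\|\dot x_a\|}\,\delta^4(x-x_a(t))\,dt,\qquad \dot x_{a,i}=g_{ik}\dot x_a^k,$$ (worldlines restricted to $\Delta$). The generalized Einstein tensor is $$\mathcal G_{ij}=\tilde R_{ij}-\tfrac12\tilde R\,g_{ij}+\mathcal B_{\cdot ij},\quad \tilde R=r+\tfrac{3\alpha^2}{2}F_{ij}F^{ij},\quad \tilde R_{ij}=r_{ij}-\tfrac12(B^l_hB^h_l)_{\cdot ij},\quad \mathcal B=\frac{6\,B^lB_l}{\|y\|^2}+\tfrac12B^l_hB^h_l .$$ A variation $\delta g^{ij}$ is a smooth symmetric field with support in the interior of $\Delta$; $g$ is varied to $g_\varepsilon$ with inverse $g^{ij}+\varepsilon\,\delta g^{ij}$, and $v$ is varied to any $v_\varepsilon$ which, for all small $\varepsilon$, is positive definite on $\Delta$ with $\det v_\varepsilon=|\det g_\varepsilon|$; $A$ and the worldlines are kept fixed. "$S$ is stationary" means that $\frac{d}{d\varepsilon}S|_{\varepsilon=0}$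 exists and vanishes for all such variations. **Proposition.** 1. $S_m+S_i=-\sum_a m_ac\int L^{\alpha_a}(x_a,\dot x_a)\,dt$, where $L^{\alpha}(x,\dot x)=\sqrt{g_{ij}\dot x^i\dot x^j}+\alpha A_i\dot x^i$ is the Randers Lagrangian and $\alpha_a=\frac{q_a}{m_ac^2}$. 2. For every variation, $\delta S_m=\frac1{2c}\int\overset{m}{T}_{ij}\,\delta g^{ij}\sqrt{-g}\,d^4x$. 3. At all $(x,y)$ with $g_{ij}y^iy^j\neq0$, $\mathcal G_{ij}=r_{ij}-\tfrac12 r\,g_{ij}-\frac{8\pi k}{c^4}\overset{f}{T}_{ij}$, where $\overset{f}{T}_{ij}=\frac1{4\pi}\left(-F_{il}F_j{}^{l}+\tfrac14g_{ij}F_{lm}F^{lm}\right)$ is the electromagnetic stress-energy tensor; in particular $\mathcal G_{ij}$ depends only on $x$. 4. For every variation $\delta g^{ij}$ and all admissible $v_\varepsilon$, $S$ is differentiable at $\varepsilon=0$ and $$\delta S=-\frac{c^3}{16\pi k}\int_\Delta\Big(\mathcal G_{ij}-\frac{8\pi k}{c^4}\overset{m}{T}_{ij}\Big)\delta g^{ij}\sqrt{-g}\,d^4x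 .$$ 5. $S$ is stationary with respect to $g^{ij}$ if and only if the Einstein field equations $$\mathcal G_{ij}=\frac{8\pi k}{c^4}\overset{m}{T}_{ij}$$ hold in the interior of $\Delta$ in the sense of distributions. (In 4 and 5, $\mathcal G_{ij}$ may be evaluated at any choice $y=Y(x)$ with $g_{ij}Y^iY^j\ne0$ on $\Delta$.) -/

import Mathlib

open MeasureTheory Set Filter Topology Manifold
open scoped ContDiff

namespace RandersGravity

noncomputable section

/-- Coordinate space `ℝ⁴`; its measure is Lebesgue measure `d⁴x`. -/
abbrev Coord := Fin 4 → ℝ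

/-- A field of `4 × 4` matrices in local coordinates, e.g. the components `g_{ij}` of a metric. -/
abbrev MatField := Coord → Matrix (Fin 4) (Fin 4) ℝ

/-- The components `A_i` of a 1-form in local coordinates. -/
abbrev CovField := Coord → Coord

/-- Partial derivative with respect to the `i`-th coordinate. -/
def pd {V : Type*} [NormedAddCommGroup V] [NormedSpace ℝ V] (i : Fin 4) (f : Coord → V)
    (x : Coord) : V :=
  fderiv ℝ f x (Pi.single i 1)

/-! ### Fields on the space-time manifold -/

section Base

/-- Christoffel symbols `γ^i_{jk}` of the Levi-Civita connection. -/
def christoffel (g : MatField) (i j k : Fin 4) (x : Coord) : ℝ :=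
  (1 / 2) * ∑ l, (g x)⁻¹ i l *
    (pd j (fun z => g z l k) x + pd k (fun z => g z l j) x - pd l (fun z => g z j k) x)

/-- Ricci tensor `r_{jl}` of `g`. -/
def ricci (g : MatField) (j l : Fin 4) (x : Coord) : ℝ :=
  ∑ i, (pd i (christoffel g i j l) x - pd l (christoffel g i j i) x
    + ∑ h, (christoffel g h j l x * christoffel g i h i x
      - christoffel g h j i x * christoffel g i h l x))

/-- Ricci scalar `r` of `g`. -/
def scalarCurv (g : MatField) (x : Coord) : ℝ :=
  ∑ j, ∑ l, (g x)⁻¹ j l * ricci g j l x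

/-- Einstein tensor `G_{ij} = r_{ij} - r g_{ij} / 2`. -/
def einstein (g : MatField) (i j : Fin 4) (x : Coord) : ℝ :=
  ricci g i j x - (1 / 2) * scalarCurv g x * g x i j

/-- Faraday tensor `F = dA`, i.e. `F_{ij} = ∂_i A_j - ∂_j A_i`. -/
def faraday (A : CovField) (i j : Fin 4) (x : Coord) : ℝ :=
  pd i (fun z => A z j) x - pd j (fun z => A z i) x

/-- `F_{il} F_j{}^l = g^{lm} F_{il} F_{jm}`. -/
def faradaySq (g : MatField) (A : CovField) (i j : Fin 4) (x : Coord) : ℝ :=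
  ∑ l, ∑ m, (g x)⁻¹ l m * faraday A i l x * faraday A j m x

/-- `F_{ij} F^{ij}`. -/
def faradayNormSq (g : MatField) (A : CovField) (x : Coord) : ℝ :=
  ∑ i, ∑ j, (g x)⁻¹ i j * faradaySq g A i j x

/-- Stress-energy tensor of the electromagnetic field,
`(1 / 4π) (- F_{il} F_j{}^l + g_{ij} F_{lm} F^{lm} / 4)`. -/
def fieldStress (g : MatField) (A : CovField) (i j : Fin 4) (x : Coord) : ℝ :=
  (1 / (4 * Real.pi)) * (-faradaySq g A i j x + (1 / 4) * g x i j * faradayNormSq g A x)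

/-- `F^i{}_j = g^{ih} F_{hj}`. -/
def faradayMixed (g : MatField) (A : CovField) (i j : Fin 4) (x : Coord) : ℝ :=
  ∑ h, (g x)⁻¹ i h * faraday A h j x

end Base

/-! ### Geometry of the tangent bundle, in the coordinates `(x, y)` -/

section TangentBundle

/-- The quadratic form `g_{ij}(x) y^i y^j`. -/
def quad (g : MatField) (x y : Coord) : ℝ :=
  ∑ i, ∑ j, g x i j * y i * y j

/-- `‖y‖ = √(g_{ij} y^i y^j)`, the principal complex square root: since `Real.sqrt` vanishes on
negative numbers, this is `√q` for `q ≥ 0` and `i √(-q)` for `q < 0`. -/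
def fibreNorm (g : MatField) (x y : Coord) : ℂ :=
  (Real.sqrt (quad g x y) : ℂ) + Complex.I * (Real.sqrt (-quad g x y) : ℂ)

theorem fibreNorm_sq (g : MatField) (x y : Coord) :
    fibreNorm g x y ^ 2 = (quad g x y : ℂ) := by
  unfold fibreNorm
  rcases le_total 0 (quad g x y) with h | h
  · rw [Real.sqrt_eq_zero_of_nonpos (x := -quad g x y) (by linarith)]
    simp [← Complex.ofReal_pow, Real.sq_sqrt h]
  · rw [Real.sqrt_eq_zero_of_nonpos (x := quad g x y) h]
    simp [mul_pow, ← Complex.ofReal_pow, Real.sq_sqrt (neg_nonneg.2 h)]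

/-- Partial derivative `f_{,k}` of a function of `(x, y)` with respect to `x^k`. -/
def dX (k : Fin 4) (f : Coord → Coord → ℂ) (x y : Coord) : ℂ :=
  pd k (fun z => f z y) x

/-- Fibre derivative `f_{· k}` of a function of `(x, y)` with respect to `y^k`. -/
def dY (k : Fin 4) (f : Coord → Coord → ℂ) (x y : Coord) : ℂ :=
  pd k (fun w => f x w) y

/-- `B^i`, where `2 B^i = - α ‖y‖ F^i{}_j y^j`. -/
def bVec (g : MatField) (A : CovField) (α : ℝ) (i : Fin 4) (x y : Coord) : ℂ :=
  -((α : ℂ) / 2) * fibreNorm g x y * ((∑ j, faradayMixed g A i j x * y j : ℝ) : ℂ)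

/-- The spray `G^i`, where `2 G^i = γ^i_{jk} y^j y^k + 2 B^i`. -/
def spray (g : MatField) (A : CovField) (α : ℝ) (i : Fin 4) (x y : Coord) : ℂ :=
  (1 / 2) * ((∑ j, ∑ k, christoffel g i j k x * y j * y k : ℝ) : ℂ) + bVec g A α i x y

/-- Coefficients `N^i_j = G^i_j = G^i_{· j}` of the Ehresmann connection of the spray. -/
def sprayN (g : MatField) (A : CovField) (α : ℝ) (i j : Fin 4) : Coord → Coord → ℂ :=
  dY j (spray g A α i)

/-- The adapted derivative `δ_k f = f_{,k} - N^h_k f_{· h}`. -/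
def hDeriv (g : MatField) (A : CovField) (α : ℝ) (k : Fin 4) (f : Coord → Coord → ℂ)
    (x y : Coord) : ℂ :=
  dX k f x y - ∑ h, sprayN g A α h k x y * dY h f x y

/-- Coefficients `G^i_{jk} = G^i_{· jk}` of the affine connection `D` on the tangent bundle:
`D_{δ_k} δ_j = G^i_{jk} δ_i`, while `D_{∂/∂y^k} δ_j = 0`. -/
def connD (g : MatField) (A : CovField) (α : ℝ) (i j k : Fin 4) : Coord → Coord → ℂ :=
  dY k (sprayN g A α i j)

/-- The horizontal block `R_j{}^i{}_{kl}` of the curvature of `D`: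
`(D_{δ_l} D_{δ_k} - D_{δ_k} D_{δ_l} - D_{[δ_l, δ_k]}) δ_j = R_j{}^i{}_{kl} δ_i`.
The bracket `[δ_l, δ_k]` is vertical, so the last term on the left vanishes. -/
def curvD (g : MatField) (A : CovField) (α : ℝ) (j i k l : Fin 4) (x y : Coord) : ℂ :=
  hDeriv g A α l (connD g A α i j k) x y - hDeriv g A α k (connD g A α i j l) x y
    + ∑ h, (connD g A α h j k x y * connD g A α i h l x y
      - connD g A α h j l x y * connD g A α i h k x y)

/-- Ricci tensor `R_{jl} = R_j{}^i{}_{li}` of `D`. -/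
def ricciD (g : MatField) (A : CovField) (α : ℝ) (j l : Fin 4) (x y : Coord) : ℂ :=
  ∑ i, curvD g A α j i l i x y

/-- Ricci scalar `R = g^{jl} R_{jl}` of `D`, a function on the tangent bundle. -/
def scalarD (g : MatField) (A : CovField) (α : ℝ) (x y : Coord) : ℂ :=
  ∑ j, ∑ l, ((g x)⁻¹ j l : ℂ) * ricciD g A α j l x y

/-- `B^i_h B^h_i`, where `B^i_j = B^i_{· j}`. -/
def bTrace (g : MatField) (A : CovField) (α : ℝ) (x y : Coord) : ℂ :=
  ∑ i, ∑ h, dY h (bVec g A α i) x y * dY i (bVec g A α h) x y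

/-- `R̃ = r + (3 α² / 2) F_{ij} F^{ij}`. -/
def scalarTilde (g : MatField) (A : CovField) (α : ℝ) (x : Coord) : ℝ :=
  scalarCurv g x + (3 * α ^ 2 / 2) * faradayNormSq g A x

/-- `R̃_{ij} = r_{ij} - (B^l_h B^h_l)_{· ij} / 2`, the Ricci tensor of `D` without its
divergence part `(B^l_{|l})_{· ij}`. -/
def ricciTilde (g : MatField) (A : CovField) (α : ℝ) (i j : Fin 4) (x y : Coord) : ℂ :=
  (ricci g i j x : ℂ) - (1 / 2) * dY j (dY i (bTrace g A α)) x y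

/-- `𝓑 = 6 B^l B_l / ‖y‖² + B^i_h B^h_i / 2`. -/
def bScalar (g : MatField) (A : CovField) (α : ℝ) (x y : Coord) : ℂ :=
  6 * (∑ l, ∑ m, (g x l m : ℂ) * bVec g A α l x y * bVec g A α m x y) / fibreNorm g x y ^ 2
    + (1 / 2) * bTrace g A α x y

/-- The generalized Einstein tensor `𝓖_{ij} = R̃_{ij} - R̃ g_{ij} / 2 + 𝓑_{· ij}`. -/
def genEinstein (g : MatField) (A : CovField) (α : ℝ) (i j : Fin 4) (x y : Coord) : ℂ :=
  ricciTilde g A α i j x y - (1 / 2) * (scalarTilde g A α x : ℂ) * (g x i j : ℂ)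
    + dY j (dY i (bScalar g A α)) x y

/-- The canonical fibre domain `{y | v_{ij} y^i y^j ≤ √(2 / π²)}`, of volume one for `v`. -/
def fibreDomain (v : MatField) (x : Coord) : Set Coord :=
  {y | quad v x y ≤ Real.sqrt (2 / Real.pi ^ 2)}

/-- `S_fg = - (c³ / 16πk) ∫_{K × Δ̃} R dΩ` with `dΩ = √(- det g · det v) d⁴x d⁴y`, the integral
over the fibres being performed first. -/
def actionFG (c k : ℝ) (K : Set Coord) (A : CovField) (α : ℝ) (g v : MatField) : ℂ :=
  -((c ^ 3 / (16 * Real.pi * k) : ℝ) : ℂ) *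
    ∫ x in K, ∫ y in fibreDomain v x,
      scalarD g A α x y * (Real.sqrt (-(g x).det * (v x).det) : ℂ)

/-- `v` is an admissible vertical metric over `K` for the metric `g`: it is positive definite and
its determinant is `|det g|`. -/
def IsVerticalMetric (K : Set Coord) (g v : MatField) : Prop :=
  ∀ x ∈ K, (v x).PosDef ∧ (v x).det = |(g x).det|

end TangentBundle

/-! ### Tensor fields on the manifold and their components in a chart -/

section ManifoldFields

variable (M : Type*) [TopologicalSpace M] [ChartedSpace Coord M]

/-- A field of bilinear forms on the tangent spaces of `M`. -/
abbrev BilinField :=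
  ∀ p : M, TangentSpace 𝓘(ℝ, Coord) p →ₗ[ℝ] TangentSpace 𝓘(ℝ, Coord) p →ₗ[ℝ] ℝ

/-- A field of linear forms on the tangent spaces of `M`. -/
abbrev FormField := ∀ p : M, TangentSpace 𝓘(ℝ, Coord) p →ₗ[ℝ] ℝ

variable {M}

/-- The coordinate vector `∂_i` of the chart `φ` at the point with coordinates `x`. -/
def coordVec (φ : OpenPartialHomeomorph M Coord) (x : Coord) (i : Fin 4) :
    TangentSpace 𝓘(ℝ, Coord) (φ.symm x) :=
  mfderiv 𝓘(ℝ, Coord) 𝓘(ℝ, Coord) φ.symm x (Pi.single i (1 : ℝ) : Coord)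

/-- Components `g_{ij}` in the chart `φ`. -/
def metricComp (φ : OpenPartialHomeomorph M Coord) (g : BilinField M) : MatField :=
  fun x => Matrix.of fun i j => g (φ.symm x) (coordVec φ x i) (coordVec φ x j)

/-- Components `A_i` in the chart `φ`. -/
def formComp (φ : OpenPartialHomeomorph M Coord) (A : FormField M) : CovField :=
  fun x i => A (φ.symm x) (coordVec φ x i)

/-- Smooth Lorentzian metric. In dimension four a symmetric matrix with negative determinant is
the same as one of signature `(1, 3)` or `(3, 1)`. -/
def IsLorentzMetric [IsManifold 𝓘(ℝ, Coord) ∞ M] (g : BilinField M) : Prop :=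
  ∀ φ ∈ IsManifold.maximalAtlas 𝓘(ℝ, Coord) ∞ M,
    (∀ i j, ContDiffOn ℝ ∞ (fun x => metricComp φ g x i j) φ.target) ∧
    ∀ x ∈ φ.target, (metricComp φ g x).IsSymm ∧ (metricComp φ g x).det < 0

/-- Smooth 1-form. -/
def IsSmoothForm [IsManifold 𝓘(ℝ, Coord) ∞ M] (A : FormField M) : Prop :=
  ∀ φ ∈ IsManifold.maximalAtlas 𝓘(ℝ, Coord) ∞ M,
    ∀ i, ContDiffOn ℝ ∞ (fun x => formComp φ A x i) φ.target

end ManifoldFields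

/-! ### Particles -/

section Particles

/-- A charged point particle: its mass, its charge, and a parametrized piece of worldline. -/
structure Particle (M : Type*) where
  mass : ℝ
  charge : ℝ
  path : ℝ → M
  start : ℝ
  finish : ℝ

variable {M : Type*} [TopologicalSpace M] [ChartedSpace Coord M]

/-- The parameters for which the particle is in the domain `Δ`. -/
def Particle.times (P : Particle M) (Δ : Set M) : Set ℝ :=
  Icc P.start P.finish ∩ P.path ⁻¹' Δ

/-- Coordinates `x^i(t)` of the particle. -/
def Particle.pos (P : Particle M) (φ : OpenPartialHomeomorph M Coord) (t : ℝ) : Coord :=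
  φ (P.path t)

/-- Coordinate velocity `ẋ^i(t)`. -/
def Particle.vel (P : Particle M) (φ : OpenPartialHomeomorph M Coord) (t : ℝ) : Coord :=
  deriv (P.pos φ) t

/-- The particle is physically admissible in `Δ`: positive mass, `C¹` worldline, and velocity
with `g(ẋ, ẋ) > 0`. -/
def Particle.Admissible (P : Particle M) (φ : OpenPartialHomeomorph M Coord) (Δ : Set M)
    (g : MatField) : Prop :=
  0 < P.mass ∧
  (∀ t ∈ Icc P.start P.finish, ContMDiffAt 𝓘(ℝ, ℝ) 𝓘(ℝ, Coord) 1 P.path t) ∧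
  ∀ t ∈ P.times Δ, 0 < quad g (P.pos φ t) (P.vel φ t)

/-- The Randers Lagrangian `L^α(x, ẋ) = √(g_{ij} ẋ^i ẋ^j) + α A_i ẋ^i`. -/
def randers (g : MatField) (A : CovField) (α : ℝ) (x u : Coord) : ℝ :=
  Real.sqrt (quad g x u) + α * ∑ i, A x i * u i

variable {ι : Type*} [Fintype ι]

/-- `S_m = - ∑ m_a c ∫ ds`, over the parts of the worldlines in `Δ`. -/
def actionM (c : ℝ) (φ : OpenPartialHomeomorph M Coord) (Δ : Set M) (P : ι → Particle M)
    (g : MatField) : ℝ :=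
  -∑ a, (P a).mass * c *
    ∫ t in (P a).times Δ, Real.sqrt (quad g ((P a).pos φ t) ((P a).vel φ t))

/-- `S_i = - ∑ (q_a / c) ∫ A_k dx^k`, over the parts of the worldlines in `Δ`. -/
def actionI (c : ℝ) (φ : OpenPartialHomeomorph M Coord) (Δ : Set M) (P : ι → Particle M)
    (A : CovField) : ℝ :=
  -∑ a, (P a).charge / c *
    ∫ t in (P a).times Δ, ∑ i, A ((P a).pos φ t) i * (P a).vel φ t i

/-- Stress-energy tensor of the particles as a distribution in the coordinate domain:
`T_{ij} √(-g) d⁴x = ∑ m_a c² ∫ (ẋ_i ẋ_j / √(g_{kl} ẋ^k ẋ^l)) δ⁴(x - x_a(t)) dt`,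
`ẋ_i = g_{ik} ẋ^k`, evaluated on the test function `f`. -/
def matterStress (c : ℝ) (φ : OpenPartialHomeomorph M Coord) (Δ : Set M) (P : ι → Particle M)
    (g : MatField) (i j : Fin 4) (f : Coord → ℝ) : ℝ :=
  ∑ a, (P a).mass * c ^ 2 * ∫ t in (P a).times Δ,
    (g ((P a).pos φ t)).mulVec ((P a).vel φ t) i * (g ((P a).pos φ t)).mulVec ((P a).vel φ t) j
      / Real.sqrt (quad g ((P a).pos φ t) ((P a).vel φ t)) * f ((P a).pos φ t)

/-- The total action `S = S_fg + S_m + S_i` over the domain `Δ` of the chart `φ`. -/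
def totalAction (c k α : ℝ) (φ : OpenPartialHomeomorph M Coord) (Δ : Set M) (P : ι → Particle M)
    (A : CovField) (g v : MatField) : ℂ :=
  actionFG c k (φ '' Δ) A α g v + ((actionM c φ Δ P g + actionI c φ Δ P A : ℝ) : ℂ)

end Particles

/-! ### Variation of the metric -/

section Variation

/-- A smooth symmetric variation `δg^{ij}` of the inverse metric, supported in the interior
of `K`. -/
def IsVariation (K : Set Coord) (h : MatField) : Prop :=
  (∀ i j, ContDiff ℝ ∞ (fun x => h x i j)) ∧ (∀ x, (h x).IsSymm) ∧ tsupport h ⊆ interior K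

/-- The varied metric, with inverse `g^{ij} + ε δg^{ij}`. -/
def varied (g h : MatField) (ε : ℝ) : MatField :=
  fun x => ((g x)⁻¹ + ε • h x)⁻¹

/-- A choice, for all small `ε`, of admissible vertical metrics for the varied metrics. -/
def IsVerticalFamily (K : Set Coord) (g h : MatField) (v : ℝ → MatField) : Prop :=
  ∀ᶠ ε in 𝓝 (0 : ℝ), IsVerticalMetric K (varied g h ε) (v ε)

/-- The functional `S` of the horizontal and vertical metrics is stationary at `g` under
variations of `g^{ij}` supported in the interior of `K`. -/
def IsStationaryMetric (K : Set Coord) (S : MatField → MatField → ℂ) (g : MatField) : Prop :=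
  ∀ h, IsVariation K h → ∀ v, IsVerticalFamily K g h v →
    HasDerivAt (fun ε : ℝ => S (varied g h ε) (v ε)) 0 0

end Variation

end

end RandersGravity

open RandersGravity

/-! Integration over the fibres turns the gravitational action into the Einstein–Maxwell action, and
Hilbert's variational argument does the rest.

Off the null cone the connection coefficients are `γ^i_{jk} + B^i_{jk}`. Antisymmetry of `F` gives
`B^i_i = 0`, hence `B^i_{ji} = 0` (`IsLorentzField.dY_dY_bVec_trace`), which removes every trace
term from the Ricci tensor of `D`. What is left is `r_{jl}`, a part linear in `B`, and quadratic
terms that combine into `-½ (B^i_h B^h_i)_{·jl}` (`IsLorentzField.ricciD_eq`). The function `B^i_h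
B^h_i` is a quadratic form in `y` (`IsLorentzField.bTrace_eq`), so its fibre Hessian depends on `x`
only and contracts to the Maxwell term. Because `‖y‖` is parallel for the Levi-Civita connection,
the linear part contracts to `-(5α/2) (∇_i F^i_j) y^j / ‖y‖`, which is odd in `y`
(`IsLorentzField.exists_scalarD_eq`).

The odd term is singular on the cone, but only like an inverse square root of a linear quantity
transverse to it, so it is integrable on bounded sets (`integrableOn_norm_div_sqrt_quad`) and has
integral zero over the symmetric fibre domain. The coordinate volume of that domain is `1/√(det v)`,
which cancels the vertical density, and the auxiliary metric `v` disappears: the action is a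
multiple of `∫ (r + (3α²/2) F²) √(-g)` (`IsLorentzField.actionFG_eq`).

Varying `g^{ij}` then follows Hilbert: `√(-g) g^{jl} δr_{jl}` is a divergence
(`IsLorentzField.palatini_identity`) with support inside the domain, `δ√(-g) = -½ √(-g) g_{ij}
δg^{ij}`, and the two inverse metrics in `F²` contribute equally. The result is `fieldTensor`, which
is also the value of the generalized Einstein tensor at any nonnull `y`
(`IsLorentzField.genEinstein_eq`). The particle action is varied under the integral along each
compact set of admissible parameters (`IsLorentzField.hasDerivAt_actionM`). Finally, since
`fieldTensor` and the matter distribution are symmetric in their indices, testing with `f (E_{ij} +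
E_{ji})` separates the components of the field equations.

The varied metrics are treated on `variedDomain`, the open set of pairs `(ε, x)` where they are
still Lorentzian; compactness supplies a uniform interval of `ε`. -/

namespace RandersGravity

/-! ### Directional derivatives of functions of one and of two variables -/

section Calculus

variable {E F : Type*} [NormedAddCommGroup E] [NormedSpace ℝ E] [NormedAddCommGroup F]
  [NormedSpace ℝ F]

theorem contDiffOn_fderiv_apply {f : E → F} {s : Set E} (hs : IsOpen s)
    (hf : ContDiffOn ℝ ∞ f s) (v : E) : ContDiffOn ℝ ∞ (fun p => fderiv ℝ f p v) s :=
  (hf.fderiv_of_isOpen hs (by simp)).clm_apply contDiffOn_const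

theorem fderiv_fderiv_comm {f : E → F} {s : Set E} (hs : IsOpen s)
    (hf : ContDiffOn ℝ ∞ f s) (v w : E) {p : E} (hp : p ∈ s) :
    fderiv ℝ (fun z => fderiv ℝ f z v) p w = fderiv ℝ (fun z => fderiv ℝ f z w) p v := by
  have hd : DifferentiableAt ℝ (fderiv ℝ f) p :=
    ((hf.fderiv_of_isOpen hs (m := ∞) (by simp)).contDiffAt (hs.mem_nhds hp)).differentiableAt
      (by simp)
  have hsymm : IsSymmSndFDerivAt ℝ f p :=
    (hf.contDiffAt (hs.mem_nhds hp)).isSymmSndFDerivAt (by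
      rw [minSmoothness_of_isRCLikeNormedField]; exact WithTop.coe_le_coe.2 le_top)
  rw [fderiv_clm_apply hd (differentiableAt_const _), fderiv_clm_apply hd (differentiableAt_const _)]
  simpa using hsymm.eq w v

theorem fderiv_apply_congr {f g : E → F} {s : Set E} (hs : IsOpen s) (h : ∀ x ∈ s, f x = g x)
    {p : E} (hp : p ∈ s) (v : E) : fderiv ℝ f p v = fderiv ℝ g p v := by
  rw [Filter.EventuallyEq.fderiv_eq (Filter.eventuallyEq_of_mem (hs.mem_nhds hp) h)]

variable {P : Type*} [NormedAddCommGroup P] [NormedSpace ℝ P]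

/-- Joint smoothness of a function of two variables. -/
def Smooth₂ (Ω : Set (P × E)) (f : P → E → F) : Prop :=
  ContDiffOn ℝ ∞ (fun p : P × E => f p.1 p.2) Ω

variable {Ω : Set (P × E)} {f g : P → E → F}

theorem Smooth₂.diffAt (hΩ : IsOpen Ω) (hf : Smooth₂ Ω f) {p : P} {x : E} (h : (p, x) ∈ Ω) :
    DifferentiableAt ℝ (fun q : P × E => f q.1 q.2) (p, x) :=
  (hf.contDiffAt (hΩ.mem_nhds h)).differentiableAt (by simp)

theorem Smooth₂.hasFDerivAt_fst (hΩ : IsOpen Ω) (hf : Smooth₂ Ω f) {p : P} {x : E}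
    (h : (p, x) ∈ Ω) :
    HasFDerivAt (fun z => f z x) ((fderiv ℝ (fun q : P × E => f q.1 q.2) (p, x)).comp
      (ContinuousLinearMap.inl ℝ P E)) p :=
  HasFDerivAt.comp (f := fun z : P => (z, x)) p (hf.diffAt hΩ h).hasFDerivAt
    (hasFDerivAt_prodMk_left p x)

theorem Smooth₂.hasFDerivAt_snd (hΩ : IsOpen Ω) (hf : Smooth₂ Ω f) {p : P} {x : E}
    (h : (p, x) ∈ Ω) :
    HasFDerivAt (f p) ((fderiv ℝ (fun q : P × E => f q.1 q.2) (p, x)).comp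
      (ContinuousLinearMap.inr ℝ P E)) x :=
  HasFDerivAt.comp (f := fun z : E => (p, z)) x (hf.diffAt hΩ h).hasFDerivAt
    (hasFDerivAt_prodMk_right p x)

theorem Smooth₂.fderiv_fst (hΩ : IsOpen Ω) (hf : Smooth₂ Ω f) {p : P} {x : E}
    (h : (p, x) ∈ Ω) (u : P) :
    fderiv ℝ (fun z => f z x) p u = fderiv ℝ (fun q : P × E => f q.1 q.2) (p, x) (u, 0) := by
  rw [(hf.hasFDerivAt_fst hΩ h).fderiv]; simp

theorem Smooth₂.fderiv_snd (hΩ : IsOpen Ω) (hf : Smooth₂ Ω f) {p : P} {x : E}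
    (h : (p, x) ∈ Ω) (v : E) :
    fderiv ℝ (f p) x v = fderiv ℝ (fun q : P × E => f q.1 q.2) (p, x) (0, v) := by
  rw [(hf.hasFDerivAt_snd hΩ h).fderiv]; simp

theorem Smooth₂.differentiableAt_fst (hΩ : IsOpen Ω) (hf : Smooth₂ Ω f) {p : P} {x : E}
    (h : (p, x) ∈ Ω) : DifferentiableAt ℝ (fun z => f z x) p :=
  (hf.hasFDerivAt_fst hΩ h).differentiableAt

theorem Smooth₂.differentiableAt_snd (hΩ : IsOpen Ω) (hf : Smooth₂ Ω f) {p : P} {x : E}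
    (h : (p, x) ∈ Ω) : DifferentiableAt ℝ (f p) x :=
  (hf.hasFDerivAt_snd hΩ h).differentiableAt

theorem Smooth₂.fst (hΩ : IsOpen Ω) (hf : Smooth₂ Ω f) (u : P) :
    Smooth₂ Ω (fun p x => fderiv ℝ (fun z => f z x) p u) :=
  (contDiffOn_fderiv_apply hΩ hf (u, (0 : E))).congr fun _ hq => hf.fderiv_fst hΩ hq u

theorem Smooth₂.snd (hΩ : IsOpen Ω) (hf : Smooth₂ Ω f) (v : E) :
    Smooth₂ Ω (fun p x => fderiv ℝ (f p) x v) :=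
  (contDiffOn_fderiv_apply hΩ hf ((0 : P), v)).congr fun _ hq => hf.fderiv_snd hΩ hq v

theorem Smooth₂.snd_snd_comm (hΩ : IsOpen Ω) (hf : Smooth₂ Ω f) (v w : E) {p : P} {x : E}
    (h : (p, x) ∈ Ω) :
    fderiv ℝ (fun z => fderiv ℝ (f p) z v) x w = fderiv ℝ (fun z => fderiv ℝ (f p) z w) x v :=
  fderiv_fderiv_comm (s := {z | (p, z) ∈ Ω}) (hΩ.preimage (by fun_prop))
    (ContDiffOn.comp (g := fun q : P × E => f q.1 q.2) hf (f := fun z : E => (p, z))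
      (by fun_prop) fun _ hz => hz) v w h

/-- Both iterated derivatives are second derivatives of the uncurried function in the directions
`(u, 0)` and `(0, v)`. This is what allows the variation parameter `ε` to be exchanged with
coordinate derivatives. -/
theorem Smooth₂.fst_snd_comm (hΩ : IsOpen Ω) (hf : Smooth₂ Ω f) (u : P) (v : E) {p : P} {x : E}
    (h : (p, x) ∈ Ω) :
    fderiv ℝ (fun z => fderiv ℝ (f z) x v) p u
      = fderiv ℝ (fun z => fderiv ℝ (fun q => f q z) p u) x v := by
  rw [(hf.snd hΩ v).fderiv_fst hΩ h u, (hf.fst hΩ u).fderiv_snd hΩ h v,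
    -- The inner partial derivatives agree with joint ones on the whole open set, so they may be
    -- replaced under the outer derivative.
    fderiv_apply_congr hΩ (fun q hq => hf.fderiv_snd hΩ (p := q.1) (x := q.2) hq v) h,
    fderiv_apply_congr hΩ (fun q hq => hf.fderiv_fst hΩ (p := q.1) (x := q.2) hq u) h]
  exact fderiv_fderiv_comm hΩ hf _ _ h

theorem Smooth₂.slice (hf : Smooth₂ Ω f) (p : P) :
    ContDiffOn ℝ ∞ (f p) {x | (p, x) ∈ Ω} :=
  ContDiffOn.comp (g := fun q : P × E => f q.1 q.2) hf (f := fun z : E => (p, z))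
    (by fun_prop) fun _ hz => hz

theorem Smooth₂.of_snd {a : E → F} {s : Set E} (ha : ContDiffOn ℝ ∞ a s)
    (h : ∀ p x, (p, x) ∈ Ω → x ∈ s) : Smooth₂ Ω (fun (_ : P) x => a x) :=
  ha.comp (f := fun q : P × E => q.2) (by fun_prop) fun q hq => h q.1 q.2 hq

theorem Smooth₂.of_fst {a : P → F} {s : Set P} (ha : ContDiffOn ℝ ∞ a s)
    (h : ∀ p x, (p, x) ∈ Ω → p ∈ s) : Smooth₂ Ω (fun p (_ : E) => a p) :=
  ha.comp (f := fun q : P × E => q.1) (by fun_prop) fun q hq => h q.1 q.2 hq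

end Calculus

/-! ### Rules for the coordinate derivatives -/

section PartialRules

variable {V : Type*} [NormedAddCommGroup V] [NormedSpace ℝ V]

theorem pd_add {f g : Coord → V} {x : Coord} (hf : DifferentiableAt ℝ f x)
    (hg : DifferentiableAt ℝ g x) (k : Fin 4) :
    pd k (fun z => f z + g z) x = pd k f x + pd k g x := by
  simp only [pd]; rw [fderiv_fun_add hf hg]; rfl

theorem pd_sub {f g : Coord → V} {x : Coord} (hf : DifferentiableAt ℝ f x)
    (hg : DifferentiableAt ℝ g x) (k : Fin 4) :
    pd k (fun z => f z - g z) x = pd k f x - pd k g x := by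
  simp only [pd]; rw [fderiv_fun_sub hf hg]; rfl

theorem pd_sum {ι : Type*} (s : Finset ι) {f : ι → Coord → V} {x : Coord}
    (hf : ∀ i ∈ s, DifferentiableAt ℝ (f i) x) (k : Fin 4) :
    pd k (fun z => ∑ i ∈ s, f i z) x = ∑ i ∈ s, pd k (f i) x := by
  simp only [pd]; rw [fderiv_fun_sum hf]; simp

variable {R : Type*} [NormedCommRing R] [NormedAlgebra ℝ R]

theorem pd_mul {f g : Coord → R} {x : Coord} (hf : DifferentiableAt ℝ f x)
    (hg : DifferentiableAt ℝ g x) (k : Fin 4) :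
    pd k (fun z => f z * g z) x = pd k f x * g x + f x * pd k g x := by
  simp only [pd]; rw [fderiv_fun_mul hf hg]; simp; ring

theorem pd_const_mul {g : Coord → R} {x : Coord} (c : R)
    (hg : DifferentiableAt ℝ g x) (k : Fin 4) :
    pd k (fun z => c * g z) x = c * pd k g x := by
  simp only [pd]; rw [fderiv_const_mul hg]; simp

theorem pd_const (c : V) (k : Fin 4) (x : Coord) : pd k (fun _ => c) x = 0 := by
  simp [pd]

theorem pd_coord (j k : Fin 4) (x : Coord) :
    pd k (fun z : Coord => z j) x = if j = k then (1 : ℝ) else 0 := by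
  have : HasFDerivAt (fun z : Coord => z j) (ContinuousLinearMap.proj (R := ℝ) j) x :=
    (ContinuousLinearMap.proj (R := ℝ) (φ := fun _ : Fin 4 => ℝ) j).hasFDerivAt
  rw [pd, this.fderiv]
  simp [Pi.single_apply]

theorem pd_ofReal {f : Coord → ℝ} {x : Coord} (hf : DifferentiableAt ℝ f x) (k : Fin 4) :
    pd k (fun z => (f z : ℂ)) x = ((pd k f x : ℝ) : ℂ) := by
  have : HasFDerivAt (fun z => (f z : ℂ)) (Complex.ofRealCLM.comp (fderiv ℝ f x)) x :=
    Complex.ofRealCLM.hasFDerivAt.comp x hf.hasFDerivAt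
  rw [pd, this.fderiv]; rfl

theorem pd_congr {f g : Coord → V} {s : Set Coord} (hs : IsOpen s) (h : ∀ x ∈ s, f x = g x)
    {x : Coord} (hx : x ∈ s) (k : Fin 4) : pd k f x = pd k g x :=
  fderiv_apply_congr hs h hx _

end PartialRules

/-! ### Matrices depending on a parameter -/

section MatrixCalculus

variable {E : Type*} [NormedAddCommGroup E] [NormedSpace ℝ E] {s : Set E}
  {m : E → Matrix (Fin 4) (Fin 4) ℝ} {n : WithTop ℕ∞}

theorem contDiffOn_det (hm : ∀ i j, ContDiffOn ℝ n (fun x => m x i j) s) :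
    ContDiffOn ℝ n (fun x => (m x).det) s := by
  simp only [Matrix.det_apply']
  exact ContDiffOn.sum fun σ _ => contDiffOn_const.mul (contDiffOn_prod fun i _ => hm _ _)

/-- By Cramer's rule an entry of the inverse is a quotient of two determinants, and determinants are
polynomial in the entries. -/
theorem contDiffOn_inv_apply (hm : ∀ i j, ContDiffOn ℝ n (fun x => m x i j) s)
    (h0 : ∀ x ∈ s, (m x).det ≠ 0) (i j : Fin 4) :
    ContDiffOn ℝ n (fun x => (m x)⁻¹ i j) s := by
  have h : ∀ x, (m x)⁻¹ i j = (m x).det⁻¹ * ((m x).updateRow j (Pi.single i 1)).det := by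
    intro x
    rw [Matrix.inv_def, Matrix.smul_apply, Matrix.adjugate_apply, Ring.inverse_eq_inv', smul_eq_mul]
  simp only [h]
  refine ((contDiffOn_det hm).inv h0).mul (contDiffOn_det fun a b => ?_)
  by_cases hb : a = j
  · subst hb; simpa using contDiffOn_const
  · simpa [Matrix.updateRow_apply, hb] using hm a b

/-- Jacobi's formula. -/
theorem hasDerivAt_det {m : ℝ → Matrix (Fin 4) (Fin 4) ℝ} {m' : Matrix (Fin 4) (Fin 4) ℝ} {t : ℝ}
    (hm : ∀ i j, HasDerivAt (fun s => m s i j) (m' i j) t) (h0 : (m t).det ≠ 0) :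
    HasDerivAt (fun s => (m s).det) ((m t).det * ∑ i, ∑ j, (m t)⁻¹ i j * m' j i) t := by
  -- Differentiating column `i` in the Leibniz formula produces the determinant with that column
  -- replaced by its derivative; as a Cramer determinant this is the adjugate applied to the new
  -- column.
  have hcol : ∀ i, ((m t).updateCol i fun j => m' j i).det
      = ∑ σ : Equiv.Perm (Fin 4), (Equiv.Perm.sign σ : ℝ) *
        ((∏ j ∈ Finset.univ.erase i, m t (σ j) j) * m' (σ i) i) := by
    intro i
    rw [Matrix.det_apply']
    refine Finset.sum_congr rfl fun σ _ => ?_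
    rw [← Finset.mul_prod_erase _ _ (Finset.mem_univ i), mul_comm (∏ j ∈ _, _)]
    congr 2
    · simp
    · refine Finset.prod_congr rfl fun j hj => ?_
      rw [Matrix.updateCol_ne (Finset.ne_of_mem_erase hj)]
  have hsum : (m t).det * ∑ i, ∑ j, (m t)⁻¹ i j * m' j i
      = ∑ σ : Equiv.Perm (Fin 4), (Equiv.Perm.sign σ : ℝ) *
        ∑ i, (∏ j ∈ Finset.univ.erase i, m t (σ j) j) * m' (σ i) i := by
    simp only [Finset.mul_sum]
    rw [Finset.sum_comm (s := (Finset.univ : Finset (Equiv.Perm (Fin 4))))]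
    refine Finset.sum_congr rfl fun i _ => ?_
    rw [← hcol, ← Matrix.cramer_apply, Matrix.cramer_eq_adjugate_mulVec, Matrix.mulVec,
      dotProduct]
    refine Finset.sum_congr rfl fun j _ => ?_
    rw [Matrix.inv_def, Matrix.smul_apply, Ring.inverse_eq_inv', smul_eq_mul]
    field_simp
  rw [hsum]
  simp only [Matrix.det_apply']
  refine HasDerivAt.fun_sum fun σ _ => HasDerivAt.const_mul _ ?_
  have := HasDerivAt.fun_finsetProd (u := Finset.univ) (f := fun i s => m s (σ i) i)
    (f' := fun i => m' (σ i) i) (x := t) (fun i _ => hm _ _)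
  simpa [smul_eq_mul] using this

end MatrixCalculus

/-! ### Lorentzian metrics in coordinates -/

section LorentzField

/-- Components of a smooth Lorentzian metric on the open set `T`. -/
structure IsLorentzField (T : Set Coord) (g : MatField) : Prop where
  isOpen : IsOpen T
  smooth : ∀ i j, ContDiffOn ℝ ∞ (fun x => g x i j) T
  symm : ∀ x ∈ T, (g x).IsSymm
  det_neg : ∀ x ∈ T, (g x).det < 0

variable {T : Set Coord} {g : MatField}

theorem IsLorentzField.mul_inv (hg : IsLorentzField T g) {x : Coord} (hx : x ∈ T) :
    g x * (g x)⁻¹ = 1 :=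
  Matrix.mul_nonsing_inv _ (isUnit_iff_ne_zero.2 (hg.det_neg x hx).ne)

theorem IsLorentzField.inv_mul (hg : IsLorentzField T g) {x : Coord} (hx : x ∈ T) :
    (g x)⁻¹ * g x = 1 :=
  Matrix.nonsing_inv_mul _ (isUnit_iff_ne_zero.2 (hg.det_neg x hx).ne)

theorem IsLorentzField.apply_comm (hg : IsLorentzField T g) {x : Coord} (hx : x ∈ T)
    (i j : Fin 4) : g x i j = g x j i :=
  (hg.symm x hx).apply j i

theorem IsLorentzField.inv_isSymm (hg : IsLorentzField T g) {x : Coord} (hx : x ∈ T) :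
    ((g x)⁻¹).IsSymm := by
  rw [Matrix.IsSymm, Matrix.transpose_nonsing_inv, (hg.symm x hx).eq]

theorem IsLorentzField.inv_comm (hg : IsLorentzField T g) {x : Coord} (hx : x ∈ T)
    (i j : Fin 4) : (g x)⁻¹ i j = (g x)⁻¹ j i :=
  (hg.inv_isSymm hx).apply j i

theorem IsLorentzField.inv_smooth (hg : IsLorentzField T g) (i j : Fin 4) :
    ContDiffOn ℝ ∞ (fun x => (g x)⁻¹ i j) T :=
  contDiffOn_inv_apply hg.smooth (fun x hx => (hg.det_neg x hx).ne) i j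

theorem IsLorentzField.differentiableAt (hg : IsLorentzField T g) {x : Coord} (hx : x ∈ T)
    (i j : Fin 4) : DifferentiableAt ℝ (fun z => g z i j) x :=
  ((hg.smooth i j).contDiffAt (hg.isOpen.mem_nhds hx)).differentiableAt (by simp)

theorem IsLorentzField.inv_differentiableAt (hg : IsLorentzField T g) {x : Coord} (hx : x ∈ T)
    (i j : Fin 4) : DifferentiableAt ℝ (fun z => (g z)⁻¹ i j) x :=
  ((hg.inv_smooth i j).contDiffAt (hg.isOpen.mem_nhds hx)).differentiableAt (by simp)

theorem IsLorentzField.pd_comm (hg : IsLorentzField T g) {x : Coord} (hx : x ∈ T)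
    (i j k : Fin 4) : pd k (fun z => g z i j) x = pd k (fun z => g z j i) x :=
  pd_congr hg.isOpen (fun _ hz => hg.apply_comm hz i j) hx k

theorem IsLorentzField.christoffel_comm (hg : IsLorentzField T g) {x : Coord} (hx : x ∈ T)
    (i j k : Fin 4) : christoffel g i j k x = christoffel g i k j x := by
  unfold christoffel
  congr 1
  refine Finset.sum_congr rfl fun l _ => ?_
  rw [hg.pd_comm hx j k l]
  ring

/-- The matrix `(γ^m_{ka})_{m, a}`. -/
noncomputable def christoffelMatrix (g : MatField) (k : Fin 4) (x : Coord) : Matrix (Fin 4) (Fin 4) ℝ :=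
  Matrix.of fun m a => christoffel g m k a x

/-- The matrix `(∂_k g_{ij})_{i, j}`. -/
noncomputable def pdMatrix (g : MatField) (k : Fin 4) (x : Coord) : Matrix (Fin 4) (Fin 4) ℝ :=
  Matrix.of fun i j => pd k (fun z => g z i j) x

/-- Lowering the upper index cancels `g⁻¹` and leaves the Christoffel symbols of the first kind.
Symmetrizing them in `i, j` is metric compatibility. -/
theorem IsLorentzField.mul_christoffelMatrix (hg : IsLorentzField T g) {x : Coord} (hx : x ∈ T)
    (k i j : Fin 4) :
    (g x * christoffelMatrix g k x) i j = (1 / 2) *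
      (pd k (fun z => g z i j) x + pd j (fun z => g z i k) x - pd i (fun z => g z k j) x) := by
  set X : Coord := fun l =>
    (1 / 2) * (pd k (fun z => g z l j) x + pd j (fun z => g z l k) x - pd l (fun z => g z k j) x)
    with hX
  have h1 : ∀ m, christoffel g m k j x = ((g x)⁻¹).mulVec X m := by
    intro m
    simp only [christoffel, Matrix.mulVec, dotProduct, hX, Finset.mul_sum]
    exact Finset.sum_congr rfl fun l _ => by ring
  have h2 : (g x).mulVec (((g x)⁻¹).mulVec X) = X := by
    rw [Matrix.mulVec_mulVec, hg.mul_inv hx, Matrix.one_mulVec]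
  calc (g x * christoffelMatrix g k x) i j = (g x).mulVec (((g x)⁻¹).mulVec X) i := by
        rw [Matrix.mul_apply, Matrix.mulVec, dotProduct]
        exact Finset.sum_congr rfl fun m _ => by rw [← h1]; rfl
    _ = X i := by rw [h2]

/-- Metric compatibility, `∂_k g_{ij} = γ^m_{ki} g_{mj} + g_{im} γ^m_{kj}`. -/
theorem IsLorentzField.pdMatrix_eq (hg : IsLorentzField T g) {x : Coord} (hx : x ∈ T)
    (k : Fin 4) :
    pdMatrix g k x
      = (christoffelMatrix g k x).transpose * g x + g x * christoffelMatrix g k x := by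
  ext i j
  have h : (christoffelMatrix g k x).transpose * g x
      = (g x * christoffelMatrix g k x).transpose := by
    rw [Matrix.transpose_mul, (hg.symm x hx).eq]
  rw [h, Matrix.add_apply, Matrix.transpose_apply, hg.mul_christoffelMatrix hx,
    hg.mul_christoffelMatrix hx, hg.pd_comm hx j i k, hg.pd_comm hx k i j, hg.pd_comm hx k j i]
  simp only [pdMatrix, Matrix.of_apply]
  ring

/-- Differentiate `g g⁻¹ = 1`, multiply by `g⁻¹` from the left, and insert metric compatibility for
`∂_k g`. -/
theorem IsLorentzField.pdMatrix_inv (hg : IsLorentzField T g) {x : Coord} (hx : x ∈ T)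
    (k : Fin 4) :
    pdMatrix (fun z => (g z)⁻¹) k x
      = -((g x)⁻¹ * (christoffelMatrix g k x).transpose + christoffelMatrix g k x * (g x)⁻¹) := by
  have h0 : pdMatrix g k x * (g x)⁻¹ + g x * pdMatrix (fun z => (g z)⁻¹) k x = 0 := by
    ext i j
    have h : pd k (fun z => ∑ l, g z i l * (g z)⁻¹ l j) x = 0 := by
      rw [pd_congr hg.isOpen (g := fun _ => (1 : Matrix (Fin 4) (Fin 4) ℝ) i j) (fun z hz => ?_) hx,
        pd_const]
      rw [← hg.mul_inv hz, Matrix.mul_apply]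
    rw [pd_sum _ fun l _ => (hg.differentiableAt hx i l).fun_mul (hg.inv_differentiableAt hx l j)] at h
    simp only [pd_mul (hg.differentiableAt hx i _) (hg.inv_differentiableAt hx _ j)] at h
    rw [Finset.sum_add_distrib] at h
    simpa [Matrix.mul_apply, pdMatrix] using h
  have h1 : (g x)⁻¹ * (pdMatrix g k x * (g x)⁻¹ + g x * pdMatrix (fun z => (g z)⁻¹) k x) = 0 := by
    rw [h0, Matrix.mul_zero]
  rw [Matrix.mul_add, ← Matrix.mul_assoc (g x)⁻¹ (g x), hg.inv_mul hx, Matrix.one_mul,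
    hg.pdMatrix_eq hx, Matrix.add_mul, Matrix.mul_assoc, Matrix.mul_assoc, hg.mul_inv hx,
    Matrix.mul_add, ← Matrix.mul_assoc (g x)⁻¹ (g x), hg.inv_mul hx, Matrix.one_mul,
    Matrix.mul_one] at h1
  exact eq_neg_of_add_eq_zero_right h1

/-- `∂_k g^{ij} = -(γ^j_{km} g^{im} + γ^i_{km} g^{mj})`. -/
theorem IsLorentzField.pd_inv (hg : IsLorentzField T g) {x : Coord} (hx : x ∈ T)
    (i j k : Fin 4) :
    pd k (fun z => (g z)⁻¹ i j) x
      = -((∑ m, (g x)⁻¹ i m * christoffel g j k m x)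
        + ∑ m, christoffel g i k m x * (g x)⁻¹ m j) := by
  have := congrFun (congrFun (hg.pdMatrix_inv hx k) i) j
  simpa [pdMatrix, christoffelMatrix, Matrix.mul_apply] using this

/-- `∂_k g_{ij} = γ^m_{ki} g_{mj} + g_{im} γ^m_{kj}`. -/
theorem IsLorentzField.pd_metric (hg : IsLorentzField T g) {x : Coord} (hx : x ∈ T)
    (i j k : Fin 4) :
    pd k (fun z => g z i j) x
      = (∑ m, christoffel g m k i x * g x m j) + ∑ m, g x i m * christoffel g m k j x := by
  have := congrFun (congrFun (hg.pdMatrix_eq hx k) i) j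
  simpa [pdMatrix, christoffelMatrix, Matrix.mul_apply] using this

/-- Jacobi's formula along a coordinate line: with `Γ` the Christoffel matrix, `tr (g⁻¹ (Γᵀ g + g
Γ)) = 2 tr Γ`. -/
theorem IsLorentzField.hasDerivAt_det_line (hg : IsLorentzField T g) {x : Coord} (hx : x ∈ T)
    (k : Fin 4) :
    HasDerivAt (fun t : ℝ => (g (x + t • Pi.single k (1 : ℝ))).det)
      ((g x).det * (2 * ∑ m, christoffel g m k m x)) 0 := by
  have h1 : ∀ i j, HasDerivAt (fun t : ℝ => g (x + t • Pi.single k (1 : ℝ)) i j)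
      (pdMatrix g k x i j) 0 := by
    intro i j
    have hl : HasDerivAt (fun t : ℝ => x + t • (Pi.single k (1 : ℝ) : Coord))
        (Pi.single k (1 : ℝ)) 0 := by
      simpa using ((hasDerivAt_id (0 : ℝ)).smul_const (Pi.single k (1 : ℝ) : Coord)).const_add x
    have hd : HasFDerivAt (fun z => g z i j) (fderiv ℝ (fun z => g z i j) x)
        (x + (0 : ℝ) • Pi.single k (1 : ℝ)) := by
      simpa using (hg.differentiableAt hx i j).hasFDerivAt
    exact hd.comp_hasDerivAt 0 hl
  have h2 := hasDerivAt_det h1 (by simpa using (hg.det_neg x hx).ne)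
  simp only [zero_smul, add_zero] at h2
  convert h2 using 2
  have htr : ∑ i, ∑ j, (g x)⁻¹ i j * pdMatrix g k x j i
      = ((g x)⁻¹ * pdMatrix g k x).trace := by
    simp [Matrix.trace, Matrix.mul_apply]
  rw [htr, hg.pdMatrix_eq hx, Matrix.mul_add, ← Matrix.mul_assoc, ← Matrix.mul_assoc,
    hg.inv_mul hx, Matrix.one_mul, Matrix.trace_add, Matrix.trace_mul_comm, ← Matrix.mul_assoc,
    hg.mul_inv hx, Matrix.one_mul, Matrix.trace_transpose, two_mul]
  rfl

/-- The density `√(- det g)`. -/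
noncomputable def vol (g : MatField) (x : Coord) : ℝ := Real.sqrt (-(g x).det)

theorem IsLorentzField.vol_pos (hg : IsLorentzField T g) {x : Coord} (hx : x ∈ T) :
    0 < vol g x :=
  Real.sqrt_pos.2 (neg_pos.2 (hg.det_neg x hx))

theorem IsLorentzField.vol_smooth (hg : IsLorentzField T g) : ContDiffOn ℝ ∞ (vol g) T :=
  (contDiffOn_det hg.smooth).neg.sqrt fun x hx => (neg_pos.2 (hg.det_neg x hx)).ne'

theorem IsLorentzField.vol_differentiableAt (hg : IsLorentzField T g) {x : Coord} (hx : x ∈ T) :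
    DifferentiableAt ℝ (vol g) x :=
  (hg.vol_smooth.contDiffAt (hg.isOpen.mem_nhds hx)).differentiableAt (by simp)

/-- `∂_k √(-det g) = √(-det g) γ^m_{km}`. -/
theorem IsLorentzField.pd_vol (hg : IsLorentzField T g) {x : Coord} (hx : x ∈ T) (k : Fin 4) :
    pd k (vol g) x = vol g x * ∑ m, christoffel g m k m x := by
  have hl : HasDerivAt (fun t : ℝ => x + t • (Pi.single k (1 : ℝ) : Coord))
      (Pi.single k (1 : ℝ)) 0 := by
    simpa using ((hasDerivAt_id (0 : ℝ)).smul_const (Pi.single k (1 : ℝ) : Coord)).const_add x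
  have hd : HasFDerivAt (vol g) (fderiv ℝ (vol g) x)
      (x + (0 : ℝ) • Pi.single k (1 : ℝ)) := by
    simpa using (hg.vol_differentiableAt hx).hasFDerivAt
  have h1 : HasDerivAt (fun t : ℝ => vol g (x + t • (Pi.single k (1 : ℝ) : Coord)))
      (pd k (vol g) x) 0 := by
    exact hd.comp_hasDerivAt 0 hl
  have hpos := neg_pos.2 (hg.det_neg x hx)
  have h2 := (hg.hasDerivAt_det_line hx k).neg.sqrt (by simpa using hpos.ne')
  rw [h1.unique h2]
  simp only [zero_smul, add_zero, Pi.neg_apply]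
  rw [vol]
  have h3 : Real.sqrt (-(g x).det) ≠ 0 := (Real.sqrt_pos.2 hpos).ne'
  have h4 := Real.mul_self_sqrt hpos.le
  field_simp
  linear_combination -(∑ m, christoffel g m k m x) * h4

end LorentzField

/-! ### Smoothness of the curvature in families of metrics -/

section Families

variable {Ω : Set (ℝ × Coord)} {G : ℝ → MatField}

/-- Stated for families so that it serves twice: for the varied metrics on `variedDomain`, where
joint smoothness in `(ε, x)` is needed, and for a single metric viewed as a constant family. -/
theorem Smooth₂.christoffel (hΩ : IsOpen Ω)
    (hG : ∀ i j, Smooth₂ Ω fun ε x => G ε x i j) (h0 : ∀ ε x, (ε, x) ∈ Ω → (G ε x).det ≠ 0)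
    (i j k : Fin 4) : Smooth₂ Ω fun ε x => christoffel (G ε) i j k x := by
  refine contDiffOn_const.mul (ContDiffOn.sum fun l _ => ContDiffOn.mul ?_ ?_)
  · exact contDiffOn_inv_apply (m := fun p : ℝ × Coord => G p.1 p.2) hG (fun _ hp => h0 _ _ hp) i l
  · exact (((hG l k).snd hΩ _).add ((hG l j).snd hΩ _)).sub ((hG j k).snd hΩ _)

theorem Smooth₂.ricci (hΩ : IsOpen Ω)
    (hG : ∀ i j, Smooth₂ Ω fun ε x => G ε x i j) (h0 : ∀ ε x, (ε, x) ∈ Ω → (G ε x).det ≠ 0)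
    (j l : Fin 4) : Smooth₂ Ω fun ε x => ricci (G ε) j l x := by
  have hc := Smooth₂.christoffel hΩ hG h0
  exact ContDiffOn.sum fun i _ => (((hc i j l).snd hΩ _).sub ((hc i j i).snd hΩ _)).add
    (ContDiffOn.sum fun h _ => ((hc h j l).mul (hc i h i)).sub ((hc h j i).mul (hc i h l)))

theorem Smooth₂.scalarCurv (hΩ : IsOpen Ω)
    (hG : ∀ i j, Smooth₂ Ω fun ε x => G ε x i j) (h0 : ∀ ε x, (ε, x) ∈ Ω → (G ε x).det ≠ 0) :
    Smooth₂ Ω fun ε x => scalarCurv (G ε) x :=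
  ContDiffOn.sum fun j _ => ContDiffOn.sum fun l _ =>
    (contDiffOn_inv_apply (m := fun p : ℝ × Coord => G p.1 p.2) hG
      (fun _ hp => h0 _ _ hp) j l).mul (Smooth₂.ricci hΩ hG h0 j l)

theorem faraday_smooth {T : Set Coord} (hT : IsOpen T) {A : CovField}
    (hA : ∀ i, ContDiffOn ℝ ∞ (fun x => A x i) T) (i j : Fin 4) :
    ContDiffOn ℝ ∞ (faraday A i j) T :=
  (contDiffOn_fderiv_apply hT (hA j) _).sub (contDiffOn_fderiv_apply hT (hA i) _)

theorem faraday_antisymm (A : CovField) (i j : Fin 4) (x : Coord) :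
    faraday A i j x = -faraday A j i x := by
  simp [faraday]

theorem Smooth₂.faradayNormSq
    (hG : ∀ i j, Smooth₂ Ω fun ε x => G ε x i j) (h0 : ∀ ε x, (ε, x) ∈ Ω → (G ε x).det ≠ 0)
    {T : Set Coord} (hT : IsOpen T) (hΩT : ∀ ε x, (ε, x) ∈ Ω → x ∈ T) {A : CovField}
    (hA : ∀ i, ContDiffOn ℝ ∞ (fun x => A x i) T) :
    Smooth₂ Ω fun ε x => faradayNormSq (G ε) A x := by
  have hF : ∀ i j, Smooth₂ Ω fun (_ : ℝ) x => faraday A i j x := fun i j =>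
    Smooth₂.of_snd (faraday_smooth hT hA i j) hΩT
  have hi := fun i j => contDiffOn_inv_apply (m := fun p : ℝ × Coord => G p.1 p.2) hG
      (fun _ hp => h0 _ _ hp) i j
  exact ContDiffOn.sum fun i _ => ContDiffOn.sum fun j _ => (hi i j).mul
    (ContDiffOn.sum fun l _ => ContDiffOn.sum fun m _ => ((hi l m).mul (hF i l)).mul (hF j m))

variable {T : Set Coord} {g : MatField}

theorem IsLorentzField.prod_isOpen (hg : IsLorentzField T g) :
    IsOpen ((univ : Set ℝ) ×ˢ T) := isOpen_univ.prod hg.isOpen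

theorem IsLorentzField.smooth₂ (hg : IsLorentzField T g) (i j : Fin 4) :
    Smooth₂ ((univ : Set ℝ) ×ˢ T) fun _ x => g x i j :=
  Smooth₂.of_snd (hg.smooth i j) fun _ _ h => h.2

theorem IsLorentzField.christoffel_smooth (hg : IsLorentzField T g) (i j k : Fin 4) :
    ContDiffOn ℝ ∞ (christoffel g i j k) T :=
  ((Smooth₂.christoffel hg.prod_isOpen hg.smooth₂
    (fun _ x h => (hg.det_neg x h.2).ne) i j k).slice 0).mono fun _ h => ⟨trivial, h⟩

theorem IsLorentzField.ricci_smooth (hg : IsLorentzField T g) (i j : Fin 4) :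
    ContDiffOn ℝ ∞ (ricci g i j) T :=
  ((Smooth₂.ricci hg.prod_isOpen hg.smooth₂
    (fun _ x h => (hg.det_neg x h.2).ne) i j).slice 0).mono fun _ h => ⟨trivial, h⟩

theorem IsLorentzField.scalarCurv_smooth (hg : IsLorentzField T g) :
    ContDiffOn ℝ ∞ (scalarCurv g) T :=
  ((Smooth₂.scalarCurv hg.prod_isOpen hg.smooth₂
    (fun _ x h => (hg.det_neg x h.2).ne)).slice 0).mono fun _ h => ⟨trivial, h⟩

theorem IsLorentzField.faradaySq_smooth (hg : IsLorentzField T g) {A : CovField}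
    (hA : ∀ i, ContDiffOn ℝ ∞ (fun x => A x i) T) (i j : Fin 4) :
    ContDiffOn ℝ ∞ (faradaySq g A i j) T :=
  ContDiffOn.sum fun l _ => ContDiffOn.sum fun m _ =>
    ((hg.inv_smooth l m).mul (faraday_smooth hg.isOpen hA i l)).mul
      (faraday_smooth hg.isOpen hA j m)

theorem IsLorentzField.faradayNormSq_smooth (hg : IsLorentzField T g) {A : CovField}
    (hA : ∀ i, ContDiffOn ℝ ∞ (fun x => A x i) T) :
    ContDiffOn ℝ ∞ (faradayNormSq g A) T :=
  ContDiffOn.sum fun i _ => ContDiffOn.sum fun j _ =>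
    (hg.inv_smooth i j).mul (hg.faradaySq_smooth hA i j)

theorem IsLorentzField.faradayMixed_smooth (hg : IsLorentzField T g) {A : CovField}
    (hA : ∀ i, ContDiffOn ℝ ∞ (fun x => A x i) T) (i j : Fin 4) :
    ContDiffOn ℝ ∞ (faradayMixed g A i j) T :=
  ContDiffOn.sum fun h _ => (hg.inv_smooth i h).mul (faraday_smooth hg.isOpen hA h j)

theorem IsLorentzField.faradaySq_comm (hg : IsLorentzField T g) {x : Coord} (hx : x ∈ T)
    (A : CovField) (i j : Fin 4) : faradaySq g A i j x = faradaySq g A j i x := by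
  unfold faradaySq
  rw [Finset.sum_comm]
  exact Finset.sum_congr rfl fun l _ => Finset.sum_congr rfl fun m _ => by
    rw [hg.inv_comm hx l m]; ring

end Families

/-! ### Calculus on the tangent bundle -/

section FibreCalculus

variable {Ω : Set (Coord × Coord)} {f f' : Coord → Coord → ℂ} {x y : Coord}

theorem Smooth₂.dY (hΩ : IsOpen Ω) (hf : Smooth₂ Ω f) (k : Fin 4) : Smooth₂ Ω (dY k f) :=
  hf.snd hΩ _

theorem dX_congr (hΩ : IsOpen Ω) (h : ∀ x y, (x, y) ∈ Ω → f x y = f' x y) (hp : (x, y) ∈ Ω)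
    (k : Fin 4) : dX k f x y = dX k f' x y :=
  pd_congr (s := {z | (z, y) ∈ Ω}) (hΩ.preimage (by fun_prop)) (fun z hz => h z y hz) hp k

theorem dY_congr (hΩ : IsOpen Ω) (h : ∀ x y, (x, y) ∈ Ω → f x y = f' x y) (hp : (x, y) ∈ Ω)
    (k : Fin 4) : dY k f x y = dY k f' x y :=
  pd_congr (s := {w | (x, w) ∈ Ω}) (hΩ.preimage (by fun_prop)) (fun w hw => h x w hw) hp k

theorem dX_add (hΩ : IsOpen Ω) (hf : Smooth₂ Ω f) (hf' : Smooth₂ Ω f') (hp : (x, y) ∈ Ω)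
    (k : Fin 4) : dX k (fun x y => f x y + f' x y) x y = dX k f x y + dX k f' x y :=
  pd_add (hf.differentiableAt_fst hΩ hp) (hf'.differentiableAt_fst hΩ hp) k

theorem dY_add (hΩ : IsOpen Ω) (hf : Smooth₂ Ω f) (hf' : Smooth₂ Ω f') (hp : (x, y) ∈ Ω)
    (k : Fin 4) : dY k (fun x y => f x y + f' x y) x y = dY k f x y + dY k f' x y :=
  pd_add (hf.differentiableAt_snd hΩ hp) (hf'.differentiableAt_snd hΩ hp) k

theorem dX_mul (hΩ : IsOpen Ω) (hf : Smooth₂ Ω f) (hf' : Smooth₂ Ω f') (hp : (x, y) ∈ Ω)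
    (k : Fin 4) :
    dX k (fun x y => f x y * f' x y) x y = dX k f x y * f' x y + f x y * dX k f' x y :=
  pd_mul (hf.differentiableAt_fst hΩ hp) (hf'.differentiableAt_fst hΩ hp) k

theorem dY_mul (hΩ : IsOpen Ω) (hf : Smooth₂ Ω f) (hf' : Smooth₂ Ω f') (hp : (x, y) ∈ Ω)
    (k : Fin 4) :
    dY k (fun x y => f x y * f' x y) x y = dY k f x y * f' x y + f x y * dY k f' x y :=
  pd_mul (hf.differentiableAt_snd hΩ hp) (hf'.differentiableAt_snd hΩ hp) k

theorem dX_const_mul (hΩ : IsOpen Ω) (c : ℂ) (hf : Smooth₂ Ω f) (hp : (x, y) ∈ Ω)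
    (k : Fin 4) : dX k (fun x y => c * f x y) x y = c * dX k f x y :=
  pd_const_mul c (hf.differentiableAt_fst hΩ hp) k

theorem dY_const_mul (hΩ : IsOpen Ω) (c : ℂ) (hf : Smooth₂ Ω f) (hp : (x, y) ∈ Ω)
    (k : Fin 4) : dY k (fun x y => c * f x y) x y = c * dY k f x y :=
  pd_const_mul c (hf.differentiableAt_snd hΩ hp) k

theorem dX_sum (hΩ : IsOpen Ω) {ι : Type*} (s : Finset ι) {F : ι → Coord → Coord → ℂ}
    (hF : ∀ i, Smooth₂ Ω (F i)) (hp : (x, y) ∈ Ω) (k : Fin 4) :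
    dX k (fun x y => ∑ i ∈ s, F i x y) x y = ∑ i ∈ s, dX k (F i) x y :=
  pd_sum s (fun i _ => (hF i).differentiableAt_fst hΩ hp) k

theorem dY_sum (hΩ : IsOpen Ω) {ι : Type*} (s : Finset ι) {F : ι → Coord → Coord → ℂ}
    (hF : ∀ i, Smooth₂ Ω (F i)) (hp : (x, y) ∈ Ω) (k : Fin 4) :
    dY k (fun x y => ∑ i ∈ s, F i x y) x y = ∑ i ∈ s, dY k (F i) x y :=
  pd_sum s (fun i _ => (hF i).differentiableAt_snd hΩ hp) k

theorem dY_comm (hΩ : IsOpen Ω) (hf : Smooth₂ Ω f) (hp : (x, y) ∈ Ω) (j k : Fin 4) :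
    dY k (dY j f) x y = dY j (dY k f) x y :=
  hf.snd_snd_comm hΩ _ _ hp

theorem Smooth₂.ofReal {a : Coord → Coord → ℝ} (ha : Smooth₂ Ω a) :
    Smooth₂ Ω fun x y => (a x y : ℂ) :=
  Complex.ofRealCLM.contDiff.comp_contDiffOn ha

theorem Smooth₂.sum {ι : Type*} (s : Finset ι) {F : ι → Coord → Coord → ℂ}
    (hF : ∀ i, Smooth₂ Ω (F i)) : Smooth₂ Ω fun x y => ∑ i ∈ s, F i x y :=
  ContDiffOn.sum fun i _ => hF i

theorem Smooth₂.mul (hf : Smooth₂ Ω f) (hf' : Smooth₂ Ω f') :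
    Smooth₂ Ω fun x y => f x y * f' x y :=
  ContDiffOn.mul hf hf'

theorem Smooth₂.add (hf : Smooth₂ Ω f) (hf' : Smooth₂ Ω f') :
    Smooth₂ Ω fun x y => f x y + f' x y :=
  ContDiffOn.add hf hf'

theorem Smooth₂.const (c : ℂ) : Smooth₂ Ω fun _ _ => c := contDiffOn_const

theorem dX_ofReal {a : Coord → Coord → ℝ} (hΩ : IsOpen Ω) (ha : Smooth₂ Ω a) (hp : (x, y) ∈ Ω)
    (k : Fin 4) :
    dX k (fun x y => (a x y : ℂ)) x y = ((pd k (fun z => a z y) x : ℝ) : ℂ) :=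
  pd_ofReal (ha.differentiableAt_fst hΩ hp) k

theorem dY_ofReal {a : Coord → Coord → ℝ} (hΩ : IsOpen Ω) (ha : Smooth₂ Ω a) (hp : (x, y) ∈ Ω)
    (k : Fin 4) :
    dY k (fun x y => (a x y : ℂ)) x y = ((pd k (a x) y : ℝ) : ℂ) :=
  pd_ofReal (ha.differentiableAt_snd hΩ hp) k

theorem dY_base (a : Coord → ℂ) (k : Fin 4) : dY k (fun x _ => a x) x y = 0 :=
  pd_const _ _ _

variable {T : Set Coord}

theorem Smooth₂.base (hΩT : ∀ x y, (x, y) ∈ Ω → x ∈ T) {a : Coord → ℝ}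
    (ha : ContDiffOn ℝ ∞ a T) : Smooth₂ Ω fun x (_ : Coord) => a x :=
  Smooth₂.of_fst ha hΩT

theorem Smooth₂.coord (j : Fin 4) : Smooth₂ Ω fun (_ : Coord) (y : Coord) => y j :=
  ((contDiff_apply ℝ ℝ j).comp contDiff_snd).contDiffOn

theorem Smooth₂.linear (hΩT : ∀ x y, (x, y) ∈ Ω → x ∈ T) {a : Fin 4 → Coord → ℝ}
    (ha : ∀ j, ContDiffOn ℝ ∞ (a j) T) : Smooth₂ Ω fun x y => ∑ j, a j x * y j :=
  ContDiffOn.sum fun j _ => ContDiffOn.mul (Smooth₂.base hΩT (ha j)) (Smooth₂.coord j)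

theorem Smooth₂.quadratic (hΩT : ∀ x y, (x, y) ∈ Ω → x ∈ T) {a : Fin 4 → Fin 4 → Coord → ℝ}
    (ha : ∀ i j, ContDiffOn ℝ ∞ (a i j) T) :
    Smooth₂ Ω fun x y => ∑ i, ∑ j, a i j x * y i * y j :=
  ContDiffOn.sum fun i _ => ContDiffOn.sum fun j _ =>
    ContDiffOn.mul (ContDiffOn.mul (Smooth₂.base hΩT (ha i j)) (Smooth₂.coord i)) (Smooth₂.coord j)

theorem pd_linear (a : Fin 4 → ℝ) (k : Fin 4) (y : Coord) :
    pd k (fun w : Coord => ∑ j, a j * w j) y = a k := by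
  rw [pd_sum _ fun j _ => by fun_prop]
  simp_rw [fun j => pd_const_mul (a j) (g := fun w : Coord => w j) (x := y) (by fun_prop) k,
    pd_coord]
  simp

theorem pd_quadratic (a : Fin 4 → Fin 4 → ℝ) (ha : ∀ i j, a i j = a j i) (k : Fin 4) (y : Coord) :
    pd k (fun w : Coord => ∑ i, ∑ j, a i j * w i * w j) y = 2 * ∑ j, a k j * y j := by
  rw [pd_sum _ fun j _ => by fun_prop]
  simp_rw [fun i => pd_sum (Finset.univ : Finset (Fin 4))
    (f := fun j (w : Coord) => a i j * w i * w j) (x := y) (fun j _ => by fun_prop) k]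
  simp_rw [fun i j => pd_mul (f := fun w : Coord => a i j * w i) (g := fun w => w j) (x := y)
    (by fun_prop) (by fun_prop) k,
    fun i j => pd_const_mul (a i j) (g := fun w : Coord => w i) (x := y) (by fun_prop) k, pd_coord]
  simp only [Finset.sum_add_distrib, mul_ite, mul_one, mul_zero, ite_mul, zero_mul]
  rw [Finset.sum_comm]
  simp only [Finset.sum_ite_eq', Finset.mem_univ, if_true]
  rw [two_mul]
  congr 1
  exact Finset.sum_congr rfl fun j _ => by rw [ha j k]

theorem dY_linear (hΩ : IsOpen Ω) (hΩT : ∀ x y, (x, y) ∈ Ω → x ∈ T) {a : Fin 4 → Coord → ℝ}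
    (ha : ∀ j, ContDiffOn ℝ ∞ (a j) T) (hp : (x, y) ∈ Ω) (k : Fin 4) :
    dY k (fun x y => ((∑ j, a j x * y j : ℝ) : ℂ)) x y = (a k x : ℂ) := by
  rw [dY_ofReal hΩ (Smooth₂.linear hΩT ha) hp, pd_linear]

theorem dY_quadratic (hΩ : IsOpen Ω) (hΩT : ∀ x y, (x, y) ∈ Ω → x ∈ T)
    {a : Fin 4 → Fin 4 → Coord → ℝ} (ha : ∀ i j, ContDiffOn ℝ ∞ (a i j) T)
    (hsymm : ∀ x ∈ T, ∀ i j, a i j x = a j i x) (hp : (x, y) ∈ Ω) (k : Fin 4) :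
    dY k (fun x y => ((∑ i, ∑ j, a i j x * y i * y j : ℝ) : ℂ)) x y
      = 2 * ((∑ j, a k j x * y j : ℝ) : ℂ) := by
  rw [dY_ofReal hΩ (Smooth₂.quadratic hΩT ha) hp,
    pd_quadratic (fun i j => a i j x) (hsymm x (hΩT x y hp))]
  push_cast; rfl

/-- This is why the generalized Einstein tensor does not depend on `y`: its fibre Hessians are those
of quadratic forms. -/
theorem dY_dY_quadratic (hΩ : IsOpen Ω) (hΩT : ∀ x y, (x, y) ∈ Ω → x ∈ T)
    {a : Fin 4 → Fin 4 → Coord → ℝ} (ha : ∀ i j, ContDiffOn ℝ ∞ (a i j) T)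
    (hsymm : ∀ x ∈ T, ∀ i j, a i j x = a j i x) (hp : (x, y) ∈ Ω) (j k : Fin 4) :
    dY k (dY j (fun x y => ((∑ i, ∑ j, a i j x * y i * y j : ℝ) : ℂ))) x y
      = 2 * (a j k x : ℂ) := by
  rw [dY_congr hΩ (fun x y h => dY_quadratic hΩ hΩT ha hsymm h j) hp,
    dY_const_mul hΩ _ (Smooth₂.linear hΩT (ha j)).ofReal hp, dY_linear hΩ hΩT (ha j) hp]

theorem dX_linear (hΩ : IsOpen Ω) (hT : IsOpen T) (hΩT : ∀ x y, (x, y) ∈ Ω → x ∈ T)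
    {a : Fin 4 → Coord → ℝ} (ha : ∀ j, ContDiffOn ℝ ∞ (a j) T) (hp : (x, y) ∈ Ω) (k : Fin 4) :
    dX k (fun x y => ((∑ j, a j x * y j : ℝ) : ℂ)) x y = ((∑ j, pd k (a j) x * y j : ℝ) : ℂ) := by
  have hd : ∀ j, DifferentiableAt ℝ (a j) x := fun j =>
    ((ha j).contDiffAt (hT.mem_nhds (hΩT x y hp))).differentiableAt (by simp)
  rw [dX_ofReal hΩ (Smooth₂.linear hΩT ha) hp, pd_sum _ fun j _ => (hd j).mul_const _]
  congr 1
  refine Finset.sum_congr rfl fun j _ => ?_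
  rw [pd_mul (hd j) (by fun_prop), pd_const]; ring

theorem dX_quadratic (hΩ : IsOpen Ω) (hT : IsOpen T) (hΩT : ∀ x y, (x, y) ∈ Ω → x ∈ T)
    {a : Fin 4 → Fin 4 → Coord → ℝ} (ha : ∀ i j, ContDiffOn ℝ ∞ (a i j) T)
    (hp : (x, y) ∈ Ω) (k : Fin 4) :
    dX k (fun x y => ((∑ i, ∑ j, a i j x * y i * y j : ℝ) : ℂ)) x y
      = ((∑ i, ∑ j, pd k (a i j) x * y i * y j : ℝ) : ℂ) := by
  have hd : ∀ i j, DifferentiableAt ℝ (a i j) x := fun i j =>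
    ((ha i j).contDiffAt (hT.mem_nhds (hΩT x y hp))).differentiableAt (by simp)
  have hd' : ∀ i j, DifferentiableAt ℝ (fun z => a i j z * y i * y j) x := fun i j =>
    ((hd i j).mul_const _).mul_const _
  rw [dX_ofReal hΩ (Smooth₂.quadratic hΩT ha) hp,
    pd_sum _ fun i _ => DifferentiableAt.fun_sum fun j _ => hd' i j]
  congr 1
  refine Finset.sum_congr rfl fun i _ => ?_
  rw [pd_sum _ fun j _ => hd' i j]
  refine Finset.sum_congr rfl fun j _ => ?_
  simp only [mul_assoc]
  rw [pd_mul (hd i j) (by fun_prop), pd_const]; ring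

end FibreCalculus

/-! ### The fibre norm -/

section FibreNorm

variable {T : Set Coord} {g : MatField} {x y : Coord}

/-- The part over `T` of the tangent bundle on which `g_{ij} y^i y^j ≠ 0`. -/
def nonnull (T : Set Coord) (g : MatField) : Set (Coord × Coord) :=
  {p | p.1 ∈ T ∧ quad g p.1 p.2 ≠ 0}

theorem nonnull_fst (x y : Coord) (h : (x, y) ∈ nonnull T g) : x ∈ T := h.1

theorem IsLorentzField.quad_smooth (hg : IsLorentzField T g) :
    ContDiffOn ℝ ∞ (fun p : Coord × Coord => quad g p.1 p.2) (T ×ˢ univ) :=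
  Smooth₂.quadratic (T := T) (fun _ _ h => h.1) hg.smooth

theorem IsLorentzField.isOpen_nonnull (hg : IsLorentzField T g) : IsOpen (nonnull T g) := by
  have := hg.quad_smooth.continuousOn.isOpen_inter_preimage (hg.isOpen.prod isOpen_univ)
    (isOpen_compl_singleton (x := (0 : ℝ)))
  have h : nonnull T g = T ×ˢ univ ∩ (fun p : Coord × Coord => quad g p.1 p.2) ⁻¹' {0}ᶜ := by
    ext p
    simp [nonnull]
  rwa [h]

theorem fibreNorm_ne_zero (h : quad g x y ≠ 0) : fibreNorm g x y ≠ 0 := fun h0 => by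
  have := fibreNorm_sq g x y
  rw [h0, zero_pow two_ne_zero] at this
  exact h (by exact_mod_cast this.symm)

/-- `Real.sqrt` is smooth at every nonzero real, being identically zero on the negative ones. Hence
the real part `√q` and the imaginary part `√(-q)` are both smooth off the cone, on either side of
it. -/
theorem IsLorentzField.fibreNorm_smooth (hg : IsLorentzField T g) :
    Smooth₂ (nonnull T g) (fibreNorm g) := by
  have hs : ∀ σ : ℝ, ContDiffOn ℝ ∞ (fun p : Coord × Coord => Real.sqrt (σ * quad g p.1 p.2))
      {p | p.1 ∈ T ∧ σ * quad g p.1 p.2 ≠ 0} := fun σ =>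
    (contDiffOn_const.mul (hg.quad_smooth.mono fun p hp => ⟨hp.1, trivial⟩)).sqrt fun p hp => hp.2
  have hs0 : ∀ σ : ℝ, σ ≠ 0 → ContDiffOn ℝ ∞
      (fun p : Coord × Coord => (Real.sqrt (σ * quad g p.1 p.2) : ℂ)) (nonnull T g) :=
    fun σ hσ => Complex.ofRealCLM.contDiff.comp_contDiffOn
      ((hs σ).mono fun p hp => ⟨hp.1, mul_ne_zero hσ hp.2⟩)
  have h1 := hs0 1 one_ne_zero
  have h2 := hs0 (-1) (by norm_num)
  simp only [one_mul, neg_mul] at h1 h2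
  exact h1.add (contDiffOn_const.mul h2)

/-- `y_j = g_{jk} y^k`. -/
noncomputable def lowerY (g : MatField) (x y : Coord) (j : Fin 4) : ℝ := ∑ k, g x j k * y k

/-- Differentiating `‖y‖ · ‖y‖ = g_{ij} y^i y^j`, instead of the square root itself, treats both
signs of the form at once. -/
theorem IsLorentzField.dY_fibreNorm (hg : IsLorentzField T g) (hp : (x, y) ∈ nonnull T g)
    (k : Fin 4) : dY k (fibreNorm g) x y = (lowerY g x y k : ℂ) * (fibreNorm g x y)⁻¹ := by
  have hΩ := hg.isOpen_nonnull
  have h1 := dY_mul hΩ hg.fibreNorm_smooth hg.fibreNorm_smooth hp k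
  rw [dY_congr hΩ (f' := fun x y => ((∑ i, ∑ j, g x i j * y i * y j : ℝ) : ℂ))
    (fun x y _ => by rw [← sq, fibreNorm_sq]; rfl) hp,
    dY_quadratic hΩ nonnull_fst hg.smooth (fun x hx => hg.apply_comm hx) hp] at h1
  have hN := fibreNorm_ne_zero hp.2
  rw [eq_mul_inv_iff_mul_eq₀ hN, lowerY]
  linear_combination -h1 / 2

theorem IsLorentzField.dX_fibreNorm (hg : IsLorentzField T g) (hp : (x, y) ∈ nonnull T g)
    (k : Fin 4) :
    dX k (fibreNorm g) x y
      = ((∑ i, ∑ j, pd k (fun z => g z i j) x * y i * y j : ℝ) : ℂ) / 2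
        * (fibreNorm g x y)⁻¹ := by
  have hΩ := hg.isOpen_nonnull
  have h1 := dX_mul hΩ hg.fibreNorm_smooth hg.fibreNorm_smooth hp k
  rw [dX_congr hΩ (f' := fun x y => ((∑ i, ∑ j, g x i j * y i * y j : ℝ) : ℂ))
    (fun x y _ => by rw [← sq, fibreNorm_sq]; rfl) hp,
    dX_quadratic hΩ hg.isOpen nonnull_fst hg.smooth hp] at h1
  have hN := fibreNorm_ne_zero hp.2
  rw [eq_mul_inv_iff_mul_eq₀ hN]
  linear_combination -h1 / 2

theorem IsLorentzField.fibreNorm_inv_smooth (hg : IsLorentzField T g) :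
    Smooth₂ (nonnull T g) fun x y => (fibreNorm g x y)⁻¹ :=
  ContDiffOn.inv hg.fibreNorm_smooth fun _ hp => fibreNorm_ne_zero hp.2

/-- Obtained by differentiating `‖y‖ · ‖y‖⁻¹ = 1`. -/
theorem IsLorentzField.dY_fibreNorm_inv (hg : IsLorentzField T g) (hp : (x, y) ∈ nonnull T g)
    (k : Fin 4) :
    dY k (fun x y => (fibreNorm g x y)⁻¹) x y
      = -(lowerY g x y k : ℂ) * (fibreNorm g x y)⁻¹ ^ 3 := by
  have hΩ := hg.isOpen_nonnull
  have hN := fibreNorm_ne_zero hp.2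
  have h1 := dY_mul hΩ hg.fibreNorm_smooth hg.fibreNorm_inv_smooth hp k
  rw [dY_congr hΩ (f' := fun _ _ => 1) (fun x y h => mul_inv_cancel₀ (fibreNorm_ne_zero h.2)) hp,
    dY_base (fun _ => 1), hg.dY_fibreNorm hp] at h1
  have h2 := mul_inv_cancel₀ hN
  linear_combination -(fibreNorm g x y)⁻¹ * h1
    - dY k (fun x y => (fibreNorm g x y)⁻¹) x y * h2

theorem IsLorentzField.dX_fibreNorm_inv (hg : IsLorentzField T g) (hp : (x, y) ∈ nonnull T g)
    (k : Fin 4) :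
    dX k (fun x y => (fibreNorm g x y)⁻¹) x y
      = -(((∑ i, ∑ j, pd k (fun z => g z i j) x * y i * y j : ℝ) : ℂ) / 2)
        * (fibreNorm g x y)⁻¹ ^ 3 := by
  have hΩ := hg.isOpen_nonnull
  have hN := fibreNorm_ne_zero hp.2
  have h1 := dX_mul hΩ hg.fibreNorm_smooth hg.fibreNorm_inv_smooth hp k
  rw [dX_congr hΩ (f' := fun _ _ => 1) (fun x y h => mul_inv_cancel₀ (fibreNorm_ne_zero h.2)) hp,
    show dX k (fun _ _ => (1 : ℂ)) x y = 0 from pd_const _ _ _, hg.dX_fibreNorm hp] at h1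
  have h2 := mul_inv_cancel₀ hN
  linear_combination -(fibreNorm g x y)⁻¹ * h1
    - dX k (fun x y => (fibreNorm g x y)⁻¹) x y * h2

/-- The fibre norm is parallel: `∂_k ‖y‖⁻¹ - γ^h_{km} y^m ∂_{y^h} ‖y‖⁻¹ = 0`. -/
theorem IsLorentzField.horizontal_fibreNorm_inv (hg : IsLorentzField T g)
    (hp : (x, y) ∈ nonnull T g) (k : Fin 4) :
    dX k (fun x y => (fibreNorm g x y)⁻¹) x y
      = ∑ h, ((∑ m, christoffel g h k m x * y m : ℝ) : ℂ)
        * dY h (fun x y => (fibreNorm g x y)⁻¹) x y := by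
  simp_rw [hg.dX_fibreNorm_inv hp, hg.dY_fibreNorm_inv hp]
  have h1 : ∑ i, ∑ j, pd k (fun z => g z i j) x * y i * y j
      = 2 * ∑ h, (∑ m, christoffel g h k m x * y m) * lowerY g x y h := by
    -- Metric compatibility gives two terms, which coincide after exchanging `i` and `j` against the
    -- symmetric factor `y^i y^j`.
    have h2 : ∀ i j, pd k (fun z => g z i j) x * y i * y j
        = ∑ m, (christoffel g m k i x * g x m j * y i * y j
          + christoffel g m k j x * g x m i * y j * y i) := by
      intro i j
      rw [hg.pd_metric hp.1, add_mul, add_mul, Finset.sum_mul, Finset.sum_mul, Finset.sum_mul,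
        Finset.sum_mul, Finset.sum_add_distrib]
      congr 1
      exact Finset.sum_congr rfl fun m _ => by rw [hg.apply_comm hp.1 i m]; ring
    simp_rw [h2, Finset.sum_add_distrib]
    have h3 : ∑ i, ∑ j, ∑ m, christoffel g m k j x * g x m i * y j * y i
        = ∑ i, ∑ j, ∑ m, christoffel g m k i x * g x m j * y i * y j := Finset.sum_comm
    rw [h3, ← two_mul]
    congr 1
    simp_rw [lowerY, Finset.sum_mul_sum]
    rw [Finset.sum_congr rfl fun i _ => Finset.sum_comm, Finset.sum_comm]
    exact Finset.sum_congr rfl fun m _ => Finset.sum_congr rfl fun i _ =>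
      Finset.sum_congr rfl fun j _ => by ring
  rw [h1]
  push_cast
  simp only [Finset.mul_sum, Finset.sum_mul, Finset.sum_div, ← Finset.sum_neg_distrib]
  exact Finset.sum_congr rfl fun i _ => Finset.sum_congr rfl fun j _ => by ring

end FibreNorm

/-! ### Contractions of the Faraday tensor -/

section Contractions

variable {T : Set Coord} {g : MatField} {A : CovField} {x : Coord}

/-- `F^i{}_j y^j`. -/
noncomputable def faradayUp (g : MatField) (A : CovField) (i : Fin 4) (x y : Coord) : ℝ :=
  ∑ j, faradayMixed g A i j x * y j

/-- `F_{ij} y^j`. -/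
noncomputable def faradayDown (A : CovField) (i : Fin 4) (x y : Coord) : ℝ :=
  ∑ j, faraday A i j x * y j

theorem IsLorentzField.sum_inv_mul (hg : IsLorentzField T g) (hx : x ∈ T) (i j : Fin 4) :
    ∑ l, (g x)⁻¹ i l * g x l j = if i = j then 1 else 0 := by
  rw [← Matrix.mul_apply, hg.inv_mul hx, Matrix.one_apply]

theorem IsLorentzField.sum_mul_inv (hg : IsLorentzField T g) (hx : x ∈ T) (i j : Fin 4) :
    ∑ l, g x i l * (g x)⁻¹ l j = if i = j then 1 else 0 := by
  rw [← Matrix.mul_apply, hg.mul_inv hx, Matrix.one_apply]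

theorem IsLorentzField.inv_contract_self (hg : IsLorentzField T g) (hx : x ∈ T) :
    ∑ j, ∑ l, (g x)⁻¹ j l * g x j l = 4 := by
  have h : ∀ j, ∑ l, (g x)⁻¹ j l * g x j l = 1 := fun j => by
    have h0 := hg.sum_inv_mul hx j j
    rw [if_pos rfl] at h0
    rw [← h0]
    exact Finset.sum_congr rfl fun l _ => by rw [hg.apply_comm hx j l]
  simp [h]

theorem IsLorentzField.inv_mul_lowerY (hg : IsLorentzField T g) (hx : x ∈ T) (y : Coord)
    (j : Fin 4) : ∑ l, (g x)⁻¹ j l * lowerY g x y l = y j := by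
  simp_rw [lowerY, Finset.mul_sum]
  rw [Finset.sum_comm]
  simp_rw [← mul_assoc, ← Finset.sum_mul, hg.sum_inv_mul hx]
  simp

theorem sum_lowerY_mul (g : MatField) (x y : Coord) : ∑ j, lowerY g x y j * y j = quad g x y := by
  simp_rw [lowerY, quad, Finset.sum_mul]
  exact Finset.sum_congr rfl fun i _ => Finset.sum_congr rfl fun j _ => by ring

theorem faradayUp_eq (g : MatField) (A : CovField) (i : Fin 4) (x y : Coord) :
    faradayUp g A i x y = ∑ h, (g x)⁻¹ i h * faradayDown A h x y := by
  simp_rw [faradayUp, faradayMixed, faradayDown, Finset.sum_mul, Finset.mul_sum]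
  rw [Finset.sum_comm]
  exact Finset.sum_congr rfl fun i _ => Finset.sum_congr rfl fun j _ => by ring

theorem IsLorentzField.metric_mul_faradayMixed (hg : IsLorentzField T g) (hx : x ∈ T)
    (i j : Fin 4) : ∑ l, g x i l * faradayMixed g A l j x = faraday A i j x := by
  simp_rw [faradayMixed, Finset.mul_sum]
  rw [Finset.sum_comm]
  simp_rw [← mul_assoc, ← Finset.sum_mul, hg.sum_mul_inv hx]
  simp

theorem IsLorentzField.metric_mul_faradayUp (hg : IsLorentzField T g) (hx : x ∈ T) (y : Coord)
    (i : Fin 4) : ∑ l, g x i l * faradayUp g A l x y = faradayDown A i x y := by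
  simp_rw [faradayUp, faradayDown, Finset.mul_sum]
  rw [Finset.sum_comm]
  simp_rw [← mul_assoc, ← Finset.sum_mul, hg.metric_mul_faradayMixed hx]

theorem IsLorentzField.lowerY_mul_faradayMixed (hg : IsLorentzField T g) (hx : x ∈ T) (y : Coord)
    (j : Fin 4) : ∑ i, lowerY g x y i * faradayMixed g A i j x = -faradayDown A j x y := by
  simp_rw [lowerY, Finset.sum_mul]
  rw [Finset.sum_comm]
  have : ∀ k i, g x i k * y k * faradayMixed g A i j x
      = (g x k i * faradayMixed g A i j x) * y k := fun k i => by
    rw [hg.apply_comm hx i k]; ring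
  simp_rw [this, ← Finset.sum_mul, hg.metric_mul_faradayMixed hx, faradayDown,
    ← Finset.sum_neg_distrib]
  exact Finset.sum_congr rfl fun k _ => by rw [faraday_antisymm A k j]; ring

/-- An antisymmetric array contracted with the symmetric `y^i y^j` equals its own negative. -/
theorem sum_faradayDown_mul (A : CovField) (x y : Coord) : ∑ j, faradayDown A j x y * y j = 0 := by
  have h : ∑ j, faradayDown A j x y * y j = -∑ j, faradayDown A j x y * y j := by
    simp_rw [faradayDown, Finset.sum_mul]
    conv_lhs => rw [Finset.sum_comm]
    simp_rw [← Finset.sum_neg_distrib]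
    exact Finset.sum_congr rfl fun i _ => Finset.sum_congr rfl fun j _ => by
      rw [faraday_antisymm A j i]; ring
  linarith

theorem IsLorentzField.sum_lowerY_mul_faradayUp (hg : IsLorentzField T g) (hx : x ∈ T)
    (y : Coord) : ∑ i, lowerY g x y i * faradayUp g A i x y = 0 := by
  simp_rw [faradayUp, Finset.mul_sum]
  rw [Finset.sum_comm]
  simp_rw [← mul_assoc, ← Finset.sum_mul, hg.lowerY_mul_faradayMixed hx, neg_mul,
    Finset.sum_neg_distrib, sum_faradayDown_mul, neg_zero]

theorem IsLorentzField.faradayMixed_trace (hg : IsLorentzField T g) (hx : x ∈ T) :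
    ∑ i, faradayMixed g A i i x = 0 := by
  have h : ∑ i, faradayMixed g A i i x = -∑ i, faradayMixed g A i i x := by
    simp_rw [faradayMixed]
    conv_lhs => rw [Finset.sum_comm]
    simp_rw [← Finset.sum_neg_distrib]
    exact Finset.sum_congr rfl fun i _ => Finset.sum_congr rfl fun j _ => by
      rw [faraday_antisymm A i j, hg.inv_comm hx]; ring
  linarith

/-- Turning both copies of `F` around costs two signs, which cancel. -/
theorem sum_faradaySq (g : MatField) (A : CovField) (x y : Coord) :
    ∑ i, ∑ j, faradaySq g A i j x * y i * y j
      = ∑ i, faradayDown A i x y * faradayUp g A i x y := by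
  have h : ∀ l m, faradayDown A l x y * ((g x)⁻¹ l m * faradayDown A m x y)
      = ∑ i, ∑ j, (g x)⁻¹ l m * faraday A i l x * faraday A j m x * y i * y j := by
    intro l m
    simp_rw [faradayDown, Finset.mul_sum, Finset.sum_mul]
    rw [Finset.sum_comm]
    exact Finset.sum_congr rfl fun i _ => Finset.sum_congr rfl fun j _ => by
      rw [faraday_antisymm A i l, faraday_antisymm A j m]; ring
  simp_rw [faradayUp_eq, Finset.mul_sum, h, faradaySq, Finset.sum_mul]
  rw [Finset.sum_congr rfl fun i _ => Finset.sum_comm, Finset.sum_comm]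
  refine Finset.sum_congr rfl fun l _ => ?_
  rw [Finset.sum_congr rfl fun i _ => Finset.sum_comm, Finset.sum_comm]

/-- Here only one copy of `F` has to be transposed, whence the minus sign. -/
theorem IsLorentzField.faradayMixed_sq_trace (hg : IsLorentzField T g) (hx : x ∈ T) :
    ∑ i, ∑ h, faradayMixed g A i h x * faradayMixed g A h i x = -faradayNormSq g A x := by
  have h : ∀ i h, faradayMixed g A i h x * faradayMixed g A h i x
      = ∑ a, ∑ b, -((g x)⁻¹ i a * ((g x)⁻¹ h b * faraday A a h x * faraday A i b x)) := by
    intro i h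
    simp_rw [faradayMixed, Finset.sum_mul_sum]
    exact Finset.sum_congr rfl fun a _ => Finset.sum_congr rfl fun b _ => by
      rw [faraday_antisymm A b i]; ring
  simp_rw [h, faradayNormSq, faradaySq, Finset.mul_sum, ← Finset.sum_neg_distrib]
  rw [Finset.sum_congr rfl fun i _ => Finset.sum_comm, Finset.sum_comm]
  exact Finset.sum_congr rfl fun a _ => Finset.sum_congr rfl fun i _ =>
    Finset.sum_congr rfl fun h _ => Finset.sum_congr rfl fun b _ => by
      rw [hg.inv_comm hx i a]

end Contractions

/-! ### The electromagnetic part of the spray -/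

section Spray

variable {T : Set Coord} {g : MatField} {A : CovField} {x y : Coord}

theorem IsLorentzField.faradayUp_smooth (hg : IsLorentzField T g)
    (hA : ∀ i, ContDiffOn ℝ ∞ (fun x => A x i) T) (i : Fin 4) :
    Smooth₂ (nonnull T g) (faradayUp g A i) :=
  Smooth₂.linear nonnull_fst fun j => hg.faradayMixed_smooth hA i j

theorem bVec_eq (g : MatField) (A : CovField) (α : ℝ) (i : Fin 4) :
    bVec g A α i = fun x y => -((α : ℂ) / 2) * (fibreNorm g x y * (faradayUp g A i x y : ℂ)) := by
  funext x y
  rw [bVec, faradayUp, mul_assoc]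

theorem IsLorentzField.bVec_smooth (hg : IsLorentzField T g)
    (hA : ∀ i, ContDiffOn ℝ ∞ (fun x => A x i) T) (α : ℝ) (i : Fin 4) :
    Smooth₂ (nonnull T g) (bVec g A α i) := by
  rw [bVec_eq]
  exact (Smooth₂.const _).mul (hg.fibreNorm_smooth.mul (hg.faradayUp_smooth hA i).ofReal)

theorem IsLorentzField.dY_bVec (hg : IsLorentzField T g)
    (hA : ∀ i, ContDiffOn ℝ ∞ (fun x => A x i) T) (α : ℝ) (hp : (x, y) ∈ nonnull T g)
    (i j : Fin 4) :
    dY j (bVec g A α i) x y = -((α : ℂ) / 2) *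
      ((lowerY g x y j : ℂ) * (fibreNorm g x y)⁻¹ * (faradayUp g A i x y : ℂ)
        + fibreNorm g x y * (faradayMixed g A i j x : ℂ)) := by
  have hΩ := hg.isOpen_nonnull
  have hf := hg.faradayUp_smooth hA i
  rw [bVec_eq, dY_const_mul hΩ _ (hg.fibreNorm_smooth.mul hf.ofReal) hp,
    dY_mul hΩ hg.fibreNorm_smooth hf.ofReal hp, hg.dY_fibreNorm hp]
  congr 3
  exact dY_linear hΩ nonnull_fst (fun j => hg.faradayMixed_smooth hA i j) hp j

theorem IsLorentzField.lowerY_smooth (hg : IsLorentzField T g) (j : Fin 4) :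
    Smooth₂ (nonnull T g) fun x y => lowerY g x y j :=
  Smooth₂.linear nonnull_fst fun k => hg.smooth j k

theorem IsLorentzField.dY_dY_bVec (hg : IsLorentzField T g)
    (hA : ∀ i, ContDiffOn ℝ ∞ (fun x => A x i) T) (α : ℝ) (hp : (x, y) ∈ nonnull T g)
    (i j k : Fin 4) :
    dY k (dY j (bVec g A α i)) x y = -((α : ℂ) / 2) *
      ((g x j k : ℂ) * (fibreNorm g x y)⁻¹ * (faradayUp g A i x y : ℂ)
        - (lowerY g x y j : ℂ) * (lowerY g x y k : ℂ) * (fibreNorm g x y)⁻¹ ^ 3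
          * (faradayUp g A i x y : ℂ)
        + (lowerY g x y j : ℂ) * (fibreNorm g x y)⁻¹ * (faradayMixed g A i k x : ℂ)
        + (lowerY g x y k : ℂ) * (fibreNorm g x y)⁻¹ * (faradayMixed g A i j x : ℂ)) := by
  have hΩ := hg.isOpen_nonnull
  have hf := (hg.faradayUp_smooth hA i).ofReal
  have hl := (hg.lowerY_smooth (T := T) j).ofReal
  have hw := hg.fibreNorm_inv_smooth
  have hm : Smooth₂ (nonnull T g) fun x _ => (faradayMixed g A i j x : ℂ) :=
    (Smooth₂.base nonnull_fst (hg.faradayMixed_smooth hA i j)).ofReal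
  rw [dY_congr hΩ (fun x y h => hg.dY_bVec hA α h i j) hp,
    dY_const_mul hΩ _ (((hl.mul hw).mul hf).add (hg.fibreNorm_smooth.mul hm)) hp,
    dY_add hΩ ((hl.mul hw).mul hf) (hg.fibreNorm_smooth.mul hm) hp,
    dY_mul hΩ (hl.mul hw) hf hp, dY_mul hΩ hl hw hp, dY_mul hΩ hg.fibreNorm_smooth hm hp,
    hg.dY_fibreNorm hp, hg.dY_fibreNorm_inv hp, dY_base fun x => (faradayMixed g A i j x : ℂ)]
  have h1 : dY k (fun x y => (lowerY g x y j : ℂ)) x y = (g x j k : ℂ) :=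
    dY_linear hΩ nonnull_fst (fun k => hg.smooth j k) hp k
  have h2 : dY k (fun x y => (faradayUp g A i x y : ℂ)) x y = (faradayMixed g A i k x : ℂ) :=
    dY_linear hΩ nonnull_fst (fun j => hg.faradayMixed_smooth hA i j) hp k
  rw [h1, h2]
  ring

/-- Both contributions vanish by antisymmetry of `F`: differentiating `‖y‖` gives `y_i F^i_j y^j =
0`, and differentiating the linear factor gives `F^i_i = 0`. -/
theorem IsLorentzField.dY_bVec_trace (hg : IsLorentzField T g)
    (hA : ∀ i, ContDiffOn ℝ ∞ (fun x => A x i) T) (α : ℝ) (hp : (x, y) ∈ nonnull T g) :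
    ∑ i, dY i (bVec g A α i) x y = 0 := by
  simp_rw [hg.dY_bVec hA α hp]
  rw [← Finset.mul_sum, Finset.sum_add_distrib, ← Finset.mul_sum]
  have h1 : ∑ i, (lowerY g x y i : ℂ) * (fibreNorm g x y)⁻¹ * (faradayUp g A i x y : ℂ)
      = ((∑ i, lowerY g x y i * faradayUp g A i x y : ℝ) : ℂ) * (fibreNorm g x y)⁻¹ := by
    push_cast
    rw [Finset.sum_mul]
    exact Finset.sum_congr rfl fun i _ => by ring
  have h2 : ∑ i, (faradayMixed g A i i x : ℂ) = 0 := by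
    exact_mod_cast hg.faradayMixed_trace (A := A) hp.1
  rw [h1, h2, hg.sum_lowerY_mul_faradayUp hp.1]
  simp

/-- `B^i_{ji} = 0`. -/
theorem IsLorentzField.dY_dY_bVec_trace (hg : IsLorentzField T g)
    (hA : ∀ i, ContDiffOn ℝ ∞ (fun x => A x i) T) (α : ℝ) (hp : (x, y) ∈ nonnull T g)
    (j : Fin 4) : ∑ i, dY i (dY j (bVec g A α i)) x y = 0 := by
  have hΩ := hg.isOpen_nonnull
  simp_rw [fun i => dY_comm hΩ (hg.bVec_smooth hA α i) hp j i]
  rw [← dY_sum hΩ _ (fun i => (hg.bVec_smooth hA α i).dY hΩ i) hp,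
    dY_congr hΩ (f' := fun _ _ => 0) (fun x y h => hg.dY_bVec_trace hA α h) hp,
    dY_base (fun _ => 0)]

/-- `g^{jl} B^i_{jl} = -(5 α / 2) F^i{}_j y^j / ‖y‖`. -/
theorem IsLorentzField.inv_mul_dY_dY_bVec (hg : IsLorentzField T g)
    (hA : ∀ i, ContDiffOn ℝ ∞ (fun x => A x i) T) (α : ℝ) (hp : (x, y) ∈ nonnull T g)
    (i : Fin 4) :
    ∑ j, ∑ l, ((g x)⁻¹ j l : ℂ) * dY l (dY j (bVec g A α i)) x y
      = -(5 * (α : ℂ) / 2) * ((fibreNorm g x y)⁻¹ * (faradayUp g A i x y : ℂ)) := by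
  set w := (fibreNorm g x y)⁻¹ with hw
  set f := faradayUp g A i x y with hf
  -- The four terms of the second derivative contract to `4`, `-1`, `1` and `1` times the common
  -- factor, using `g^{jl} g_{jl} = 4` and `g^{jl} y_j y_l = ‖y‖²`; this is the origin of the
  -- coefficient `5`.
  have h1 : ∀ j l, ((g x)⁻¹ j l : ℂ) * dY l (dY j (bVec g A α i)) x y
      = -((α : ℂ) / 2) * w * f * (((g x)⁻¹ j l * g x j l : ℝ) : ℂ)
        + ((α : ℂ) / 2) * w ^ 3 * f * (((g x)⁻¹ j l * lowerY g x y l * lowerY g x y j : ℝ) : ℂ)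
        - ((α : ℂ) / 2) * w * (((g x)⁻¹ l j * lowerY g x y j * faradayMixed g A i l x : ℝ) : ℂ)
        - ((α : ℂ) / 2) * w
          * (((g x)⁻¹ j l * lowerY g x y l * faradayMixed g A i j x : ℝ) : ℂ) := by
    intro j l
    rw [hg.dY_dY_bVec hA α hp, hg.inv_comm hp.1 l j]
    push_cast
    ring
  have h2 : ∑ j, ∑ l, (g x)⁻¹ j l * lowerY g x y l * lowerY g x y j = quad g x y := by
    simp_rw [← Finset.sum_mul, hg.inv_mul_lowerY hp.1, ← sum_lowerY_mul, mul_comm]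
  have h3 : ∑ j, ∑ l, (g x)⁻¹ j l * lowerY g x y l * faradayMixed g A i j x = f := by
    simp_rw [← Finset.sum_mul, hg.inv_mul_lowerY hp.1, hf, faradayUp, mul_comm]
  have h4 : ∑ j, ∑ l, (g x)⁻¹ l j * lowerY g x y j * faradayMixed g A i l x = f := by
    rw [Finset.sum_comm, h3]
  simp_rw [h1, Finset.sum_sub_distrib, Finset.sum_add_distrib, ← Finset.mul_sum,
    ← Complex.ofReal_sum, hg.inv_contract_self hp.1, h2, h3, h4]
  rw [← fibreNorm_sq]
  have hN : w * fibreNorm g x y = 1 := inv_mul_cancel₀ (fibreNorm_ne_zero hp.2)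
  push_cast
  linear_combination (α / 2 * w * f * (w * fibreNorm g x y + 1)) * hN

/-- `B^i_h B^h_i` is a quadratic form in `y`. -/
theorem IsLorentzField.bTrace_eq (hg : IsLorentzField T g)
    (hA : ∀ i, ContDiffOn ℝ ∞ (fun x => A x i) T) (α : ℝ) (hp : (x, y) ∈ nonnull T g) :
    bTrace g A α x y = ((∑ i, ∑ j, (-(α ^ 2 / 4) * (2 * faradaySq g A i j x
      + faradayNormSq g A x * g x i j)) * y i * y j : ℝ) : ℂ) := by
  set w := (fibreNorm g x y)⁻¹ with hw
  set N := fibreNorm g x y with hN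
  have hwN : w * N = 1 := inv_mul_cancel₀ (fibreNorm_ne_zero hp.2)
  -- After summation the first product vanishes because `y_i F^i_j y^j = 0`, each of the two cross
  -- terms gives `-F_{il} F_j^l y^i y^j`, and the last gives `-‖y‖² F²`.
  have h1 : ∀ i h, dY h (bVec g A α i) x y * dY i (bVec g A α h) x y
      = (α : ℂ) ^ 2 / 4 * w ^ 2 * (((lowerY g x y i * faradayUp g A i x y)
          * (lowerY g x y h * faradayUp g A h x y) : ℝ) : ℂ)
        + (α : ℂ) ^ 2 / 4 * ((lowerY g x y h * faradayMixed g A h i x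
          * faradayUp g A i x y : ℝ) : ℂ)
        + (α : ℂ) ^ 2 / 4 * ((lowerY g x y i * faradayMixed g A i h x
          * faradayUp g A h x y : ℝ) : ℂ)
        + (α : ℂ) ^ 2 / 4 * N ^ 2 * ((faradayMixed g A i h x * faradayMixed g A h i x : ℝ) : ℂ) := by
    intro i h
    rw [hg.dY_bVec hA α hp, hg.dY_bVec hA α hp]
    push_cast
    linear_combination ((α : ℂ) ^ 2 / 4 * ((lowerY g x y h * faradayMixed g A h i x
          * faradayUp g A i x y : ℂ) + (lowerY g x y i * faradayMixed g A i h x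
          * faradayUp g A h x y : ℂ))) * hwN
  have h2 : ∑ i, ∑ h, lowerY g x y h * faradayMixed g A h i x * faradayUp g A i x y
      = -∑ i, ∑ j, faradaySq g A i j x * y i * y j := by
    simp_rw [← Finset.sum_mul, hg.lowerY_mul_faradayMixed hp.1, sum_faradaySq, neg_mul,
      Finset.sum_neg_distrib]
  have h3 : ∑ i, ∑ h, lowerY g x y i * faradayMixed g A i h x * faradayUp g A h x y
      = -∑ i, ∑ j, faradaySq g A i j x * y i * y j := by
    rw [Finset.sum_comm, h2]
  simp_rw [bTrace, h1, Finset.sum_add_distrib, ← Finset.mul_sum,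
    ← Complex.ofReal_sum, h2, h3, ← Finset.sum_mul_sum, hg.sum_lowerY_mul_faradayUp hp.1,
    hg.faradayMixed_sq_trace hp.1]
  rw [hN, fibreNorm_sq, quad]
  have h4 : ∑ i, ∑ j, (-(α ^ 2 / 4) * (2 * faradaySq g A i j x
      + faradayNormSq g A x * g x i j)) * y i * y j
      = -(α ^ 2 / 4) * (2 * ∑ i, ∑ j, faradaySq g A i j x * y i * y j)
        - α ^ 2 / 4 * (faradayNormSq g A x * ∑ i, ∑ j, g x i j * y i * y j) := by
    simp_rw [Finset.mul_sum, ← Finset.sum_sub_distrib]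
    exact Finset.sum_congr rfl fun i _ => Finset.sum_congr rfl fun j _ => by ring
  rw [h4]
  push_cast
  ring

/-- The norm `B^l B_l` is `(α²/4) ‖y‖²` times the quadratic form of `F_{il} F_j^l`, so the division
by `‖y‖²` leaves a quadratic form, with coefficient `6 · α²/4 = 3α²/2`. -/
theorem IsLorentzField.bScalar_eq (hg : IsLorentzField T g)
    (hA : ∀ i, ContDiffOn ℝ ∞ (fun x => A x i) T) (α : ℝ) (hp : (x, y) ∈ nonnull T g) :
    bScalar g A α x y = ((∑ i, ∑ j, ((3 * α ^ 2 / 2) * faradaySq g A i j x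
      - (α ^ 2 / 8) * (2 * faradaySq g A i j x + faradayNormSq g A x * g x i j))
        * y i * y j : ℝ) : ℂ) := by
  have hN := fibreNorm_ne_zero hp.2
  have h1 : ∑ l, ∑ m, (g x l m : ℂ) * bVec g A α l x y * bVec g A α m x y
      = (α : ℂ) ^ 2 / 4 * fibreNorm g x y ^ 2
        * ((∑ i, ∑ j, faradaySq g A i j x * y i * y j : ℝ) : ℂ) := by
    rw [sum_faradaySq]
    simp_rw [← hg.metric_mul_faradayUp hp.1, Finset.sum_mul, bVec_eq]
    push_cast
    simp_rw [Finset.mul_sum]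
    exact Finset.sum_congr rfl fun i _ => Finset.sum_congr rfl fun j _ => by ring
  rw [bScalar, h1, hg.bTrace_eq hA α hp]
  have h4 : ∑ i, ∑ j, ((3 * α ^ 2 / 2) * faradaySq g A i j x
      - (α ^ 2 / 8) * (2 * faradaySq g A i j x + faradayNormSq g A x * g x i j)) * y i * y j
      = (3 * α ^ 2 / 2) * (∑ i, ∑ j, faradaySq g A i j x * y i * y j)
        + 1 / 2 * ∑ i, ∑ j, (-(α ^ 2 / 4) * (2 * faradaySq g A i j x
      + faradayNormSq g A x * g x i j)) * y i * y j := by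
    simp_rw [Finset.mul_sum, ← Finset.sum_add_distrib]
    exact Finset.sum_congr rfl fun i _ => Finset.sum_congr rfl fun j _ => by ring
  rw [h4]
  push_cast
  field_simp
  ring

theorem IsLorentzField.dY_dY_bTrace (hg : IsLorentzField T g)
    (hA : ∀ i, ContDiffOn ℝ ∞ (fun x => A x i) T) (α : ℝ) (hp : (x, y) ∈ nonnull T g)
    (i j : Fin 4) :
    dY j (dY i (bTrace g A α)) x y = 2 * ((-(α ^ 2 / 4) * (2 * faradaySq g A i j x
      + faradayNormSq g A x * g x i j) : ℝ) : ℂ) := by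
  have hΩ := hg.isOpen_nonnull
  rw [dY_congr hΩ (fun x y h => dY_congr hΩ (fun x y h => hg.bTrace_eq hA α h) h i) hp]
  refine dY_dY_quadratic (a := fun i j x => -(α ^ 2 / 4) * (2 * faradaySq g A i j x
      + faradayNormSq g A x * g x i j)) hΩ nonnull_fst (fun i j => ?_) (fun x hx i j => ?_) hp i j
  · exact contDiffOn_const.mul ((contDiffOn_const.mul (hg.faradaySq_smooth hA i j)).add
      ((hg.faradayNormSq_smooth hA).mul (hg.smooth i j)))
  · rw [hg.faradaySq_comm hx, hg.apply_comm hx]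

theorem IsLorentzField.dY_dY_bScalar (hg : IsLorentzField T g)
    (hA : ∀ i, ContDiffOn ℝ ∞ (fun x => A x i) T) (α : ℝ) (hp : (x, y) ∈ nonnull T g)
    (i j : Fin 4) :
    dY j (dY i (bScalar g A α)) x y = 2 * (((3 * α ^ 2 / 2) * faradaySq g A i j x
      - (α ^ 2 / 8) * (2 * faradaySq g A i j x + faradayNormSq g A x * g x i j) : ℝ) : ℂ) := by
  have hΩ := hg.isOpen_nonnull
  rw [dY_congr hΩ (fun x y h => dY_congr hΩ (fun x y h => hg.bScalar_eq hA α h) h i) hp]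
  refine dY_dY_quadratic (a := fun i j x => (3 * α ^ 2 / 2) * faradaySq g A i j x
      - (α ^ 2 / 8) * (2 * faradaySq g A i j x + faradayNormSq g A x * g x i j))
      hΩ nonnull_fst (fun i j => ?_) (fun x hx i j => ?_) hp i j
  · exact (contDiffOn_const.mul (hg.faradaySq_smooth hA i j)).sub (contDiffOn_const.mul
      ((contDiffOn_const.mul (hg.faradaySq_smooth hA i j)).add
      ((hg.faradayNormSq_smooth hA).mul (hg.smooth i j))))
  · rw [hg.faradaySq_comm hx, hg.apply_comm hx]

/-- The generalized Einstein tensor is the Einstein tensor minus the electromagnetic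
stress-energy tensor. -/
theorem IsLorentzField.genEinstein_eq (hg : IsLorentzField T g)
    (hA : ∀ i, ContDiffOn ℝ ∞ (fun x => A x i) T) {α κ : ℝ} (hα : 3 * α ^ 2 / 2 = κ)
    (hp : (x, y) ∈ nonnull T g) (i j : Fin 4) :
    genEinstein g A α i j x y
      = ((einstein g i j x - 8 * Real.pi * κ * fieldStress g A i j x : ℝ) : ℂ) := by
  -- The Hessian of `½ B^l_h B^h_l` inside `𝓑` cancels the one subtracted in `R̃_{ij}`. Besides the
  -- Einstein tensor there remain `3α² F_{il} F_j^l` and `-(3α²/4) F² g_{ij}`, which together are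
  -- `-8πκ` times the field stress.
  rw [genEinstein, ricciTilde, hg.dY_dY_bTrace hA α hp, hg.dY_dY_bScalar hA α hp, einstein,
    fieldStress, scalarTilde, ← hα]
  have := Real.pi_ne_zero
  push_cast
  field_simp
  ring

end Spray

/-! ### The Ricci scalar of the connection `D` -/

section ScalarCurvature

variable {T : Set Coord} {g : MatField} {A : CovField} {x y : Coord}

theorem IsLorentzField.sprayN_eq (hg : IsLorentzField T g)
    (hA : ∀ i, ContDiffOn ℝ ∞ (fun x => A x i) T) (α : ℝ) (hp : (x, y) ∈ nonnull T g)
    (i j : Fin 4) :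
    sprayN g A α i j x y
      = ((∑ k, christoffel g i j k x * y k : ℝ) : ℂ) + dY j (bVec g A α i) x y := by
  have hΩ := hg.isOpen_nonnull
  have hq : Smooth₂ (nonnull T g) fun x y =>
      ((∑ j, ∑ k, christoffel g i j k x * y j * y k : ℝ) : ℂ) :=
    (Smooth₂.quadratic nonnull_fst fun j k => hg.christoffel_smooth i j k).ofReal
  have h1 := dY_add hΩ (Smooth₂.mul (Smooth₂.const (1 / 2)) hq) (hg.bVec_smooth hA α i) hp j
  rw [dY_const_mul hΩ _ hq hp, dY_quadratic hΩ nonnull_fst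
    (fun j k => hg.christoffel_smooth i j k) (fun x hx => hg.christoffel_comm hx i) hp] at h1
  rw [sprayN]
  refine h1.trans ?_
  ring

theorem IsLorentzField.connD_eq (hg : IsLorentzField T g)
    (hA : ∀ i, ContDiffOn ℝ ∞ (fun x => A x i) T) (α : ℝ) (hp : (x, y) ∈ nonnull T g)
    (i j k : Fin 4) :
    connD g A α i j k x y
      = (christoffel g i j k x : ℂ) + dY k (dY j (bVec g A α i)) x y := by
  have hΩ := hg.isOpen_nonnull
  have hl : Smooth₂ (nonnull T g) fun x y =>
      ((∑ k, christoffel g i j k x * y k : ℝ) : ℂ) :=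
    (Smooth₂.linear nonnull_fst fun k => hg.christoffel_smooth i j k).ofReal
  rw [connD, dY_congr hΩ (fun x y h => hg.sprayN_eq hA α h i j) hp,
    dY_add hΩ hl ((hg.bVec_smooth hA α i).dY hΩ j) hp,
    dY_linear hΩ nonnull_fst (fun k => hg.christoffel_smooth i j k) hp]

/-- The horizontal derivative of the Levi-Civita connection, `∂_k f - γ^h_{km} y^m ∂_{y^h} f`. -/
noncomputable def leviDeriv (g : MatField) (k : Fin 4) (f : Coord → Coord → ℂ) (x y : Coord) : ℂ :=
  dX k f x y - ∑ h, ((∑ m, christoffel g h k m x * y m : ℝ) : ℂ) * dY h f x y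

/-- The adapted derivative is the Levi-Civita one minus `B^h_a ∂_{y^h}`, and the Christoffel part of
the connection is constant along the fibres. This sorts the curvature by degree in `B`. -/
theorem IsLorentzField.hDeriv_connD (hg : IsLorentzField T g)
    (hA : ∀ i, ContDiffOn ℝ ∞ (fun x => A x i) T) (α : ℝ) (hp : (x, y) ∈ nonnull T g)
    (a i j k : Fin 4) :
    hDeriv g A α a (connD g A α i j k) x y
      = ((pd a (christoffel g i j k) x : ℝ) : ℂ)
        + leviDeriv g a (dY k (dY j (bVec g A α i))) x y
        - ∑ h, dY a (bVec g A α h) x y * dY h (dY k (dY j (bVec g A α i))) x y := by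
  have hΩ := hg.isOpen_nonnull
  have hB := ((hg.bVec_smooth hA α i).dY hΩ j).dY hΩ k
  have hγ : Smooth₂ (nonnull T g) fun x _ => (christoffel g i j k x : ℂ) :=
    (Smooth₂.base nonnull_fst (hg.christoffel_smooth i j k)).ofReal
  have h1 : dX a (connD g A α i j k) x y
      = ((pd a (christoffel g i j k) x : ℝ) : ℂ) + dX a (dY k (dY j (bVec g A α i))) x y := by
    rw [dX_congr hΩ (fun x y h => hg.connD_eq hA α h i j k) hp, dX_add hΩ hγ hB hp,
      dX_ofReal hΩ (Smooth₂.base nonnull_fst (hg.christoffel_smooth i j k)) hp]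
  have h2 : ∀ h, dY h (connD g A α i j k) x y = dY h (dY k (dY j (bVec g A α i))) x y := by
    intro h
    rw [dY_congr hΩ (fun x y h => hg.connD_eq hA α h i j k) hp, dY_add hΩ hγ hB hp,
      dY_base fun x => (christoffel g i j k x : ℂ), zero_add]
  rw [hDeriv, h1, leviDeriv]
  simp_rw [h2, hg.sprayN_eq hA α hp, add_mul, Finset.sum_add_distrib]
  ring

theorem dY_sum_sum_mul {Ω : Set (Coord × Coord)} (hΩ : IsOpen Ω)
    {F F' : Fin 4 → Fin 4 → Coord → Coord → ℂ} (hF : ∀ i h, Smooth₂ Ω (F i h))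
    (hF' : ∀ i h, Smooth₂ Ω (F' i h)) (hp : (x, y) ∈ Ω) (k : Fin 4) :
    dY k (fun x y => ∑ i, ∑ h, F i h x y * F' i h x y) x y
      = ∑ i, ∑ h, (dY k (F i h) x y * F' i h x y + F i h x y * dY k (F' i h) x y) := by
  have hS := fun i h => (hF i h).mul (hF' i h)
  rw [dY_sum hΩ _ (fun i => Smooth₂.sum _ fun h => hS i h) hp]
  refine Finset.sum_congr rfl fun i _ => ?_
  rw [dY_sum hΩ _ (fun h => hS i h) hp]
  exact Finset.sum_congr rfl fun h _ => dY_mul hΩ (hF i h) (hF' i h) hp k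

/-- The product rule yields four double sums that agree in pairs after exchanging `i, h` and
commuting derivatives. The pairs are the two kinds of quadratic terms in the Ricci tensor of `D`:
those from `B^h_i ∂_{y^h}` and those from products of connection coefficients. -/
theorem IsLorentzField.dY_bTrace_expand (hg : IsLorentzField T g)
    (hA : ∀ i, ContDiffOn ℝ ∞ (fun x => A x i) T) (α : ℝ) (hp : (x, y) ∈ nonnull T g)
    (j l : Fin 4) :
    dY l (dY j (bTrace g A α)) x y = 2 * ∑ i, ∑ h,
      (dY i (bVec g A α h) x y * dY h (dY l (dY j (bVec g A α i))) x y
        + dY i (dY j (bVec g A α h)) x y * dY l (dY h (bVec g A α i)) x y) := by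
  have hΩ := hg.isOpen_nonnull
  have hB := fun i => hg.bVec_smooth hA α i
  have hB1 := fun i k => (hB i).dY hΩ k
  have hB2 := fun i k m => (hB1 i k).dY hΩ m
  have h1 : ∀ x y, (x, y) ∈ nonnull T g → dY j (bTrace g A α) x y
      = 2 * ∑ i, ∑ h, dY h (dY j (bVec g A α i)) x y * dY i (bVec g A α h) x y := by
    intro x y hp
    refine (dY_sum_sum_mul hΩ (F := fun i h => dY h (bVec g A α i))
      (F' := fun i h => dY i (bVec g A α h)) (fun i h => hB1 i h) (fun i h => hB1 h i) hp j).trans ?_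
    simp_rw [Finset.sum_add_distrib]
    rw [two_mul]
    refine congrArg₂ (· + ·) ?_ ?_
    · exact Finset.sum_congr rfl fun i _ => Finset.sum_congr rfl fun h _ => by
        rw [dY_comm hΩ (hB i) hp h j]
    · rw [Finset.sum_comm]
      exact Finset.sum_congr rfl fun i _ => Finset.sum_congr rfl fun h _ => by
        rw [dY_comm hΩ (hB i) hp h j]; ring
  have hS : Smooth₂ (nonnull T g) fun x y =>
      ∑ i, ∑ h, dY h (dY j (bVec g A α i)) x y * dY i (bVec g A α h) x y :=
    Smooth₂.sum _ fun i => Smooth₂.sum _ fun h => (hB2 i j h).mul (hB1 h i)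
  rw [dY_congr hΩ h1 hp, dY_const_mul hΩ _ hS hp,
    dY_sum_sum_mul hΩ (F := fun i h => dY h (dY j (bVec g A α i)))
      (F' := fun i h => dY i (bVec g A α h)) (fun i h => hB2 i j h) (fun i h => hB1 h i) hp l]
  simp_rw [Finset.sum_add_distrib]
  refine congrArg (2 * ·) (congrArg₂ (· + ·) ?_ ?_)
  · exact Finset.sum_congr rfl fun i _ => Finset.sum_congr rfl fun h _ => by
      rw [dY_comm hΩ (hB1 i j) hp h l]; ring
  · rw [Finset.sum_comm]

/-- The part of the Ricci tensor of `D` that is linear in `B`. -/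
noncomputable def ricciLinear (g : MatField) (A : CovField) (α : ℝ) (j l : Fin 4) (x y : Coord) :
    ℂ :=
  ∑ i, (leviDeriv g i (dY l (dY j (bVec g A α i))) x y
    + ∑ h, (dY l (dY j (bVec g A α h)) x y * (christoffel g i h i x : ℂ)
      - (christoffel g h j i x : ℂ) * dY l (dY h (bVec g A α i)) x y
      - dY i (dY j (bVec g A α h)) x y * (christoffel g i h l x : ℂ)))

/-- Every term containing the trace `B^i_{ji}` or one of its derivatives drops out. The surviving
terms are grouped by degree in `B`, and those of degree two form a fibre Hessian by
`IsLorentzField.dY_bTrace_expand`. -/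
theorem IsLorentzField.ricciD_eq (hg : IsLorentzField T g)
    (hA : ∀ i, ContDiffOn ℝ ∞ (fun x => A x i) T) (α : ℝ) (hp : (x, y) ∈ nonnull T g)
    (j l : Fin 4) :
    ricciD g A α j l x y
      = (ricci g j l x : ℂ) + ricciLinear g A α j l x y
        - (1 / 2) * dY l (dY j (bTrace g A α)) x y := by
  have hΩ := hg.isOpen_nonnull
  have hB2 := fun i k m => ((hg.bVec_smooth hA α i).dY hΩ k).dY hΩ m
  have hB3 := fun i k m n => (hB2 i k m).dY hΩ n
  -- The trace vanishes on the whole open nonnull set, so its `x`- and `y`-derivatives vanish as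
  -- well.
  have hz : ∀ x y, (x, y) ∈ nonnull T g →
      ∑ i, dY i (dY j (bVec g A α i)) x y = 0 := fun x y h => hg.dY_dY_bVec_trace hA α h j
  have hX : ∑ i, dX l (dY i (dY j (bVec g A α i))) x y = 0 := by
    rw [← dX_sum hΩ _ (fun i => hB2 i j i) hp, dX_congr hΩ (f' := fun _ _ => 0) hz hp]
    exact pd_const _ _ _
  have hY : ∀ h, ∑ i, dY h (dY i (dY j (bVec g A α i))) x y = 0 := by
    intro h
    rw [← dY_sum hΩ _ (fun i => hB2 i j i) hp, dY_congr hΩ (f' := fun _ _ => 0) hz hp]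
    exact pd_const _ _ _
  have h1 : ∑ i, hDeriv g A α l (connD g A α i j i) x y
      = ∑ i, ((pd l (christoffel g i j i) x : ℝ) : ℂ) := by
    simp_rw [hg.hDeriv_connD hA α hp, leviDeriv, Finset.sum_sub_distrib, Finset.sum_add_distrib,
      Finset.sum_sub_distrib, hX]
    rw [Finset.sum_comm, Finset.sum_comm (f := fun i h => dY l (bVec g A α h) x y * _)]
    simp_rw [← Finset.mul_sum, hY]
    simp
  have h2 : ∑ i, ∑ h, connD g A α h j l x y * connD g A α i h i x y
      = ∑ i, ∑ h, ((christoffel g h j l x : ℂ) * (christoffel g i h i x : ℂ)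
        + dY l (dY j (bVec g A α h)) x y * (christoffel g i h i x : ℂ)) := by
    rw [Finset.sum_comm, Finset.sum_comm (f := fun i h =>
      (christoffel g h j l x : ℂ) * (christoffel g i h i x : ℂ) + _)]
    refine Finset.sum_congr rfl fun h _ => ?_
    simp_rw [hg.connD_eq hA α hp, ← add_mul, ← Finset.mul_sum, Finset.sum_add_distrib,
      hg.dY_dY_bVec_trace hA α hp h, add_zero]
  have h3 : ricciD g A α j l x y
      = (∑ i, hDeriv g A α i (connD g A α i j l) x y)
        - (∑ i, hDeriv g A α l (connD g A α i j i) x y)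
        + ∑ i, ∑ h, connD g A α h j l x y * connD g A α i h i x y
        - ∑ i, ∑ h, connD g A α h j i x y * connD g A α i h l x y := by
    simp_rw [ricciD, curvD, Finset.sum_add_distrib, Finset.sum_sub_distrib]
    ring
  rw [h3, h1, h2, hg.dY_bTrace_expand hA α hp, ricci, ricciLinear]
  simp_rw [hg.hDeriv_connD hA α hp, hg.connD_eq hA α hp]
  push_cast
  simp only [mul_add, add_mul, Finset.sum_add_distrib, Finset.sum_sub_distrib]
  ring

theorem leviDeriv_const_mul {Ω : Set (Coord × Coord)} (hΩ : IsOpen Ω) (c : ℂ)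
    {f : Coord → Coord → ℂ} (hf : Smooth₂ Ω f) (hp : (x, y) ∈ Ω) (k : Fin 4) :
    leviDeriv g k (fun x y => c * f x y) x y = c * leviDeriv g k f x y := by
  simp_rw [leviDeriv, dX_const_mul hΩ c hf hp, dY_const_mul hΩ c hf hp, mul_sub, Finset.mul_sum]
  congr 1
  exact Finset.sum_congr rfl fun h _ => by ring

theorem leviDeriv_mul {Ω : Set (Coord × Coord)} (hΩ : IsOpen Ω) {f f' : Coord → Coord → ℂ}
    (hf : Smooth₂ Ω f) (hf' : Smooth₂ Ω f') (hp : (x, y) ∈ Ω) (k : Fin 4) :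
    leviDeriv g k (fun x y => f x y * f' x y) x y
      = leviDeriv g k f x y * f' x y + f x y * leviDeriv g k f' x y := by
  simp_rw [leviDeriv, dX_mul hΩ hf hf' hp, dY_mul hΩ hf hf' hp, mul_add, sub_mul, mul_sub,
    Finset.sum_add_distrib, Finset.sum_mul, Finset.mul_sum]
  have h1 : ∀ h, ((∑ m, christoffel g h k m x * y m : ℝ) : ℂ) * (f x y * dY h f' x y)
      = f x y * (((∑ m, christoffel g h k m x * y m : ℝ) : ℂ) * dY h f' x y) := fun h => by ring
  simp_rw [h1, mul_assoc]
  ring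

theorem leviDeriv_sum {Ω : Set (Coord × Coord)} (hΩ : IsOpen Ω) {ι : Type*} (s : Finset ι)
    {F : ι → Coord → Coord → ℂ} (hF : ∀ i, Smooth₂ Ω (F i)) (hp : (x, y) ∈ Ω) (k : Fin 4) :
    leviDeriv g k (fun x y => ∑ i ∈ s, F i x y) x y = ∑ i ∈ s, leviDeriv g k (F i) x y := by
  simp_rw [leviDeriv, dX_sum hΩ s hF hp, dY_sum hΩ s hF hp, Finset.sum_sub_distrib, Finset.mul_sum]
  rw [Finset.sum_comm]

theorem leviDeriv_congr {Ω : Set (Coord × Coord)} (hΩ : IsOpen Ω) {f f' : Coord → Coord → ℂ}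
    (h : ∀ x y, (x, y) ∈ Ω → f x y = f' x y) (hp : (x, y) ∈ Ω) (k : Fin 4) :
    leviDeriv g k f x y = leviDeriv g k f' x y := by
  simp_rw [leviDeriv, dX_congr hΩ h hp, dY_congr hΩ h hp]

/-- Apply the horizontal Levi-Civita derivative to the formula for `g^{jl} B^i_{jl}`. On the right
`‖y‖⁻¹` is parallel, so only `F^i_j y^j` is differentiated; on the left the Leibniz rule produces
the correction with `∂_i g^{jl}`. -/
theorem IsLorentzField.inv_mul_leviDeriv (hg : IsLorentzField T g)
    (hA : ∀ i, ContDiffOn ℝ ∞ (fun x => A x i) T) (α : ℝ) (hp : (x, y) ∈ nonnull T g)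
    (i : Fin 4) :
    ∑ j, ∑ l, ((g x)⁻¹ j l : ℂ) * leviDeriv g i (dY l (dY j (bVec g A α i))) x y
      = -(5 * (α : ℂ) / 2) * (fibreNorm g x y)⁻¹
          * leviDeriv g i (fun x y => (faradayUp g A i x y : ℂ)) x y
        - ∑ j, ∑ l, ((pd i (fun z => (g z)⁻¹ j l) x : ℝ) : ℂ) * dY l (dY j (bVec g A α i)) x y := by
  have hΩ := hg.isOpen_nonnull
  have hB2 := fun i k m => ((hg.bVec_smooth hA α i).dY hΩ k).dY hΩ m
  have hinv : ∀ j l, Smooth₂ (nonnull T g) fun x (_ : Coord) => (g x)⁻¹ j l := fun j l =>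
    Smooth₂.base nonnull_fst (hg.inv_smooth j l)
  have hf := (hg.faradayUp_smooth hA i).ofReal
  have hw := hg.fibreNorm_inv_smooth
  have h1 := leviDeriv_congr (g := g) hΩ (fun x y h => hg.inv_mul_dY_dY_bVec hA α h i) hp i
  rw [leviDeriv_const_mul hΩ _ (hw.mul hf) hp, leviDeriv_mul hΩ hw hf hp,
    show leviDeriv g i (fun x y => (fibreNorm g x y)⁻¹) x y = 0 from
      sub_eq_zero.2 (hg.horizontal_fibreNorm_inv hp i), zero_mul, zero_add,
    leviDeriv_sum hΩ _ (fun j => Smooth₂.sum _ fun l => (hinv j l).ofReal.mul (hB2 i j l)) hp]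
    at h1
  rw [mul_assoc, ← h1, ← Finset.sum_sub_distrib]
  refine Finset.sum_congr rfl fun j _ => ?_
  rw [leviDeriv_sum hΩ _ (fun l => (hinv j l).ofReal.mul (hB2 i j l)) hp,
    ← Finset.sum_sub_distrib]
  refine Finset.sum_congr rfl fun l _ => ?_
  rw [leviDeriv_mul hΩ (hinv j l).ofReal (hB2 i j l) hp]
  have h2 : leviDeriv g i (fun x _ => ((g x)⁻¹ j l : ℂ)) x y
      = ((pd i (fun z => (g z)⁻¹ j l) x : ℝ) : ℂ) := by
    simp_rw [leviDeriv, dY_base fun x => ((g x)⁻¹ j l : ℂ), dX_ofReal hΩ (hinv j l) hp]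
    simp
  rw [h2]
  ring

theorem IsLorentzField.leviDeriv_faradayUp (hg : IsLorentzField T g)
    (hA : ∀ i, ContDiffOn ℝ ∞ (fun x => A x i) T) (hp : (x, y) ∈ nonnull T g) (k i : Fin 4) :
    leviDeriv g k (fun x y => (faradayUp g A i x y : ℂ)) x y
      = ((∑ j, (pd k (faradayMixed g A i j) x
          - ∑ h, christoffel g h k j x * faradayMixed g A i h x) * y j : ℝ) : ℂ) := by
  have hΩ := hg.isOpen_nonnull
  have h1 : dX k (fun x y => (faradayUp g A i x y : ℂ)) x y
      = ((∑ j, pd k (faradayMixed g A i j) x * y j : ℝ) : ℂ) :=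
    dX_linear (a := fun j => faradayMixed g A i j) hΩ hg.isOpen nonnull_fst (fun j => hg.faradayMixed_smooth hA i j) hp k
  have h2 : ∀ h, dY h (fun x y => (faradayUp g A i x y : ℂ)) x y
      = (faradayMixed g A i h x : ℂ) := fun h =>
    dY_linear (a := fun j => faradayMixed g A i j) hΩ nonnull_fst (fun j => hg.faradayMixed_smooth hA i j) hp h
  simp_rw [leviDeriv, h1, h2]
  norm_cast
  simp_rw [sub_mul, Finset.sum_sub_distrib, Finset.sum_mul]
  refine congrArg₂ (· - ·) rfl ?_
  rw [Finset.sum_comm]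
  exact Finset.sum_congr rfl fun j _ => Finset.sum_congr rfl fun h _ => by ring

/-- Pure relabelling of sums over abstract arrays. When `I` is the inverse metric, the bracket in
the last sum is `-∂_i g^{jl}`, which is what cancels the correction in
`IsLorentzField.inv_mul_leviDeriv`. -/
theorem sum_inv_mul_ricciLinear_aux (I : Fin 4 → Fin 4 → ℂ) (γ B L : Fin 4 → Fin 4 → Fin 4 → ℂ)
    (hγ : ∀ i j k, γ i j k = γ i k j) :
    ∑ j, ∑ l, I j l * ∑ i, (L i j l
        + ∑ h, (B h j l * γ i h i - γ h j i * B i h l - B h j i * γ i h l))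
      = ∑ i, ((∑ j, ∑ l, I j l * L i j l) + ∑ h, γ i h i * ∑ j, ∑ l, I j l * B h j l)
        - ∑ i, ∑ j, ∑ l, ((∑ m, I j m * γ l i m) + ∑ m, γ j i m * I m l) * B i j l := by
  have rot : ∀ f : Fin 4 → Fin 4 → Fin 4 → ℂ,
      ∑ j, ∑ l, ∑ i, f i j l = ∑ i, ∑ j, ∑ l, f i j l := fun f => by
    rw [Finset.sum_congr rfl fun j _ => Finset.sum_comm, Finset.sum_comm]
  have e1 : ∑ j, ∑ l, ∑ i, ∑ h, I j l * (B h j l * γ i h i)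
      = ∑ i, ∑ h, ∑ j, ∑ l, γ i h i * (I j l * B h j l) := by
    rw [rot fun i j l => ∑ h, I j l * (B h j l * γ i h i)]
    refine Finset.sum_congr rfl fun i _ => ?_
    rw [rot fun h j l => I j l * (B h j l * γ i h i)]
    exact Finset.sum_congr rfl fun h _ => Finset.sum_congr rfl fun j _ =>
      Finset.sum_congr rfl fun l _ => by ring
  have e2 : ∑ j, ∑ l, ∑ i, ∑ h, I j l * (γ h j i * B i h l)
      = ∑ i, ∑ j, ∑ l, ∑ m, γ j i m * I m l * B i j l := by
    rw [rot fun i j l => ∑ h, I j l * (γ h j i * B i h l)]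
    refine Finset.sum_congr rfl fun i _ => ?_
    rw [rot fun h j l => I j l * (γ h j i * B i h l)]
    refine Finset.sum_congr rfl fun h _ => ?_
    rw [Finset.sum_comm]
    exact Finset.sum_congr rfl fun j _ =>
      Finset.sum_congr rfl fun l _ => by rw [hγ h i l]; ring
  have e3 : ∑ j, ∑ l, ∑ i, ∑ h, I j l * (B h j i * γ i h l)
      = ∑ i, ∑ j, ∑ l, ∑ m, I j m * γ l i m * B i j l := by
    rw [Finset.sum_comm (s := Finset.univ) (t := Finset.univ)
      (f := fun i j => ∑ l, ∑ m, I j m * γ l i m * B i j l)]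
    refine Finset.sum_congr rfl fun j _ => ?_
    rw [Finset.sum_congr rfl fun l _ => Finset.sum_comm, Finset.sum_comm]
    refine Finset.sum_congr rfl fun h _ => ?_
    rw [Finset.sum_comm]
    exact Finset.sum_congr rfl fun i _ => Finset.sum_congr rfl fun l _ => by ring
  simp only [Finset.mul_sum, mul_add, mul_sub, add_mul, Finset.sum_mul, Finset.sum_add_distrib,
    Finset.sum_sub_distrib]
  rw [e1, e2, e3, rot fun i j l => I j l * L i j l]
  ring

/-- The inner sum over `i` is the covariant divergence `∇_i F^i_j`. For the action only the shape of
the result matters: a linear form in `y` divided by `‖y‖`, hence an odd function. -/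
theorem IsLorentzField.inv_mul_ricciLinear (hg : IsLorentzField T g)
    (hA : ∀ i, ContDiffOn ℝ ∞ (fun x => A x i) T) (α : ℝ) (hp : (x, y) ∈ nonnull T g) :
    ∑ j, ∑ l, ((g x)⁻¹ j l : ℂ) * ricciLinear g A α j l x y
      = ((∑ j, (-(5 * α / 2) * ∑ i, (pd i (faradayMixed g A i j) x
          - (∑ h, christoffel g h i j x * faradayMixed g A i h x)
          + ∑ h, christoffel g i h i x * faradayMixed g A h j x)) * y j : ℝ) : ℂ)
        * (fibreNorm g x y)⁻¹ := by
  have h1 := sum_inv_mul_ricciLinear_aux (fun j l => ((g x)⁻¹ j l : ℂ))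
    (fun i j k => (christoffel g i j k x : ℂ)) (fun i j l => dY l (dY j (bVec g A α i)) x y)
    (fun i j l => leviDeriv g i (dY l (dY j (bVec g A α i))) x y)
    (fun i j k => by rw [hg.christoffel_comm hp.1])
  simp_rw [ricciLinear]
  refine h1.trans ?_
  have h2 : ∀ i j l, (∑ m, ((g x)⁻¹ j m : ℂ) * (christoffel g l i m x : ℂ))
      + ∑ m, (christoffel g j i m x : ℂ) * ((g x)⁻¹ m l : ℂ)
      = -((pd i (fun z => (g z)⁻¹ j l) x : ℝ) : ℂ) := fun i j l => by
    rw [hg.pd_inv hp.1]; push_cast; ring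
  simp_rw [h2, hg.inv_mul_leviDeriv hA α hp, hg.inv_mul_dY_dY_bVec hA α hp,
    hg.leviDeriv_faradayUp hA hp]
  have h3 : ∑ j, (-(5 * α / 2) * ∑ i, (pd i (faradayMixed g A i j) x
          - (∑ h, christoffel g h i j x * faradayMixed g A i h x)
          + ∑ h, christoffel g i h i x * faradayMixed g A h j x)) * y j
      = ∑ i, -(5 * α / 2) * ((∑ j, (pd i (faradayMixed g A i j) x
          - ∑ h, christoffel g h i j x * faradayMixed g A i h x) * y j)
          + ∑ h, christoffel g i h i x * faradayUp g A h x y) := by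
    simp_rw [faradayUp, Finset.mul_sum, Finset.sum_mul]
    rw [Finset.sum_comm]
    refine Finset.sum_congr rfl fun i _ => ?_
    rw [Finset.sum_comm (f := fun h j => christoffel g i h i x * (faradayMixed g A h j x * y j)),
      ← Finset.sum_add_distrib, Finset.mul_sum]
    refine Finset.sum_congr rfl fun j _ => ?_
    rw [show ∑ h, christoffel g i h i x * (faradayMixed g A h j x * y j)
      = (∑ h, christoffel g i h i x * faradayMixed g A h j x) * y j by
        rw [Finset.sum_mul]; exact Finset.sum_congr rfl fun h _ => by ring]
    ring
  rw [h3, Complex.ofReal_sum, Finset.sum_mul, sub_eq_iff_eq_add]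
  rw [← Finset.sum_add_distrib]
  refine Finset.sum_congr rfl fun i _ => ?_
  simp_rw [neg_mul, Finset.sum_neg_distrib]
  have h4 : ∑ h, (christoffel g i h i x : ℂ) * (-(5 * (α : ℂ) / 2)
      * ((fibreNorm g x y)⁻¹ * (faradayUp g A h x y : ℂ)))
      = -(5 * (α : ℂ) / 2) * (fibreNorm g x y)⁻¹
        * ∑ h, (christoffel g i h i x : ℂ) * (faradayUp g A h x y : ℂ) := by
    rw [Finset.mul_sum]
    exact Finset.sum_congr rfl fun h _ => by ring
  simp only [neg_mul] at h4
  rw [h4]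
  push_cast
  ring

/-- The Ricci scalar of `D` is `R̃` up to a term that is odd in `y`. -/
theorem IsLorentzField.exists_scalarD_eq (hg : IsLorentzField T g)
    (hA : ∀ i, ContDiffOn ℝ ∞ (fun x => A x i) T) (α : ℝ) (hx : x ∈ T) :
    ∃ b : Fin 4 → ℝ, ∀ y, quad g x y ≠ 0 → scalarD g A α x y
      = (scalarTilde g A α x : ℂ) + ((∑ j, b j * y j : ℝ) : ℂ) * (fibreNorm g x y)⁻¹ := by
  refine ⟨fun j => -(5 * α / 2) * ∑ i, (pd i (faradayMixed g A i j) x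
          - (∑ h, christoffel g h i j x * faradayMixed g A i h x)
          + ∑ h, christoffel g i h i x * faradayMixed g A h j x), fun y hy => ?_⟩
  have hp : (x, y) ∈ nonnull T g := ⟨hx, hy⟩
  have h0 : scalarD g A α x y = (∑ j, ∑ l, ((g x)⁻¹ j l : ℂ) * (ricci g j l x : ℂ))
      + (∑ j, ∑ l, ((g x)⁻¹ j l : ℂ) * ricciLinear g A α j l x y)
      - ∑ j, ∑ l, ((g x)⁻¹ j l : ℂ) * (1 / 2 * dY l (dY j (bTrace g A α)) x y) := by
    simp_rw [scalarD, hg.ricciD_eq hA α hp, mul_sub, mul_add, Finset.sum_sub_distrib,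
      Finset.sum_add_distrib]
  rw [h0, hg.inv_mul_ricciLinear hA α hp]
  have h1 : ∑ j, ∑ l, ((g x)⁻¹ j l : ℂ) * (ricci g j l x : ℂ) = (scalarCurv g x : ℂ) := by
    rw [scalarCurv]; push_cast; rfl
  -- The contraction is `-(α²/4) (2 + 4) F²`, the `4` being `g^{jl} g_{jl}`; this is the source of
  -- `3α²/2`.
  have h2 : ∑ j, ∑ l, ((g x)⁻¹ j l : ℂ) * (1 / 2 * dY l (dY j (bTrace g A α)) x y)
      = -((3 * α ^ 2 / 2 * faradayNormSq g A x : ℝ) : ℂ) := by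
    simp_rw [hg.dY_dY_bTrace hA α hp]
    have h3 : ∀ j l, ((g x)⁻¹ j l : ℂ) * (1 / 2 * (2 * ((-(α ^ 2 / 4) * (2 * faradaySq g A j l x
        + faradayNormSq g A x * g x j l) : ℝ) : ℂ)))
        = ((-(α ^ 2 / 2) * ((g x)⁻¹ j l * faradaySq g A j l x)
          + -(α ^ 2 / 4 * faradayNormSq g A x) * ((g x)⁻¹ j l * g x j l) : ℝ) : ℂ) := fun j l => by
      push_cast; ring
    simp_rw [h3]
    norm_cast
    simp_rw [Finset.sum_add_distrib, ← Finset.mul_sum, hg.inv_contract_self hx]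
    rw [← faradayNormSq]
    ring
  rw [h1, h2, scalarTilde, Complex.ofReal_add]
  ring

end ScalarCurvature

/-! ### Quadratic forms on `ℝ⁴` -/

section QuadraticForms

/-- Spectral theorem, with `Q` the transpose of the eigenvector matrix. Of orthogonality only `|det
Q| = 1` is recorded, which is enough for volume computations. -/
theorem exists_diagonalization {m : Matrix (Fin 4) (Fin 4) ℝ} (hm : m.IsHermitian) :
    ∃ Q : Matrix (Fin 4) (Fin 4) ℝ, |Q.det| = 1 ∧
      (∀ y : Coord, ∑ i, ∑ j, m i j * y i * y j = ∑ i, hm.eigenvalues i * Q.mulVec y i ^ 2) := by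
  set U : Matrix (Fin 4) (Fin 4) ℝ := (hm.eigenvectorUnitary : Matrix (Fin 4) (Fin 4) ℝ) with hU
  have hUU : U * U.transpose = 1 := by
    have := Unitary.coe_mul_star_self hm.eigenvectorUnitary
    rwa [Unitary.coe_star, Matrix.star_eq_conjTranspose,
      Matrix.conjTranspose_eq_transpose_of_trivial] at this
  have hspec : m = U * Matrix.diagonal hm.eigenvalues * U.transpose := by
    have := hm.spectral_theorem
    rw [Unitary.conjStarAlgAut_apply, Matrix.star_eq_conjTranspose,
      Matrix.conjTranspose_eq_transpose_of_trivial] at this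
    exact this
  refine ⟨U.transpose, ?_, fun y => ?_⟩
  · have h := congrArg Matrix.det hUU
    rw [Matrix.det_mul, Matrix.det_transpose, Matrix.det_one] at h
    rw [Matrix.det_transpose]
    rcases mul_self_eq_one_iff.1 h with h | h <;> simp [h]
  · have h1 : ∑ i, ∑ j, m i j * y i * y j = dotProduct y (m.mulVec y) := by
      simp_rw [dotProduct, Matrix.mulVec, dotProduct, Finset.mul_sum]
      exact Finset.sum_congr rfl fun i _ => Finset.sum_congr rfl fun j _ => by ring
    have h2 : m.mulVec y
        = U.mulVec ((Matrix.diagonal hm.eigenvalues).mulVec (U.transpose.mulVec y)) := by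
      rw [Matrix.mulVec_mulVec, Matrix.mulVec_mulVec, ← hspec]
    rw [h1, h2, Matrix.dotProduct_mulVec, ← Matrix.mulVec_transpose, dotProduct]
    exact Finset.sum_congr rfl fun i _ => by rw [Matrix.mulVec_diagonal]; ring

theorem volume_preimage_mulVec {Q : Matrix (Fin 4) (Fin 4) ℝ} (hQ : Q.det ≠ 0) (s : Set Coord) :
    volume ((fun y : Coord => Q.mulVec y) ⁻¹' s) = ENNReal.ofReal |Q.det|⁻¹ * volume s := by
  have := Measure.addHaar_preimage_linearMap (volume : Measure Coord)
    (f := Matrix.toLin' Q) (by rwa [LinearMap.det_toLin']) s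
  rw [LinearMap.det_toLin', abs_inv] at this
  exact this

theorem measurePreserving_mulVec {Q : Matrix (Fin 4) (Fin 4) ℝ} (hQ : |Q.det| = 1) :
    MeasurePreserving (fun y : Coord => Q.mulVec y) := by
  have h0 : Q.det ≠ 0 := fun h => by simp [h] at hQ
  refine ⟨(Continuous.matrix_mulVec continuous_const continuous_id).measurable, ?_⟩
  have := Real.map_matrix_volume_pi_eq_smul_volume_pi h0
  rw [abs_inv, hQ, inv_one, ENNReal.ofReal_one, one_smul] at this
  exact this

/-- The bound is the square of a radius `r` with `r⁴ = 2/π²`, and a Euclidean 4-ball has volume `π²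
r⁴ / 2`, the denominator being `Γ(3) = 2`. -/
theorem volume_unitBall :
    volume {z : Coord | ∑ i, z i ^ 2 ≤ Real.sqrt (2 / Real.pi ^ 2)} = 1 := by
  set r := Real.sqrt (Real.sqrt (2 / Real.pi ^ 2)) with hr
  have hr2 : r ^ 2 = Real.sqrt (2 / Real.pi ^ 2) := Real.sq_sqrt (Real.sqrt_nonneg _)
  have hr4 : r ^ 4 = 2 / Real.pi ^ 2 := by
    rw [show r ^ 4 = (r ^ 2) ^ 2 by ring, hr2, Real.sq_sqrt (by positivity)]
  have h1 : {z : Coord | ∑ i, z i ^ 2 ≤ Real.sqrt (2 / Real.pi ^ 2)}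
      = (WithLp.toLp 2) ⁻¹' (Metric.closedBall (0 : EuclideanSpace ℝ (Fin 4)) r) := by
    ext z
    have hr0 : 0 ≤ r := Real.sqrt_nonneg _
    simp only [mem_ofPred_eq, mem_preimage, mem_closedBall_zero_iff]
    rw [EuclideanSpace.norm_eq, Real.sqrt_le_left hr0, hr2]
    simp
  rw [h1, (PiLp.volume_preserving_toLp (Fin 4)).measure_preimage
    Metric.isClosed_closedBall.measurableSet.nullMeasurableSet, EuclideanSpace.volume_closedBall]
  have hG : Real.Gamma ((Fintype.card (Fin 4) : ℝ) / 2 + 1) = 2 := by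
    have h := Real.Gamma_nat_eq_factorial 2
    norm_num at h ⊢
  have hpi : Real.sqrt Real.pi ^ 4 = Real.pi ^ 2 := by
    rw [show Real.sqrt Real.pi ^ 4 = (Real.sqrt Real.pi ^ 2) ^ 2 by ring,
      Real.sq_sqrt Real.pi_pos.le]
  rw [hG, Fintype.card_fin, ← ENNReal.ofReal_pow (Real.sqrt_nonneg _),
    ← ENNReal.ofReal_mul (by positivity), hr4, hpi]
  have := Real.pi_ne_zero
  rw [show 2 / Real.pi ^ 2 * (Real.pi ^ 2 / 2) = 1 by field_simp, ENNReal.ofReal_one]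

/-- The canonical fibre domain has `v`-volume one. -/
theorem volume_fibreDomain {v : MatField} {x : Coord} (hv : (v x).PosDef) :
    volume (fibreDomain v x) = ENNReal.ofReal (Real.sqrt (v x).det)⁻¹ := by
  obtain ⟨Q, hQ, hq⟩ := exists_diagonalization hv.isHermitian
  -- The map `M` is a square root of the form `v`: the fibre domain is the preimage under `M` of the
  -- Euclidean ball of volume one, and `|det M| = √(det v)`.
  set M := Matrix.diagonal (fun i => Real.sqrt (hv.isHermitian.eigenvalues i)) * Q with hM
  have hpos : ∀ i, 0 < hv.isHermitian.eigenvalues i := hv.eigenvalues_pos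
  have hdet : |M.det| = Real.sqrt (v x).det := by
    have h1 : (v x).det = ∏ i, hv.isHermitian.eigenvalues i := by
      simpa using hv.isHermitian.det_eq_prod_eigenvalues
    rw [hM, Matrix.det_mul, Matrix.det_diagonal, abs_mul, hQ, mul_one,
      abs_of_nonneg (Finset.prod_nonneg fun i _ => Real.sqrt_nonneg _), h1,
      ← Real.sqrt_prod _ fun i _ => (hpos i).le]
  have h0 : M.det ≠ 0 := by
    rw [← abs_ne_zero, hdet]
    exact (Real.sqrt_pos.2 hv.det_pos).ne'
  have hpre : fibreDomain v x = (fun y : Coord => M.mulVec y) ⁻¹'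
      {z : Coord | ∑ i, z i ^ 2 ≤ Real.sqrt (2 / Real.pi ^ 2)} := by
    ext y
    simp only [fibreDomain, quad, mem_ofPred_eq, mem_preimage, hq]
    have : ∀ i, hv.isHermitian.eigenvalues i * Q.mulVec y i ^ 2 = M.mulVec y i ^ 2 := fun i => by
      rw [hM, ← Matrix.mulVec_mulVec, Matrix.mulVec_diagonal, mul_pow, Real.sq_sqrt (hpos i).le]
    simp_rw [this]
  rw [hpre, volume_preimage_mulVec h0, volume_unitBall, mul_one, hdet]

theorem isClosed_fibreDomain (v : MatField) (x : Coord) : IsClosed (fibreDomain v x) := by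
  refine isClosed_le ?_ continuous_const
  unfold quad
  fun_prop

theorem isBounded_fibreDomain {v : MatField} {x : Coord} (hv : (v x).PosDef) :
    Bornology.IsBounded (fibreDomain v x) := by
  obtain ⟨Q, hQ, hq⟩ := exists_diagonalization hv.isHermitian
  have hpos : ∀ i, 0 < hv.isHermitian.eigenvalues i := hv.eigenvalues_pos
  set c := Real.sqrt (2 / Real.pi ^ 2)
  set R := ∑ i, Real.sqrt (c / hv.isHermitian.eigenvalues i) with hR
  have hcont : Continuous fun z : Coord => Q⁻¹.mulVec z := by fun_prop
  refine (((isCompact_closedBall (0 : Coord) R).image hcont).isBounded).subset fun y hy => ?_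
  refine ⟨Q.mulVec y, ?_, ?_⟩
  · rw [mem_closedBall_zero_iff]
    have hR0 : 0 ≤ R := Finset.sum_nonneg fun i _ => Real.sqrt_nonneg _
    refine (pi_norm_le_iff_of_nonneg hR0).2 fun i => ?_
    have hy' : ∑ i, hv.isHermitian.eigenvalues i * Q.mulVec y i ^ 2 ≤ c := by
      rw [← hq]; exact hy
    have h1 : hv.isHermitian.eigenvalues i * Q.mulVec y i ^ 2 ≤ c :=
      (Finset.single_le_sum (f := fun i => hv.isHermitian.eigenvalues i * Q.mulVec y i ^ 2)
        (fun i _ => mul_nonneg (hpos i).le (sq_nonneg _)) (Finset.mem_univ i)).trans hy'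
    calc ‖Q.mulVec y i‖ ≤ Real.sqrt (c / hv.isHermitian.eigenvalues i) := by
          refine Real.abs_le_sqrt ?_
          rw [le_div_iff₀ (hpos i), mul_comm]
          exact h1
      _ ≤ R := Finset.single_le_sum (f := fun i => Real.sqrt (c / hv.isHermitian.eigenvalues i))
          (fun i _ => Real.sqrt_nonneg _) (Finset.mem_univ i)
  · have hu : IsUnit Q.det := isUnit_iff_ne_zero.2 fun h => by simp [h] at hQ
    simp only [Matrix.mulVec_mulVec, Matrix.nonsing_inv_mul _ hu, Matrix.one_mulVec]

end QuadraticForms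

/-! ### Integrability of `‖y‖⁻¹` on the fibres -/

section FibreIntegrability

/-- `z ↦ ((z_j)_{j ≠ i}, z_i - s((z_j)_{j ≠ i}))`. -/
def shear (i : Fin 4) (s : (Fin 3 → ℝ) → ℝ) (z : Coord) : (Fin 3 → ℝ) × ℝ :=
  (i.removeNth z, z i - s (i.removeNth z))

/-- Splitting off one coordinate and swapping the factors preserve volume, and on each line the
remaining map is a translation. -/
theorem measurePreserving_shear (i : Fin 4) {s : (Fin 3 → ℝ) → ℝ} (hs : Continuous s) :
    MeasurePreserving (shear i s) := by
  have h1 := (volume_preserving_piFinSuccAbove (fun _ : Fin 4 => ℝ) i)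
  have h2 : MeasurePreserving (Prod.swap : ℝ × (Fin 3 → ℝ) → (Fin 3 → ℝ) × ℝ)
      (volume.prod volume) (volume.prod volume) := Measure.measurePreserving_swap
  have h3 : MeasurePreserving (fun p : (Fin 3 → ℝ) × ℝ => (p.1, p.2 - s p.1))
      (volume.prod volume) (volume.prod volume) :=
    (MeasurePreserving.id volume).skew_product (g := fun a t => t - s a)
      (by fun_prop) (ae_of_all _ fun a => (measurePreserving_sub_right volume (s a)).map_eq)
  exact (h3.comp h2).comp h1

/-- `|u|^{-1/2}` cut off at `|u| = 1`. -/
noncomputable def cutoff (u : ℝ) : ℝ :=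
  (Icc (-1) 1).indicator (fun u => (Real.sqrt |u|)⁻¹) u

theorem integrable_cutoff : Integrable cutoff := by
  have h1 : IntervalIntegrable (fun u : ℝ => (Real.sqrt |u|)⁻¹) volume 0 1 := by
    refine (intervalIntegral.intervalIntegrable_rpow' (r := -(1 / 2)) (by norm_num)).congr ?_
    intro u hu
    rw [uIoc_of_le zero_le_one] at hu
    simp only
    rw [abs_of_pos hu.1, Real.sqrt_eq_rpow, Real.rpow_neg hu.1.le]
  have h2 : IntervalIntegrable (fun u : ℝ => (Real.sqrt |u|)⁻¹) volume (-1) 0 := by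
    have := (IntervalIntegrable.iff_comp_neg).1 h1
    simp only [abs_neg, neg_zero] at this
    exact this.symm
  have h3 := h2.trans h1
  rw [intervalIntegrable_iff_integrableOn_Icc_of_le (by norm_num)] at h3
  exact (integrable_indicator_iff measurableSet_Icc).2 h3

theorem inv_sqrt_le_cutoff (u : ℝ) : (Real.sqrt |u|)⁻¹ ≤ 1 + cutoff u := by
  by_cases h : u ∈ Icc (-1 : ℝ) 1
  · rw [cutoff, indicator_of_mem h]; linarith
  · rw [cutoff, indicator_of_notMem h, add_zero]
    refine inv_le_one_of_one_le₀ ?_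
    rw [Real.one_le_sqrt]
    rw [mem_Icc, ← abs_le, not_le] at h
    exact h.le

theorem cutoff_nonneg (u : ℝ) : 0 ≤ cutoff u :=
  indicator_nonneg (fun _ _ => by positivity) u

/-- The shear straightens the graph of `s`. On the ball the integrand then agrees with the pullback
of a product: the indicator of a ball in `ℝ³` times an integrable function of one variable. -/
theorem integrableOn_cutoff_shear (i : Fin 4) {s : (Fin 3 → ℝ) → ℝ} (hs : Continuous s) (r : ℝ) :
    IntegrableOn (fun z => cutoff (shear i s z).2) (Metric.closedBall (0 : Coord) r) := by
  have h1 : Integrable (fun p : (Fin 3 → ℝ) × ℝ =>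
      (Metric.closedBall (0 : Fin 3 → ℝ) r).indicator (fun _ => (1 : ℝ)) p.1 * cutoff p.2)
      (volume.prod volume) :=
    ((integrable_indicator_iff Metric.isClosed_closedBall.measurableSet).2
      (integrableOn_const (Metric.isBounded_closedBall.measure_lt_top.ne))).mul_prod
      integrable_cutoff
  have h2 := (measurePreserving_shear i hs).integrable_comp_of_integrable h1
  refine (h2.integrableOn (s := Metric.closedBall (0 : Coord) r)).congr_fun (fun z hz => ?_)
    Metric.isClosed_closedBall.measurableSet
  have hz' : i.removeNth z ∈ Metric.closedBall (0 : Fin 3 → ℝ) r := by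
    rw [mem_closedBall_zero_iff] at hz ⊢
    have h0 : 0 ≤ r := (norm_nonneg z).trans hz
    exact (pi_norm_le_iff_of_nonneg h0).2 fun j => (norm_le_pi_norm z _).trans hz
  simp [shear, indicator_of_mem hz']

/-- `√(-∑_{j ≠ i} (e_j / e_i) z_j²)`, the absolute value of the solution `z_i` of
`∑ e_j z_j² = 0`. -/
noncomputable def nullRoot (e : Fin 4 → ℝ) (i : Fin 4) (z : Fin 3 → ℝ) : ℝ :=
  Real.sqrt (-∑ j, e (i.succAbove j) / e i * z j ^ 2)

theorem continuous_nullRoot (e : Fin 4 → ℝ) (i : Fin 4) : Continuous (nullRoot e i) := by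
  unfold nullRoot; fun_prop

/-- The form is `e_i (z_i² - D)` with `D` independent of `z_i`. If `D ≥ 0` it factors over the roots
`±√D` and equality holds; if `D ≤ 0`, `Real.sqrt` returns `0` and `z_i² ≤ z_i² - D`. -/
theorem abs_diagForm_ge {e : Fin 4 → ℝ} (i : Fin 4) (hi : e i ≠ 0) (z : Coord) :
    |e i| * (|(shear i (nullRoot e i) z).2| * |(shear i (fun w => -nullRoot e i w) z).2|)
      ≤ |∑ j, e j * z j ^ 2| := by
  set D := -∑ j, e (i.succAbove j) / e i * (i.removeNth z) j ^ 2 with hD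
  have h1 : ∑ j, e j * z j ^ 2 = e i * (z i ^ 2 - D) := by
    rw [Fin.sum_univ_succAbove _ i, hD, sub_neg_eq_add, mul_add, Finset.mul_sum]
    congr 1
    refine Finset.sum_congr rfl fun j _ => ?_
    rw [Fin.removeNth]
    field_simp
  have h2 : (shear i (nullRoot e i) z).2 * (shear i (fun w => -nullRoot e i w) z).2
      = z i ^ 2 - Real.sqrt D ^ 2 := by
    simp only [shear, nullRoot, ← hD]; ring
  rw [h1, abs_mul, ← abs_mul (shear i (nullRoot e i) z).2, h2]
  refine mul_le_mul_of_nonneg_left ?_ (abs_nonneg _)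
  rcases le_total 0 D with h | h
  · rw [Real.sq_sqrt h]
  · rw [Real.sqrt_eq_zero_of_nonpos h, zero_pow two_ne_zero, sub_zero, abs_of_nonneg (sq_nonneg _),
      abs_of_nonneg (by nlinarith [sq_nonneg (z i)])]
    linarith

theorem volume_shear_eq_zero (i : Fin 4) {s : (Fin 3 → ℝ) → ℝ} (hs : Continuous s) :
    volume {z : Coord | (shear i s z).2 = 0} = 0 := by
  have h1 : volume ((univ : Set (Fin 3 → ℝ)) ×ˢ ({0} : Set ℝ)) = 0 := by
    rw [Measure.volume_eq_prod, Measure.prod_prod]; simp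
  have h2 := (measurePreserving_shear i hs).measure_preimage
    (MeasurableSet.univ.prod (measurableSet_singleton (0 : ℝ))).nullMeasurableSet
  rw [h1] at h2
  convert h2 using 2
  ext z
  simp

/-- A nondegenerate cone is a null set. -/
theorem volume_diagForm_eq_zero {e : Fin 4 → ℝ} (he : e 0 ≠ 0) :
    volume {z : Coord | ∑ j, e j * z j ^ 2 = 0} = 0 := by
  refine measure_mono_null (fun z hz => ?_) (measure_union_null
    (volume_shear_eq_zero 0 (continuous_nullRoot e 0))
    (volume_shear_eq_zero 0 (continuous_nullRoot e 0).neg))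
  have h := abs_diagForm_ge 0 he z
  rw [mem_ofPred_eq] at hz
  rw [hz, abs_zero] at h
  have h3 : |(shear 0 (nullRoot e 0) z).2| * |(shear 0 (fun w => -nullRoot e 0 w) z).2| = 0 := by
    have hpos := abs_pos.2 he
    have hn : 0 ≤ |(shear 0 (nullRoot e 0) z).2| * |(shear 0 (fun w => -nullRoot e 0 w) z).2| := by
      positivity
    nlinarith
  rcases mul_eq_zero.1 h3 with h4 | h4
  · exact Or.inl (abs_eq_zero.1 h4)
  · exact Or.inr (abs_eq_zero.1 h4)

/-- The larger of `|a|`, `|b|` is at least `n`, so one of the two inverse square roots is absorbed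
by the factor `n` at the cost of `√r`. A single inverse square root remains, controlled even where
both linear factors become small. -/
theorem mul_inv_sqrt_mul_le {n a b r : ℝ} (hn : 0 ≤ n) (hnr : n ≤ r) (ha : a ≠ 0) (hb : b ≠ 0)
    (hab : 2 * n ≤ |a| + |b|) :
    n * (Real.sqrt (|a| * |b|))⁻¹
      ≤ Real.sqrt r * ((Real.sqrt |a|)⁻¹ + (Real.sqrt |b|)⁻¹) := by
  have key : ∀ {a b : ℝ}, b ≠ 0 → n ≤ |b| →
      n * (Real.sqrt (|a| * |b|))⁻¹ ≤ Real.sqrt r * (Real.sqrt |a|)⁻¹ := by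
    intro a b hb h
    have hb' : 0 < Real.sqrt |b| := Real.sqrt_pos.2 (abs_pos.2 hb)
    have h1 : n ≤ Real.sqrt r * Real.sqrt |b| := by
      rw [← Real.sqrt_mul (hn.trans hnr)]
      refine Real.le_sqrt_of_sq_le ?_
      nlinarith
    rw [Real.sqrt_mul (abs_nonneg a), mul_inv]
    calc n * ((Real.sqrt |a|)⁻¹ * (Real.sqrt |b|)⁻¹)
        ≤ Real.sqrt r * Real.sqrt |b| * ((Real.sqrt |a|)⁻¹ * (Real.sqrt |b|)⁻¹) :=
          mul_le_mul_of_nonneg_right h1 (by positivity)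
      _ = Real.sqrt r * (Real.sqrt |a|)⁻¹ := by field_simp
  rcases le_total |a| |b| with h | h
  · refine (key hb (by linarith)).trans (mul_le_mul_of_nonneg_left ?_ (Real.sqrt_nonneg _))
    have : 0 ≤ (Real.sqrt |b|)⁻¹ := by positivity
    linarith
  · rw [mul_comm |a|]
    refine (key ha (by linarith)).trans (mul_le_mul_of_nonneg_left ?_ (Real.sqrt_nonneg _))
    have : 0 ≤ (Real.sqrt |a|)⁻¹ := by positivity
    linarith

/-- `|z| / √|∑ e_j z_j²|` is bounded on bounded sets by an integrable function. -/
theorem norm_div_sqrt_diagForm_le {e : Fin 4 → ℝ} (he : ∀ i, e i ≠ 0) {r : ℝ} {z : Coord}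
    (hz : ‖z‖ ≤ r) (h1 : ∀ i, (shear i (nullRoot e i) z).2 ≠ 0)
    (h2 : ∀ i, (shear i (fun w => -nullRoot e i w) z).2 ≠ 0) :
    ‖z‖ * (Real.sqrt |∑ j, e j * z j ^ 2|)⁻¹
      ≤ ∑ i, (Real.sqrt |e i|)⁻¹ * (Real.sqrt r *
        ((1 + cutoff (shear i (nullRoot e i) z).2)
          + (1 + cutoff (shear i (fun w => -nullRoot e i w) z).2))) := by
  -- Factoring the form in the coordinate of largest modulus makes the sup norm equal to `|z_i|`,
  -- while the two shears satisfy `a + b = 2 z_i`. As `i` depends on `z`, the bound is summed over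
  -- all `i`.
  obtain ⟨i, hi⟩ := Finite.exists_max fun i => ‖z i‖
  have hni : ‖z‖ = |z i| :=
    le_antisymm ((pi_norm_le_iff_of_nonneg (norm_nonneg _)).2 hi) (norm_le_pi_norm z i)
  set a := (shear i (nullRoot e i) z).2 with ha
  set b := (shear i (fun w => -nullRoot e i w) z).2 with hb
  have hab : 2 * ‖z‖ ≤ |a| + |b| := by
    rw [hni]
    calc 2 * |z i| = |a + b| := by
          rw [ha, hb, shear, shear, ← abs_two, ← abs_mul]; congr 1; ring
      _ ≤ |a| + |b| := abs_add_le _ _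
  have hq := abs_diagForm_ge i (he i) z
  rw [← ha, ← hb] at hq
  have hpos : 0 < |e i| * (|a| * |b|) :=
    mul_pos (abs_pos.2 (he i)) (mul_pos (abs_pos.2 (h1 i)) (abs_pos.2 (h2 i)))
  have hinv : (Real.sqrt |∑ j, e j * z j ^ 2|)⁻¹
      ≤ (Real.sqrt |e i|)⁻¹ * (Real.sqrt (|a| * |b|))⁻¹ := by
    rw [← mul_inv, ← Real.sqrt_mul (abs_nonneg _)]
    exact inv_anti₀ (Real.sqrt_pos.2 hpos) (Real.sqrt_le_sqrt hq)
  calc ‖z‖ * (Real.sqrt |∑ j, e j * z j ^ 2|)⁻¹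
      ≤ ‖z‖ * ((Real.sqrt |e i|)⁻¹ * (Real.sqrt (|a| * |b|))⁻¹) :=
        mul_le_mul_of_nonneg_left hinv (norm_nonneg _)
    _ = (Real.sqrt |e i|)⁻¹ * (‖z‖ * (Real.sqrt (|a| * |b|))⁻¹) := by ring
    _ ≤ (Real.sqrt |e i|)⁻¹ * (Real.sqrt r * ((1 + cutoff a) + (1 + cutoff b))) := by
        refine mul_le_mul_of_nonneg_left ?_ (by positivity)
        refine (mul_inv_sqrt_mul_le (norm_nonneg _) hz (h1 i) (h2 i) hab).trans ?_
        exact mul_le_mul_of_nonneg_left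
          (add_le_add (inv_sqrt_le_cutoff _) (inv_sqrt_le_cutoff _)) (Real.sqrt_nonneg _)
    _ ≤ _ := Finset.single_le_sum (f := fun i => (Real.sqrt |e i|)⁻¹ * (Real.sqrt r *
        ((1 + cutoff (shear i (nullRoot e i) z).2)
          + (1 + cutoff (shear i (fun w => -nullRoot e i w) z).2)))) (fun i _ => by
            have := cutoff_nonneg (shear i (nullRoot e i) z).2
            have := cutoff_nonneg (shear i (fun w => -nullRoot e i w) z).2
            positivity) (Finset.mem_univ i)

theorem integrableOn_norm_div_sqrt_diagForm {e : Fin 4 → ℝ} (he : ∀ i, e i ≠ 0) (r : ℝ) :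
    IntegrableOn (fun z : Coord => ‖z‖ * (Real.sqrt |∑ j, e j * z j ^ 2|)⁻¹)
      (Metric.closedBall 0 r) := by
  have hconst : IntegrableOn (fun _ : Coord => (1 : ℝ)) (Metric.closedBall 0 r) :=
    integrableOn_const (Metric.isBounded_closedBall.measure_lt_top.ne)
  have hbound : IntegrableOn (fun z : Coord => ∑ i, (Real.sqrt |e i|)⁻¹ * (Real.sqrt r *
        ((1 + cutoff (shear i (nullRoot e i) z).2)
          + (1 + cutoff (shear i (fun w => -nullRoot e i w) z).2)))) (Metric.closedBall 0 r) :=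
    integrable_finsetSum _ fun i _ => (((hconst.add
      (integrableOn_cutoff_shear i (continuous_nullRoot e i) r)).add (hconst.add
      (integrableOn_cutoff_shear i (continuous_nullRoot e i).neg r))).const_mul _).const_mul _
  refine Integrable.mono' hbound ?_ ?_
  · refine Measurable.aestronglyMeasurable ?_
    fun_prop
  -- The pointwise bound requires nonvanishing factors; their zero sets are graphs, hence null.
  · have hae : ∀ᵐ z : Coord, ∀ i, (shear i (nullRoot e i) z).2 ≠ 0
        ∧ (shear i (fun w => -nullRoot e i w) z).2 ≠ 0 := by
      refine ae_all_iff.2 fun i => Filter.Eventually.and ?_ ?_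
      · exact compl_mem_ae_iff.2 (volume_shear_eq_zero i (continuous_nullRoot e i))
      · exact compl_mem_ae_iff.2 (volume_shear_eq_zero i (continuous_nullRoot e i).neg)
    filter_upwards [ae_restrict_of_ae hae,
      ae_restrict_mem Metric.isClosed_closedBall.measurableSet] with z hz hzr
    rw [Real.norm_of_nonneg (by positivity)]
    exact norm_div_sqrt_diagForm_le he (by simpa using hzr) (fun i => (hz i).1) fun i => (hz i).2

theorem eigenvalues_ne_zero {m : Matrix (Fin 4) (Fin 4) ℝ} (hm : m.IsHermitian)
    (h0 : m.det ≠ 0) (i : Fin 4) : hm.eigenvalues i ≠ 0 := fun h => h0 (by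
  rw [hm.det_eq_prod_eigenvalues]
  exact Finset.prod_eq_zero (Finset.mem_univ i) (by simp [h]))

/-- The diagonal case is transported by the volume-preserving change of basis. The sup norm is not
invariant under it, which costs the operator norms of `Q` and `Q⁻¹`. -/
theorem integrableOn_norm_div_sqrt_quad {m : Matrix (Fin 4) (Fin 4) ℝ} (hm : m.IsHermitian)
    (h0 : m.det ≠ 0) (r : ℝ) :
    IntegrableOn (fun y : Coord => ‖y‖ * (Real.sqrt |∑ i, ∑ j, m i j * y i * y j|)⁻¹)
      (Metric.closedBall 0 r) := by
  obtain ⟨Q, hQ, hq⟩ := exists_diagonalization hm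
  have hu : IsUnit Q.det := isUnit_iff_ne_zero.2 fun h => by simp [h] at hQ
  set L := (Matrix.toLin' Q).toContinuousLinearMap
  set L' := (Matrix.toLin' Q⁻¹).toContinuousLinearMap
  have hLL' : ∀ y, L' (L y) = y := fun y => by
    change Q⁻¹.mulVec (Q.mulVec y) = y
    rw [Matrix.mulVec_mulVec, Matrix.nonsing_inv_mul _ hu, Matrix.one_mulVec]
  have h1 := (integrableOn_norm_div_sqrt_diagForm (eigenvalues_ne_zero hm h0) (‖L‖ * r))
  have h2 := (measurePreserving_mulVec hQ).integrable_comp_of_integrable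
    ((integrable_indicator_iff Metric.isClosed_closedBall.measurableSet).2 h1)
  refine Integrable.mono' ((h2.const_mul ‖L'‖).integrableOn) ?_ ?_
  · refine Measurable.aestronglyMeasurable ?_
    fun_prop
  · filter_upwards [ae_restrict_mem Metric.isClosed_closedBall.measurableSet] with y hy
    have hmem : Q.mulVec y ∈ Metric.closedBall (0 : Coord) (‖L‖ * r) := by
      rw [mem_closedBall_zero_iff] at hy ⊢
      exact (L.le_opNorm y).trans (mul_le_mul_of_nonneg_left hy (norm_nonneg _))
    rw [Real.norm_of_nonneg (by positivity), Function.comp_apply, indicator_of_mem hmem, hq,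
      ← mul_assoc]
    refine mul_le_mul_of_nonneg_right ?_ (by positivity)
    calc ‖y‖ = ‖L' (L y)‖ := by rw [hLL']
      _ ≤ ‖L'‖ * ‖L y‖ := L'.le_opNorm _

theorem volume_quad_eq_zero {m : Matrix (Fin 4) (Fin 4) ℝ} (hm : m.IsHermitian)
    (h0 : m.det ≠ 0) : volume {y : Coord | ∑ i, ∑ j, m i j * y i * y j = 0} = 0 := by
  obtain ⟨Q, hQ, hq⟩ := exists_diagonalization hm
  have he := eigenvalues_ne_zero hm h0 0
  simp_rw [hq]
  have h1 := volume_diagForm_eq_zero (e := hm.eigenvalues) he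
  rw [← (measurePreserving_mulVec hQ).measure_preimage] at h1
  · exact h1
  · refine (IsClosed.measurableSet ?_).nullMeasurableSet
    exact isClosed_eq (by fun_prop) continuous_const

end FibreIntegrability

/-! ### The gravitational action after integration over the fibres -/

section FibreIntegral

variable {T : Set Coord} {g v : MatField} {A : CovField} {x : Coord}

theorem quad_neg (g : MatField) (x y : Coord) : quad g x (-y) = quad g x y := by
  simp [quad]

theorem fibreNorm_neg (g : MatField) (x y : Coord) : fibreNorm g x (-y) = fibreNorm g x y := by
  simp [fibreNorm, quad_neg]

theorem norm_fibreNorm (g : MatField) (x y : Coord) :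
    ‖fibreNorm g x y‖ = Real.sqrt |quad g x y| := by
  rw [eq_comm, Real.sqrt_eq_iff_mul_self_eq (abs_nonneg _) (norm_nonneg _), ← sq, ← norm_pow,
    fibreNorm_sq, Complex.norm_real, Real.norm_eq_abs]

theorem continuous_quad (g : MatField) (x : Coord) : Continuous (quad g x) := by
  unfold quad; fun_prop

theorem continuous_fibreNorm (g : MatField) (x : Coord) : Continuous (fibreNorm g x) := by
  have := continuous_quad g x
  unfold fibreNorm; fun_prop

theorem IsLorentzField.ae_quad_ne_zero (hg : IsLorentzField T g) (hx : x ∈ T) :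
    ∀ᵐ y : Coord, quad g x y ≠ 0 := by
  have hm : (g x).IsHermitian := by
    rw [Matrix.IsHermitian, Matrix.conjTranspose_eq_transpose_of_trivial, (hg.symm x hx).eq]
  exact compl_mem_ae_iff.2 (volume_quad_eq_zero hm (hg.det_neg x hx).ne)

theorem IsLorentzField.integrableOn_linear_div_fibreNorm (hg : IsLorentzField T g) (hx : x ∈ T)
    (b : Fin 4 → ℝ) {s : Set Coord} (hs : Bornology.IsBounded s) :
    IntegrableOn (fun y : Coord => ((∑ j, b j * y j : ℝ) : ℂ) * (fibreNorm g x y)⁻¹) s := by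
  have hm : (g x).IsHermitian := by
    rw [Matrix.IsHermitian, Matrix.conjTranspose_eq_transpose_of_trivial, (hg.symm x hx).eq]
  obtain ⟨r, hr⟩ := hs.subset_closedBall 0
  refine IntegrableOn.mono_set ?_ hr
  refine Integrable.mono' ((integrableOn_norm_div_sqrt_quad hm (hg.det_neg x hx).ne r).const_mul
    (∑ j, |b j|)) ?_ (ae_of_all _ fun y => ?_)
  · have hN := (continuous_fibreNorm g x).measurable
    have hl : Continuous fun y : Coord => ((∑ j, b j * y j : ℝ) : ℂ) := by fun_prop
    exact (hl.measurable.mul hN.inv).aestronglyMeasurable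
  · rw [norm_mul, norm_inv, norm_fibreNorm, Complex.norm_real, Real.norm_eq_abs, ← mul_assoc]
    refine mul_le_mul_of_nonneg_right ?_ (by positivity)
    rw [Finset.sum_mul]
    refine (Finset.abs_sum_le_sum_abs _ _).trans (Finset.sum_le_sum fun j _ => ?_)
    rw [abs_mul]
    exact mul_le_mul_of_nonneg_left (norm_le_pi_norm y j) (abs_nonneg _)

theorem setIntegral_eq_zero_of_odd {E : Type*} [NormedAddCommGroup E] [NormedSpace ℝ E]
    {f : Coord → E} {s : Set Coord}
    (hs : MeasurableSet s) (hneg : ∀ y, -y ∈ s ↔ y ∈ s) (hf : ∀ y, f (-y) = -f y) :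
    ∫ y in s, f y = 0 := by
  rw [← integral_indicator hs]
  have h1 : ∀ y, s.indicator f (-y) = -s.indicator f y := fun y => by
    by_cases h : y ∈ s
    · rw [indicator_of_mem h, indicator_of_mem ((hneg y).2 h), hf]
    · rw [indicator_of_notMem h, indicator_of_notMem (fun h' => h ((hneg y).1 h')), neg_zero]
  have h2 := integral_neg_eq_self (s.indicator f) volume
  simp_rw [h1, integral_neg] at h2
  have h3 : (2 : ℝ) • ∫ y, s.indicator f y = 0 := by
    rw [two_smul]; nth_rewrite 1 [← h2]; simp
  exact (smul_eq_zero.1 h3).resolve_left two_ne_zero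

/-- The integral of the Ricci scalar of `D` over a fibre. -/
theorem IsLorentzField.integral_scalarD (hg : IsLorentzField T g)
    (hA : ∀ i, ContDiffOn ℝ ∞ (fun x => A x i) T) (α : ℝ) (hx : x ∈ T) (hv : (v x).PosDef)
    (hdet : (v x).det = |(g x).det|) :
    ∫ y in fibreDomain v x, scalarD g A α x y * (Real.sqrt (-(g x).det * (v x).det) : ℂ)
      = ((scalarTilde g A α x * vol g x : ℝ) : ℂ) := by
  obtain ⟨b, hb⟩ := hg.exists_scalarD_eq hA α hx
  have hms := (isClosed_fibreDomain v x).measurableSet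
  have hbd := isBounded_fibreDomain hv
  have h1 : ∫ y in fibreDomain v x, scalarD g A α x y
      = ∫ y in fibreDomain v x, ((scalarTilde g A α x : ℂ)
        + ((∑ j, b j * y j : ℝ) : ℂ) * (fibreNorm g x y)⁻¹) := by
    refine integral_congr_ae ?_
    filter_upwards [ae_restrict_of_ae (hg.ae_quad_ne_zero hx)] with y hy
    exact hb y hy
  have hodd : ∫ y in fibreDomain v x, ((∑ j, b j * y j : ℝ) : ℂ) * (fibreNorm g x y)⁻¹ = 0 := by
    refine setIntegral_eq_zero_of_odd hms (fun y => ?_) fun y => ?_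
    · simp [fibreDomain, quad_neg]
    · rw [fibreNorm_neg]; simp
  have hc : Integrable (fun _ : Coord => (scalarTilde g A α x : ℂ))
      (volume.restrict (fibreDomain v x)) :=
    integrableOn_const hbd.measure_lt_top.ne
  -- Consequently the density `√(-det g · det v)` is `det v`; times the fibre volume `1/√(det v)` it
  -- leaves `√(det v) = √(-det g)`.
  have hdg : -(g x).det = (v x).det := by rw [hdet, abs_of_neg (hg.det_neg x hx)]
  have hpos : 0 < (v x).det := hv.det_pos
  rw [integral_mul_const, h1, integral_add hc
    (hg.integrableOn_linear_div_fibreNorm hx b hbd), hodd, add_zero, setIntegral_const, vol, hdg,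
    Measure.real, volume_fibreDomain hv, ENNReal.toReal_ofReal (by positivity),
    Real.sqrt_mul_self hpos.le, Complex.real_smul]
  have h2 := Real.mul_self_sqrt hpos.le
  have h3 : Real.sqrt (v x).det ≠ 0 := (Real.sqrt_pos.2 hpos).ne'
  norm_cast
  field_simp
  rw [sq, h2, mul_comm]

/-- The gravitational action as an integral over space-time. -/
theorem IsLorentzField.actionFG_eq (hg : IsLorentzField T g)
    (hA : ∀ i, ContDiffOn ℝ ∞ (fun x => A x i) T) {K : Set Coord} (hK : MeasurableSet K)
    (hKT : K ⊆ T) (hv : IsVerticalMetric K g v) (c k α : ℝ) :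
    actionFG c k K A α g v
      = ((-(c ^ 3 / (16 * Real.pi * k)) * ∫ x in K, scalarTilde g A α x * vol g x : ℝ) : ℂ) := by
  rw [actionFG, Complex.ofReal_mul, ← integral_complex_ofReal, Complex.ofReal_neg]
  congr 1
  exact setIntegral_congr_fun hK fun x hx =>
    hg.integral_scalarD hA α (hKT hx) (hv x hx).1 (hv x hx).2

end FibreIntegral

/-! ### Differentiation under the integral sign -/

section ParametricIntegral

/-- The derivative is continuous on a compact product, so a constant dominates it. Used for the
field action on `K` and for worldlines on a compact set of parameters. -/
theorem hasDerivAt_setIntegral_of_continuousOn {X : Type*} [TopologicalSpace X]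
    [SecondCountableTopology X] [T2Space X] [MeasurableSpace X] [BorelSpace X] {μ : Measure X}
    [IsFiniteMeasureOnCompacts μ] {K : Set X} (hK : IsCompact K) {F F' : ℝ → X → ℝ} {δ : ℝ}
    (hδ : 0 < δ)
    (hF : ContinuousOn (fun p : ℝ × X => F p.1 p.2) (Icc (-δ) δ ×ˢ K))
    (hF' : ContinuousOn (fun p : ℝ × X => F' p.1 p.2) (Icc (-δ) δ ×ˢ K))
    (hd : ∀ ε ∈ Icc (-δ) δ, ∀ x ∈ K, HasDerivAt (fun ε => F ε x) (F' ε x) ε) :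
    HasDerivAt (fun ε => ∫ x in K, F ε x ∂μ) (∫ x in K, F' 0 x ∂μ) 0 := by
  have hs : Icc (-δ) δ ∈ 𝓝 (0 : ℝ) := Icc_mem_nhds (by linarith) hδ
  have h0 : (0 : ℝ) ∈ Icc (-δ) δ := mem_of_mem_nhds hs
  have hslice : ∀ {f : ℝ → X → ℝ},
      ContinuousOn (fun p : ℝ × X => f p.1 p.2) (Icc (-δ) δ ×ˢ K) →
      ∀ ε ∈ Icc (-δ) δ, ContinuousOn (f ε) K := fun {f} hf ε hε =>
    hf.comp (f := fun x : X => (ε, x)) (by fun_prop) fun x hx => ⟨hε, hx⟩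
  obtain ⟨C, hC⟩ := (isCompact_Icc.prod hK).exists_bound_of_continuousOn hF'
  refine (hasDerivAt_integral_of_dominated_loc_of_deriv_le (μ := μ.restrict K) (F := F) (F' := F')
    (bound := fun _ => C) hs ?_ ?_ ?_ ?_ ?_ ?_).2
  · filter_upwards [hs] with ε hε
    exact (hslice hF ε hε).aestronglyMeasurable hK.measurableSet
  · exact (hslice hF 0 h0).integrableOn_compact hK
  · exact (hslice hF' 0 h0).aestronglyMeasurable hK.measurableSet
  · filter_upwards [ae_restrict_mem hK.measurableSet] with x hx ε hε
    exact hC (ε, x) ⟨hε, hx⟩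
  · exact integrableOn_const hK.measure_lt_top.ne
  · filter_upwards [ae_restrict_mem hK.measurableSet] with x hx ε hε
    exact hd ε hε x hx

/-- The integral of a partial derivative of a compactly supported function vanishes. -/
theorem integral_pd_eq_zero {f : Coord → ℝ} (hf : ContDiff ℝ 1 f) (hc : HasCompactSupport f)
    (k : Fin 4) : ∫ x, pd k f x = 0 := by
  -- Integration by parts against the constant function `1`.
  have h1 := integral_mul_fderiv_eq_neg_fderiv_mul_of_integrable (μ := (volume : Measure Coord))
    (f := fun _ : Coord => (1 : ℝ)) (g := f) (v := Pi.single k (1 : ℝ)) (by simp) ?_ ?_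
    (by fun_prop) (fun x _ => (hf.differentiable (by simp)) x)
  · simpa [pd] using h1
  · simp only [one_mul]
    have hcont : Continuous fun x => fderiv ℝ f x (Pi.single k (1 : ℝ)) :=
      (hf.continuous_fderiv (by simp)).clm_apply continuous_const
    exact hcont.integrable_of_hasCompactSupport (hc.fderiv_apply ℝ _)
  · simp only [one_mul]
    exact hf.continuous.integrable_of_hasCompactSupport hc

/-- Vanishing off the closed set `S ⊆ T` makes `f` globally `C¹` although its regularity is assumed
only on `T`. Outside `K` the derivative is zero, so the integral extends to all of space. -/
theorem setIntegral_pd_eq_zero {f : Coord → ℝ} {T S K : Set Coord} (hT : IsOpen T)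
    (hf : ContDiffOn ℝ 1 f T) (hS : IsClosed S) (hST : S ⊆ T) (hSK : S ⊆ K) (hK : IsCompact K)
    (h0 : ∀ x ∉ S, f x = 0) (k : Fin 4) : ∫ x in K, pd k f x = 0 := by
  have hsupp : tsupport f ⊆ S :=
    closure_minimal (fun x hx => by_contra fun h => hx (h0 x h)) hS
  have hsmooth : ContDiff ℝ 1 f := contDiff_iff_contDiffAt.2 fun x => by
    by_cases hx : x ∈ S
    · exact hf.contDiffAt (hT.mem_nhds (hST hx))
    · exact contDiffAt_const.congr_of_eventuallyEq
        (Filter.eventuallyEq_of_mem (hS.isOpen_compl.mem_nhds hx) fun z hz => h0 z hz)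
  rw [setIntegral_eq_integral_of_forall_compl_eq_zero fun x hx => ?_]
  · exact integral_pd_eq_zero hsmooth
      (HasCompactSupport.of_support_subset_isCompact (hK.of_isClosed_subset hS hSK)
        ((subset_tsupport f).trans hsupp)) k
  · rw [pd_congr hS.isOpen_compl (g := fun _ => 0) (fun z hz => h0 z hz) (fun h => hx (hSK h)),
      pd_const]

end ParametricIntegral

/-! ### Dependence of the curvature on the metric -/

section Congruence

variable {T : Set Coord} {g g' : MatField} {x : Coord}

/-- Locality is needed because `varied g h 0` is known to agree with `g` only on `T`, where `g` is
invertible. -/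
theorem christoffel_congr (hT : IsOpen T) (h : ∀ x ∈ T, g x = g' x) (hx : x ∈ T) (i j k : Fin 4) :
    christoffel g i j k x = christoffel g' i j k x := by
  have h1 : ∀ i j k, pd k (fun z => g z i j) x = pd k (fun z => g' z i j) x := fun i j k =>
    pd_congr hT (fun z hz => by rw [h z hz]) hx k
  simp_rw [christoffel, h x hx, h1]

theorem ricci_congr (hT : IsOpen T) (h : ∀ x ∈ T, g x = g' x) (hx : x ∈ T) (i j : Fin 4) :
    ricci g i j x = ricci g' i j x := by
  have h1 : ∀ i j k l, pd l (christoffel g i j k) x = pd l (christoffel g' i j k) x :=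
    fun i j k l => pd_congr hT (fun z hz => christoffel_congr hT h hz i j k) hx l
  simp_rw [ricci, h1, fun i j k => christoffel_congr hT h hx i j k]

end Congruence

/-! ### The varied metric -/

section Varied

variable {T K : Set Coord} {g h : MatField} {A : CovField} {x : Coord} {ε : ℝ}

/-- The points `(ε, x)`, `x ∈ T`, at which the varied metric is Lorentzian. -/
def variedDomain (T : Set Coord) (g h : MatField) : Set (ℝ × Coord) :=
  {p | p.2 ∈ T ∧ ((g p.2)⁻¹ + p.1 • h p.2).det < 0}

theorem variedDomain_snd (ε : ℝ) (x : Coord) (hp : (ε, x) ∈ variedDomain T g h) : x ∈ T := hp.1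

theorem IsLorentzField.inv_add_smooth (hg : IsLorentzField T g) (hh : IsVariation K h)
    (i j : Fin 4) :
    ContDiffOn ℝ ∞ (fun p : ℝ × Coord => ((g p.2)⁻¹ + p.1 • h p.2) i j) (univ ×ˢ T) := by
  simp only [Matrix.add_apply, Matrix.smul_apply, smul_eq_mul]
  refine ((hg.inv_smooth i j).comp contDiffOn_snd fun p hp => hp.2).add
    (contDiffOn_fst.mul (((hh.1 i j).comp contDiff_snd).contDiffOn))

theorem IsLorentzField.isOpen_variedDomain (hg : IsLorentzField T g) (hh : IsVariation K h) :
    IsOpen (variedDomain T g h) := by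
  have h1 := (contDiffOn_det (m := fun p : ℝ × Coord => (g p.2)⁻¹ + p.1 • h p.2)
    (hg.inv_add_smooth hh)).continuousOn.isOpen_inter_preimage (isOpen_univ.prod hg.isOpen)
    (isOpen_Iio (a := (0 : ℝ)))
  have h2 : variedDomain T g h = univ ×ˢ T ∩
      (fun p : ℝ × Coord => ((g p.2)⁻¹ + p.1 • h p.2).det) ⁻¹' Iio 0 := by
    ext p; simp [variedDomain]
  rwa [h2]

theorem varied_inv (hp : (ε, x) ∈ variedDomain T g h) :
    (varied g h ε x)⁻¹ = (g x)⁻¹ + ε • h x :=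
  Matrix.nonsing_inv_nonsing_inv _ (isUnit_iff_ne_zero.2 hp.2.ne)

theorem det_varied (g h : MatField) (ε : ℝ) (x : Coord) :
    (varied g h ε x).det = (((g x)⁻¹ + ε • h x).det)⁻¹ := by
  rw [varied, Matrix.det_nonsing_inv, Ring.inverse_eq_inv']

theorem det_varied_neg (hp : (ε, x) ∈ variedDomain T g h) : (varied g h ε x).det < 0 := by
  rw [det_varied]; exact inv_lt_zero.2 hp.2

theorem IsLorentzField.varied_smooth (hg : IsLorentzField T g) (hh : IsVariation K h)
    (i j : Fin 4) : Smooth₂ (variedDomain T g h) fun ε x => varied g h ε x i j :=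
  contDiffOn_inv_apply (m := fun p : ℝ × Coord => (g p.2)⁻¹ + p.1 • h p.2)
    (fun i j => (hg.inv_add_smooth hh i j).mono fun _ hp => ⟨trivial, hp.1⟩)
    (fun _ hp => hp.2.ne) i j

theorem IsLorentzField.zero_mem_variedDomain (hg : IsLorentzField T g) (hx : x ∈ T) :
    ((0 : ℝ), x) ∈ variedDomain T g h := by
  refine ⟨hx, ?_⟩
  rw [zero_smul, add_zero, Matrix.det_nonsing_inv, Ring.inverse_eq_inv']
  exact inv_lt_zero.2 (hg.det_neg x hx)

theorem IsLorentzField.varied_zero (hg : IsLorentzField T g) (hx : x ∈ T) :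
    varied g h 0 x = g x := by
  rw [varied, zero_smul, add_zero]
  exact Matrix.nonsing_inv_nonsing_inv _ (isUnit_iff_ne_zero.2 (hg.det_neg x hx).ne)

/-- With this, the reduction of the action to a space-time integral applies to every varied metric
and not only at `ε = 0`. -/
theorem IsLorentzField.varied (hg : IsLorentzField T g) (hh : IsVariation K h) (ε : ℝ) :
    IsLorentzField {x | (ε, x) ∈ variedDomain T g h} (varied g h ε) where
  isOpen := (hg.isOpen_variedDomain hh).preimage (by fun_prop)
  smooth i j := (hg.varied_smooth hh i j).slice ε
  symm x hx := by
    have h1 : ((g x)⁻¹ + ε • h x).IsSymm := (hg.inv_isSymm hx.1).add ((hh.2.1 x).smul ε)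
    rw [RandersGravity.varied, Matrix.IsSymm, Matrix.transpose_nonsing_inv, h1.eq]
  det_neg x hx := det_varied_neg hx

/-- The tube lemma around `{0} × K`: one bound on `ε` keeps the varied metric Lorentzian over all of
`K`. -/
theorem IsLorentzField.exists_Icc_subset_variedDomain (hg : IsLorentzField T g)
    (hh : IsVariation K h) (hK : IsCompact K) (hKT : K ⊆ T) :
    ∃ δ > 0, Icc (-δ) δ ×ˢ K ⊆ variedDomain T g h := by
  obtain ⟨u, v, hu, -, h0u, hKv, huv⟩ := generalized_tube_lemma (s := {(0 : ℝ)}) isCompact_singleton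
    hK (hg.isOpen_variedDomain hh) (by
      rintro ⟨ε, x⟩ ⟨hε, hx⟩
      rw [mem_singleton_iff] at hε
      subst hε
      exact hg.zero_mem_variedDomain (hKT hx))
  obtain ⟨δ, hδ, hδu⟩ := Metric.isOpen_iff.1 hu 0 (h0u rfl)
  refine ⟨δ / 2, half_pos hδ, (prod_mono (fun ε hε => hδu ?_) hKv).trans huv⟩
  rw [Metric.mem_ball, Real.dist_eq, sub_zero]
  exact (abs_le.2 hε).trans_lt (by linarith)

end Varied

/-! ### First variation of the curvature -/

section CurvatureVariation

variable {T K : Set Coord} {g h : MatField} {A : CovField} {x : Coord}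

/-- The variation `δγ^i_{jk}` of the Christoffel symbols. -/
noncomputable def varChristoffel (g h : MatField) (i j k : Fin 4) (x : Coord) : ℝ :=
  fderiv ℝ (fun ε : ℝ => christoffel (varied g h ε) i j k x) 0 1

/-- The variation `δr_{jl}` of the Ricci tensor. -/
noncomputable def varRicci (g h : MatField) (j l : Fin 4) (x : Coord) : ℝ :=
  ∑ i, (pd i (varChristoffel g h i j l) x - pd l (varChristoffel g h i j i) x
    + ∑ a, (varChristoffel g h a j l x * christoffel g i a i x
      + christoffel g a j l x * varChristoffel g h i a i x
      - varChristoffel g h a j i x * christoffel g i a l x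
      - christoffel g a j i x * varChristoffel g h i a l x))

theorem IsLorentzField.smooth₂_christoffel (hg : IsLorentzField T g) (hh : IsVariation K h)
    (i j k : Fin 4) :
    Smooth₂ (variedDomain T g h) fun ε x => christoffel (RandersGravity.varied g h ε) i j k x :=
  Smooth₂.christoffel (hg.isOpen_variedDomain hh) (hg.varied_smooth hh)
    (fun _ _ hp => (det_varied_neg hp).ne) i j k

theorem IsLorentzField.varChristoffel_smooth (hg : IsLorentzField T g) (hh : IsVariation K h)
    (i j k : Fin 4) : ContDiffOn ℝ ∞ (varChristoffel g h i j k) T :=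
  (((hg.smooth₂_christoffel hh i j k).fst (hg.isOpen_variedDomain hh) 1).slice 0).mono
    fun _ hx => hg.zero_mem_variedDomain hx

theorem IsLorentzField.christoffel_varied_zero (hg : IsLorentzField T g) (hx : x ∈ T)
    (i j k : Fin 4) :
    christoffel (RandersGravity.varied g h 0) i j k x = christoffel g i j k x :=
  christoffel_congr hg.isOpen (fun _ hz => hg.varied_zero hz) hx i j k

theorem IsLorentzField.hasDerivAt_christoffel (hg : IsLorentzField T g) (hh : IsVariation K h)
    (hx : x ∈ T) (i j k : Fin 4) :
    HasDerivAt (fun ε => christoffel (RandersGravity.varied g h ε) i j k x)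
      (varChristoffel g h i j k x) 0 :=
  ((hg.smooth₂_christoffel hh i j k).differentiableAt_fst (hg.isOpen_variedDomain hh)
    (hg.zero_mem_variedDomain hx)).hasFDerivAt.hasDerivAt

theorem IsLorentzField.hasDerivAt_pd_christoffel (hg : IsLorentzField T g) (hh : IsVariation K h)
    (hx : x ∈ T) (i j k l : Fin 4) :
    HasDerivAt (fun ε => pd l (christoffel (RandersGravity.varied g h ε) i j k) x)
      (pd l (varChristoffel g h i j k) x) 0 := by
  have hΩ := hg.isOpen_variedDomain hh
  have hs := hg.smooth₂_christoffel hh i j k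
  have h0 := hg.zero_mem_variedDomain (h := h) hx
  have h1 := ((hs.snd hΩ (Pi.single l (1 : ℝ))).differentiableAt_fst hΩ h0).hasFDerivAt.hasDerivAt
  rw [hs.fst_snd_comm hΩ 1 _ h0] at h1
  exact h1

theorem IsLorentzField.hasDerivAt_ricci (hg : IsLorentzField T g) (hh : IsVariation K h)
    (hx : x ∈ T) (j l : Fin 4) :
    HasDerivAt (fun ε => ricci (RandersGravity.varied g h ε) j l x) (varRicci g h j l x) 0 := by
  have hc := fun i j k => hg.hasDerivAt_christoffel hh hx i j k
  have hp := fun i j k l => hg.hasDerivAt_pd_christoffel hh hx i j k l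
  refine HasDerivAt.fun_sum fun i _ => ((hp i j l i).sub (hp i j i l)).add
    (HasDerivAt.fun_sum fun a _ => ?_)
  refine (((hc a j l).fun_mul (hc i a i)).fun_sub ((hc a j i).fun_mul (hc i a l))).congr_deriv ?_
  simp only [hg.christoffel_varied_zero hx]
  ring

theorem IsLorentzField.eventually_mem_variedDomain (hg : IsLorentzField T g)
    (hh : IsVariation K h) (hx : x ∈ T) : ∀ᶠ ε in 𝓝 (0 : ℝ), (ε, x) ∈ variedDomain T g h :=
  ((hg.isOpen_variedDomain hh).preimage (f := fun ε : ℝ => (ε, x)) (by fun_prop)).mem_nhds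
    (hg.zero_mem_variedDomain hx)

theorem IsLorentzField.hasDerivAt_inv_varied (hg : IsLorentzField T g) (hh : IsVariation K h)
    (hx : x ∈ T) (i j : Fin 4) :
    HasDerivAt (fun ε => (RandersGravity.varied g h ε x)⁻¹ i j) (h x i j) 0 := by
  have h1 : HasDerivAt (fun ε : ℝ => (g x)⁻¹ i j + ε * h x i j) (h x i j) 0 := by
    simpa using ((hasDerivAt_id (0 : ℝ)).mul_const (h x i j)).const_add ((g x)⁻¹ i j)
  refine h1.congr_of_eventuallyEq ?_
  filter_upwards [hg.eventually_mem_variedDomain hh hx] with ε hε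
  rw [varied_inv hε]; simp

/-- The inverse metric is affine in `ε`, so Jacobi's formula is applied to its determinant, which is
then inverted; the inversion produces the minus sign. -/
theorem IsLorentzField.hasDerivAt_vol_varied (hg : IsLorentzField T g) (hx : x ∈ T) :
    HasDerivAt (fun ε => vol (RandersGravity.varied g h ε) x)
      (-(1 / 2) * vol g x * ∑ i, ∑ j, g x i j * h x j i) 0 := by
  have h1 : ∀ i j, HasDerivAt (fun ε : ℝ => ((g x)⁻¹ + ε • h x) i j) (h x i j) 0 := fun i j => by
    simpa using ((hasDerivAt_id (0 : ℝ)).mul_const (h x i j)).const_add ((g x)⁻¹ i j)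
  have hdet : ((g x)⁻¹).det = ((g x).det)⁻¹ := by
    rw [Matrix.det_nonsing_inv, Ring.inverse_eq_inv']
  have hneg := hg.det_neg x hx
  have h0 : ((g x)⁻¹ + (0 : ℝ) • h x).det = ((g x).det)⁻¹ := by rw [zero_smul, add_zero, hdet]
  have h2 := hasDerivAt_det h1 (by rw [h0]; exact inv_ne_zero hneg.ne)
  have h3 := (h2.fun_inv (by rw [h0]; exact inv_ne_zero hneg.ne)).fun_neg.sqrt
    (by rw [h0, inv_inv]; exact (neg_pos.2 hneg).ne')
  rw [h0, inv_inv, zero_smul, add_zero,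
    Matrix.nonsing_inv_nonsing_inv _ (isUnit_iff_ne_zero.2 hneg.ne)] at h3
  simp only [vol, det_varied]
  refine h3.congr_deriv ?_
  have hpos : 0 < Real.sqrt (-(g x).det) := Real.sqrt_pos.2 (neg_pos.2 hneg)
  have hsq := Real.mul_self_sqrt (neg_pos.2 hneg).le
  have hd := hneg.ne
  field_simp
  rw [sq, hsq]
  ring

/-- With lower indices `F` does not involve the metric. The square contains two inverse metrics,
whose variations contribute equally after relabelling. -/
theorem IsLorentzField.hasDerivAt_faradayNormSq (hg : IsLorentzField T g) (hh : IsVariation K h)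
    (hx : x ∈ T) (A : CovField) :
    HasDerivAt (fun ε => faradayNormSq (RandersGravity.varied g h ε) A x)
      (2 * ∑ i, ∑ j, h x i j * faradaySq g A i j x) 0 := by
  have hi := fun i j => hg.hasDerivAt_inv_varied hh hx i j
  have h1 : HasDerivAt (fun ε => faradayNormSq (RandersGravity.varied g h ε) A x)
      (∑ i, ∑ j, (h x i j * faradaySq g A i j x
        + (g x)⁻¹ i j * ∑ l, ∑ m, h x l m * faraday A i l x * faraday A j m x)) 0 := by
    refine HasDerivAt.fun_sum fun i _ => HasDerivAt.fun_sum fun j _ => ?_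
    have h2 : HasDerivAt (fun ε => faradaySq (RandersGravity.varied g h ε) A i j x)
        (∑ l, ∑ m, h x l m * faraday A i l x * faraday A j m x) 0 :=
      HasDerivAt.fun_sum fun l _ => HasDerivAt.fun_sum fun m _ =>
        ((hi l m).mul_const _).mul_const _
    have h3 := (hi i j).mul h2
    simp only [faradaySq, hg.varied_zero hx] at h3
    exact h3
  convert h1 using 1
  simp_rw [Finset.sum_add_distrib]
  rw [two_mul]
  refine congrArg₂ (· + ·) rfl ?_
  have rot : ∀ f : Fin 4 → Fin 4 → Fin 4 → Fin 4 → ℝ,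
      ∑ i, ∑ j, ∑ l, ∑ m, f i j l m = ∑ l, ∑ m, ∑ i, ∑ j, f i j l m := fun f => by
    rw [Finset.sum_congr rfl fun i _ => Finset.sum_comm, Finset.sum_comm]
    refine Finset.sum_congr rfl fun l _ => ?_
    rw [Finset.sum_congr rfl fun i _ => Finset.sum_comm, Finset.sum_comm]
  simp_rw [faradaySq, Finset.mul_sum]
  rw [rot]
  refine Finset.sum_congr rfl fun i _ => Finset.sum_congr rfl fun j _ =>
    Finset.sum_congr rfl fun l _ => Finset.sum_congr rfl fun m _ => ?_
  rw [faraday_antisymm A i l, faraday_antisymm A j m]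
  ring

/-- The vector density `√(-det g) (g^{jl} δγ^i_{jl} - g^{ij} δγ^l_{jl})`. -/
noncomputable def palatini (g h : MatField) (i : Fin 4) (x : Coord) : ℝ :=
  vol g x * ((∑ j, ∑ l, (g x)⁻¹ j l * varChristoffel g h i j l x)
    - ∑ j, ∑ l, (g x)⁻¹ i j * varChristoffel g h l j l x)

theorem IsLorentzField.palatini_smooth (hg : IsLorentzField T g) (hh : IsVariation K h)
    (i : Fin 4) : ContDiffOn ℝ ∞ (palatini g h i) T :=
  hg.vol_smooth.mul ((ContDiffOn.sum fun j _ => ContDiffOn.sum fun l _ =>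
    (hg.inv_smooth j l).mul (hg.varChristoffel_smooth hh i j l)).sub
    (ContDiffOn.sum fun j _ => ContDiffOn.sum fun l _ =>
    (hg.inv_smooth i j).mul (hg.varChristoffel_smooth hh l j l)))

/-- Near a point outside the support of `h` the varied metric does not depend on `ε`, so the
Christoffel symbols have no variation there. -/
theorem palatini_eq_zero (hx : x ∉ tsupport h) (i : Fin 4) : palatini g h i x = 0 := by
  have h1 : ∀ i j k, varChristoffel g h i j k x = 0 := by
    intro i j k
    have h2 : (fun ε : ℝ => christoffel (varied g h ε) i j k x)
        = fun _ => christoffel (varied g h 0) i j k x := by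
      funext ε
      refine christoffel_congr (isClosed_tsupport h).isOpen_compl (fun z hz => ?_) hx i j k
      rw [varied, varied, image_eq_zero_of_notMem_tsupport hz, smul_zero, smul_zero]
    rw [varChristoffel, h2]; simp
  simp [palatini, h1]

/-- Index bookkeeping for the Palatini identity: `C` stands for `δγ`, `dC` for its derivatives and
`P` for `∂g⁻¹`. Expanding `P` in Christoffel symbols reproduces the connection terms of `δr`. -/
theorem palatini_aux (I : Fin 4 → Fin 4 → ℝ) (γ C : Fin 4 → Fin 4 → Fin 4 → ℝ)
    (dC : Fin 4 → Fin 4 → Fin 4 → Fin 4 → ℝ) (P : Fin 4 → Fin 4 → Fin 4 → ℝ)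
    (hI : ∀ i j, I i j = I j i) (hγ : ∀ i j k, γ i j k = γ i k j)
    (hP : ∀ k i j, P k i j = -((∑ m, I i m * γ j k m) + ∑ m, γ i k m * I m j)) :
    ∑ j, ∑ l, I j l * ∑ i, (dC i i j l - dC l i j i + ∑ a, (C a j l * γ i a i + γ a j l * C i a i
        - C a j i * γ i a l - γ a j i * C i a l))
      = ∑ i, ((∑ m, γ m i m) * ((∑ j, ∑ l, I j l * C i j l) - ∑ j, ∑ l, I i j * C l j l)
        + ((∑ j, ∑ l, (P i j l * C i j l + I j l * dC i i j l))
          - ∑ j, ∑ l, (P i i j * C l j l + I i j * dC i l j l))) := by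
  have rot : ∀ f : Fin 4 → Fin 4 → Fin 4 → ℝ,
      ∑ j, ∑ l, ∑ i, f i j l = ∑ i, ∑ j, ∑ l, f i j l := fun f => by
    rw [Finset.sum_congr rfl fun j _ => Finset.sum_comm, Finset.sum_comm]
  have d2 : ∑ j, ∑ l, ∑ i, I j l * dC l i j i = ∑ i, ∑ j, ∑ l, I i j * dC i l j l := by
    rw [Finset.sum_comm]
    exact Finset.sum_congr rfl fun i _ => Finset.sum_congr rfl fun j _ =>
      Finset.sum_congr rfl fun l _ => by rw [hI]
  have c1 : ∑ j, ∑ l, ∑ i, ∑ a, I j l * (C a j l * γ i a i)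
      = ∑ i, ∑ j, ∑ l, ∑ m, γ m i m * (I j l * C i j l) := by
    rw [Finset.sum_congr rfl fun j _ => Finset.sum_congr rfl fun l _ => Finset.sum_comm,
      rot fun a j l => ∑ i, I j l * (C a j l * γ i a i)]
    exact Finset.sum_congr rfl fun i _ => Finset.sum_congr rfl fun j _ =>
      Finset.sum_congr rfl fun l _ => Finset.sum_congr rfl fun m _ => by ring
  have c2 : ∑ j, ∑ l, ∑ i, ∑ a, I j l * (γ a j l * C i a i)
      = ∑ i, ∑ j, ∑ l, ∑ m, I i m * γ j i m * C l j l := by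
    refine Finset.sum_congr rfl fun i _ => ?_
    rw [Finset.sum_comm, Finset.sum_comm (f := fun j l => ∑ m, I i m * γ j i m * C l j l)]
    refine Finset.sum_congr rfl fun l _ => ?_
    rw [Finset.sum_comm]
    exact Finset.sum_congr rfl fun j _ => Finset.sum_congr rfl fun m _ => by ring
  -- One half of `∂_i g^{ij}` cancels the derivative of `√(-g)` in the trace part of the divergence.
  have c2' : ∑ i, ∑ j, ∑ l, ∑ m, γ i i m * I m j * C l j l
      = ∑ i, ∑ j, ∑ l, ∑ m, γ m i m * (I i j * C l j l) := by
    have : ∀ f : Fin 4 → Fin 4 → Fin 4 → Fin 4 → ℝ,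
        ∑ i, ∑ j, ∑ l, ∑ m, f i j l m = ∑ m, ∑ j, ∑ l, ∑ i, f i j l m := fun f => by
      have e1 : ∀ i, ∑ j, ∑ l, ∑ m, f i j l m = ∑ m, ∑ j, ∑ l, f i j l m := fun i =>
        rot fun m j l => f i j l m
      simp_rw [e1]
      rw [Finset.sum_comm]
      exact Finset.sum_congr rfl fun m _ => (rot fun i j l => f i j l m).symm
    rw [this]
    exact Finset.sum_congr rfl fun i _ => Finset.sum_congr rfl fun j _ =>
      Finset.sum_congr rfl fun l _ => Finset.sum_congr rfl fun m _ => by rw [hγ m m i]; ring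
  have c3 : ∑ j, ∑ l, ∑ i, ∑ a, I j l * (C a j i * γ i a l)
      = ∑ i, ∑ j, ∑ l, ∑ m, I j m * γ l i m * C i j l := by
    rw [Finset.sum_comm (f := fun i j => ∑ l, ∑ m, I j m * γ l i m * C i j l)]
    refine Finset.sum_congr rfl fun j _ => ?_
    rw [Finset.sum_congr rfl fun l _ => Finset.sum_comm, Finset.sum_comm]
    refine Finset.sum_congr rfl fun a _ => ?_
    rw [Finset.sum_comm]
    exact Finset.sum_congr rfl fun i _ => Finset.sum_congr rfl fun l _ => by ring
  have c4 : ∑ j, ∑ l, ∑ i, ∑ a, I j l * (γ a j i * C i a l)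
      = ∑ i, ∑ j, ∑ l, ∑ m, γ j i m * I m l * C i j l := by
    rw [rot fun i j l => ∑ a, I j l * (γ a j i * C i a l)]
    refine Finset.sum_congr rfl fun i _ => ?_
    rw [rot fun a j l => I j l * (γ a j i * C i a l)]
    refine Finset.sum_congr rfl fun a _ => ?_
    rw [Finset.sum_comm]
    exact Finset.sum_congr rfl fun j _ =>
      Finset.sum_congr rfl fun l _ => by rw [hγ a i l]; ring
  have hneg : ∀ a b : ℝ, -(a + b) = -a - b := fun a b => by ring
  simp only [hP, hneg, Finset.mul_sum, mul_add, mul_sub, sub_mul, neg_mul, Finset.sum_mul,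
    Finset.sum_add_distrib, Finset.sum_sub_distrib, Finset.sum_neg_distrib]
  rw [c1, c2, c3, c4, c2', d2, rot fun i j l => I j l * dC i i j l]
  ring

/-- The Palatini identity: `√(-det g) g^{jl} δr_{jl}` is a divergence. -/
theorem IsLorentzField.palatini_identity (hg : IsLorentzField T g) (hh : IsVariation K h)
    (hx : x ∈ T) :
    vol g x * ∑ j, ∑ l, (g x)⁻¹ j l * varRicci g h j l x = ∑ i, pd i (palatini g h i) x := by
  have hC := fun i j k => (((hg.varChristoffel_smooth hh i j k).contDiffAt
    (hg.isOpen.mem_nhds hx)).differentiableAt (by simp) : DifferentiableAt ℝ _ x)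
  have hI := fun i j => hg.inv_differentiableAt hx i j
  have h1 : ∀ i, pd i (palatini g h i) x
      = vol g x * ((∑ m, christoffel g m i m x)
          * ((∑ j, ∑ l, (g x)⁻¹ j l * varChristoffel g h i j l x)
            - ∑ j, ∑ l, (g x)⁻¹ i j * varChristoffel g h l j l x)
        + ((∑ j, ∑ l, (pd i (fun z => (g z)⁻¹ j l) x * varChristoffel g h i j l x
            + (g x)⁻¹ j l * pd i (varChristoffel g h i j l) x))
          - ∑ j, ∑ l, (pd i (fun z => (g z)⁻¹ i j) x * varChristoffel g h l j l x
            + (g x)⁻¹ i j * pd i (varChristoffel g h l j l) x))) := by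
    intro i
    have hd1 : ∀ j l, DifferentiableAt ℝ (fun z => (g z)⁻¹ j l * varChristoffel g h i j l z) x :=
      fun j l => (hI j l).fun_mul (hC i j l)
    have hd2 : ∀ j l, DifferentiableAt ℝ (fun z => (g z)⁻¹ i j * varChristoffel g h l j l z) x :=
      fun j l => (hI i j).fun_mul (hC l j l)
    have hs1 := fun j => DifferentiableAt.fun_sum fun l (_ : l ∈ Finset.univ) => hd1 j l
    have hs2 := fun j => DifferentiableAt.fun_sum fun l (_ : l ∈ Finset.univ) => hd2 j l
    unfold palatini
    rw [pd_mul (hg.vol_differentiableAt hx)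
      ((DifferentiableAt.fun_sum fun j _ => hs1 j).fun_sub
        (DifferentiableAt.fun_sum fun j _ => hs2 j)),
      hg.pd_vol hx, pd_sub (DifferentiableAt.fun_sum fun j _ => hs1 j)
        (DifferentiableAt.fun_sum fun j _ => hs2 j), pd_sum _ fun j _ => hs1 j,
      pd_sum _ fun j _ => hs2 j]
    have e1 : ∀ j, pd i (fun z => ∑ l, (g z)⁻¹ j l * varChristoffel g h i j l z) x
        = ∑ l, (pd i (fun z => (g z)⁻¹ j l) x * varChristoffel g h i j l x
            + (g x)⁻¹ j l * pd i (varChristoffel g h i j l) x) := fun j => by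
      rw [pd_sum _ fun l _ => hd1 j l]
      exact Finset.sum_congr rfl fun l _ => pd_mul (hI j l) (hC i j l) i
    have e2 : ∀ j, pd i (fun z => ∑ l, (g z)⁻¹ i j * varChristoffel g h l j l z) x
        = ∑ l, (pd i (fun z => (g z)⁻¹ i j) x * varChristoffel g h l j l x
            + (g x)⁻¹ i j * pd i (varChristoffel g h l j l) x) := fun j => by
      rw [pd_sum _ fun l _ => hd2 j l]
      exact Finset.sum_congr rfl fun l _ => pd_mul (hI i j) (hC l j l) i
    rw [Finset.sum_congr rfl fun j _ => e1 j, Finset.sum_congr rfl fun j _ => e2 j]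
    ring
  rw [Finset.sum_congr rfl fun i _ => h1 i, ← Finset.mul_sum]
  refine congrArg (vol g x * ·) ?_
  exact palatini_aux (fun i j => (g x)⁻¹ i j) (fun i j k => christoffel g i j k x)
    (fun i j k => varChristoffel g h i j k x) (fun a i j l => pd a (varChristoffel g h i j l) x)
    (fun k i j => pd k (fun z => (g z)⁻¹ i j) x) (hg.inv_comm hx) (hg.christoffel_comm hx)
    (fun k i j => hg.pd_inv hx i j k)

theorem IsLorentzField.integral_palatini (hg : IsLorentzField T g) (hh : IsVariation K h)
    (hK : IsCompact K) (hKT : K ⊆ T) (i : Fin 4) : ∫ x in K, pd i (palatini g h i) x = 0 :=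
  setIntegral_pd_eq_zero hg.isOpen ((hg.palatini_smooth hh i).of_le (by simp))
    (isClosed_tsupport h) ((hh.2.2.trans interior_subset).trans hKT)
    (hh.2.2.trans interior_subset) hK (fun _ hx => palatini_eq_zero hx i) i

end CurvatureVariation

/-! ### First variation of the gravitational action -/

section FieldVariation

variable {T K : Set Coord} {g h : MatField} {A : CovField} {x : Coord}

/-- The real form `r_{ij} - r g_{ij} / 2 - 8 π κ T_{ij}` of the generalized Einstein tensor. -/
noncomputable def fieldTensor (g : MatField) (A : CovField) (κ : ℝ) (i j : Fin 4) (x : Coord) : ℝ :=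
  einstein g i j x - 8 * Real.pi * κ * fieldStress g A i j x

theorem fieldTensor_eq (g : MatField) (A : CovField) (κ : ℝ) (i j : Fin 4) (x : Coord) :
    fieldTensor g A κ i j x = ricci g i j x - (1 / 2) * scalarCurv g x * g x i j
      + 2 * κ * faradaySq g A i j x - (κ / 2) * g x i j * faradayNormSq g A x := by
  have := Real.pi_ne_zero
  rw [fieldTensor, einstein, fieldStress]
  field_simp
  ring

theorem IsLorentzField.fieldTensor_smooth (hg : IsLorentzField T g)
    (hA : ∀ i, ContDiffOn ℝ ∞ (fun x => A x i) T) (κ : ℝ) (i j : Fin 4) :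
    ContDiffOn ℝ ∞ (fieldTensor g A κ i j) T := by
  have h1 : fieldTensor g A κ i j = fun x => ricci g i j x - (1 / 2) * scalarCurv g x * g x i j
      + 2 * κ * faradaySq g A i j x - (κ / 2) * g x i j * faradayNormSq g A x :=
    funext fun x => fieldTensor_eq g A κ i j x
  rw [h1]
  exact (((hg.ricci_smooth i j).sub ((contDiffOn_const.mul hg.scalarCurv_smooth).mul
    (hg.smooth i j))).add (contDiffOn_const.mul (hg.faradaySq_smooth hA i j))).sub
    ((contDiffOn_const.mul (hg.smooth i j)).mul (hg.faradayNormSq_smooth hA))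

/-- Four contributions: `r_{ij}` and `3α² F_{il} F_j^l` from varying the inverse metrics, `-½ R̃
g_{ij}` from the volume, and `g^{jl} δr_{jl}`, which is a divergence. The first three add up to
`fieldTensor` with `κ = 3α²/2`. -/
theorem IsLorentzField.hasDerivAt_lagrangian (hg : IsLorentzField T g) (hh : IsVariation K h)
    (hx : x ∈ T) (A : CovField) (α : ℝ) :
    HasDerivAt (fun ε => scalarTilde (RandersGravity.varied g h ε) A α x
        * vol (RandersGravity.varied g h ε) x)
      ((∑ i, ∑ j, h x i j * fieldTensor g A (3 * α ^ 2 / 2) i j x) * vol g x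
        + ∑ i, pd i (palatini g h i) x) 0 := by
  have h1 : HasDerivAt (fun ε => scalarCurv (RandersGravity.varied g h ε) x)
      (∑ j, ∑ l, (h x j l * ricci g j l x + (g x)⁻¹ j l * varRicci g h j l x)) 0 := by
    refine HasDerivAt.fun_sum fun j _ => HasDerivAt.fun_sum fun l _ => ?_
    have := (hg.hasDerivAt_inv_varied hh hx j l).fun_mul (hg.hasDerivAt_ricci hh hx j l)
    rwa [ricci_congr hg.isOpen (fun _ hz => hg.varied_zero hz) hx, hg.varied_zero hx] at this
  have h2 := (h1.fun_add ((hg.hasDerivAt_faradayNormSq hh hx A).const_mul (3 * α ^ 2 / 2))).fun_mul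
    (hg.hasDerivAt_vol_varied (h := h) hx)
  have e1 : scalarCurv (RandersGravity.varied g h 0) x = scalarCurv g x := by
    rw [scalarCurv, scalarCurv, hg.varied_zero hx]
    refine Finset.sum_congr rfl fun i _ => Finset.sum_congr rfl fun j _ => ?_
    rw [ricci_congr hg.isOpen (fun _ hz => hg.varied_zero hz) hx]
  have e2 : faradayNormSq (RandersGravity.varied g h 0) A x = faradayNormSq g A x := by
    simp_rw [faradayNormSq, faradaySq, hg.varied_zero hx]
  have e3 : vol (RandersGravity.varied g h 0) x = vol g x := by
    rw [vol, vol, hg.varied_zero hx]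
  refine h2.congr_deriv ?_
  rw [e1, e2, e3, ← hg.palatini_identity hh hx]
  have e4 : ∑ i, ∑ j, h x i j * fieldTensor g A (3 * α ^ 2 / 2) i j x
      = (∑ i, ∑ j, h x i j * ricci g i j x)
        + 3 * α ^ 2 * (∑ i, ∑ j, h x i j * faradaySq g A i j x)
        - (1 / 2) * (scalarCurv g x + 3 * α ^ 2 / 2 * faradayNormSq g A x)
          * ∑ i, ∑ j, g x i j * h x j i := by
    simp_rw [Finset.mul_sum, ← Finset.sum_add_distrib, ← Finset.sum_sub_distrib]
    refine Finset.sum_congr rfl fun i _ => Finset.sum_congr rfl fun j _ => ?_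
    rw [fieldTensor_eq, (hh.2.1 x).apply i j]
    ring
  simp_rw [Finset.sum_add_distrib]
  rw [e4]
  ring

theorem IsLorentzField.smooth₂_lagrangian (hg : IsLorentzField T g) (hh : IsVariation K h)
    (hA : ∀ i, ContDiffOn ℝ ∞ (fun x => A x i) T) (α : ℝ) :
    Smooth₂ (variedDomain T g h) fun ε x => scalarTilde (RandersGravity.varied g h ε) A α x
        * vol (RandersGravity.varied g h ε) x := by
  have hΩ := hg.isOpen_variedDomain hh
  have hs := hg.varied_smooth hh
  have h0 : ∀ ε x, (ε, x) ∈ variedDomain T g h → (RandersGravity.varied g h ε x).det ≠ 0 :=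
    fun _ _ hp => (det_varied_neg hp).ne
  refine ContDiffOn.mul (ContDiffOn.add (Smooth₂.scalarCurv hΩ hs h0) (contDiffOn_const.mul
    (Smooth₂.faradayNormSq hs h0 hg.isOpen variedDomain_snd hA))) ?_
  exact (contDiffOn_det (m := fun p : ℝ × Coord => RandersGravity.varied g h p.1 p.2) hs).neg.sqrt
    fun p hp => (neg_pos.2 (det_varied_neg hp)).ne'

theorem IsLorentzField.hasDerivAt_integral_lagrangian (hg : IsLorentzField T g)
    (hh : IsVariation K h) (hK : IsCompact K) (hKT : K ⊆ T)
    (hA : ∀ i, ContDiffOn ℝ ∞ (fun x => A x i) T) (α : ℝ) :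
    HasDerivAt (fun ε => ∫ x in K, scalarTilde (RandersGravity.varied g h ε) A α x
        * vol (RandersGravity.varied g h ε) x)
      (∫ x in K, (∑ i, ∑ j, h x i j * fieldTensor g A (3 * α ^ 2 / 2) i j x) * vol g x) 0 := by
  have hΩ := hg.isOpen_variedDomain hh
  have hs := hg.smooth₂_lagrangian hh hA α
  obtain ⟨δ, hδ, hδK⟩ := hg.exists_Icc_subset_variedDomain hh hK hKT
  have h1 := hasDerivAt_setIntegral_of_continuousOn (μ := (volume : Measure Coord)) hK hδ
    (hs.continuousOn.mono hδK) ((hs.fst hΩ (1 : ℝ)).continuousOn.mono hδK) fun ε hε x hx =>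
      (hs.differentiableAt_fst hΩ (hδK ⟨hε, hx⟩)).hasFDerivAt.hasDerivAt
  refine h1.congr_deriv ?_
  have hc1 : ContinuousOn
      (fun x => (∑ i, ∑ j, h x i j * fieldTensor g A (3 * α ^ 2 / 2) i j x) * vol g x) K := by
    refine ContinuousOn.mono ?_ hKT
    exact (continuousOn_finsetSum _ fun i _ => continuousOn_finsetSum _ fun j _ =>
      (hh.1 i j).continuous.continuousOn.mul (hg.fieldTensor_smooth hA _ i j).continuousOn).mul
      hg.vol_smooth.continuousOn
  have hc2 : ∀ i, ContinuousOn (fun x => pd i (palatini g h i) x) K := fun i =>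
    (contDiffOn_fderiv_apply hg.isOpen (hg.palatini_smooth hh i) _).continuousOn.mono hKT
  calc _ = ∫ x in K, ((∑ i, ∑ j, h x i j * fieldTensor g A (3 * α ^ 2 / 2) i j x) * vol g x
          + ∑ i, pd i (palatini g h i) x) := by
        -- The integrand supplied by joint smoothness is identified with the explicit variation by
        -- uniqueness of derivatives.
        refine setIntegral_congr_fun hK.measurableSet fun x hx => ?_
        have hd := (hs.differentiableAt_fst hΩ
          (hg.zero_mem_variedDomain (hKT hx))).hasFDerivAt.hasDerivAt
        exact hd.unique (hg.hasDerivAt_lagrangian hh (hKT hx) A α)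
    _ = _ := by
        rw [integral_add (hc1.integrableOn_compact hK)
          ((continuousOn_finsetSum _ fun i _ => hc2 i).integrableOn_compact hK),
          integral_finsetSum _ fun i _ => (hc2 i).integrableOn_compact hK,
          Finset.sum_eq_zero fun i _ => hg.integral_palatini hh hK hKT i, add_zero]

/-- For small `ε` the fibre integral no longer involves `v ε`, so no regularity of the vertical
metrics in `ε` is required. -/
theorem IsLorentzField.hasDerivAt_actionFG (hg : IsLorentzField T g)
    (hh : IsVariation K h) (hK : IsCompact K) (hKT : K ⊆ T)
    (hA : ∀ i, ContDiffOn ℝ ∞ (fun x => A x i) T) (c k α : ℝ) {v : ℝ → MatField}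
    (hv : IsVerticalFamily K g h v) :
    HasDerivAt (fun ε : ℝ => actionFG c k K A α (RandersGravity.varied g h ε) (v ε))
      ((-(c ^ 3 / (16 * Real.pi * k))
        * ∫ x in K, (∑ i, ∑ j, h x i j * fieldTensor g A (3 * α ^ 2 / 2) i j x) * vol g x : ℝ) : ℂ)
      0 := by
  have h1 := ((hg.hasDerivAt_integral_lagrangian hh hK hKT hA α).const_mul
    (-(c ^ 3 / (16 * Real.pi * k)))).ofReal_comp
  refine h1.congr_of_eventuallyEq ?_
  obtain ⟨δ, hδ, hδK⟩ := hg.exists_Icc_subset_variedDomain hh hK hKT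
  filter_upwards [hv, Icc_mem_nhds (neg_lt_zero.2 hδ) hδ] with ε hε hεδ
  exact (hg.varied hh ε).actionFG_eq (fun i => (hA i).mono fun _ hx => hx.1) hK.measurableSet
    (fun x hx => hδK ⟨hεδ, hx⟩) hε c k α

end FieldVariation

/-! ### Particles -/

section Worldlines

variable {M : Type*} [TopologicalSpace M] [ChartedSpace Coord M]
  {φ : OpenPartialHomeomorph M Coord} {Δ : Set M} {g : MatField} {P : Particle M}

theorem Particle.Admissible.contDiffAt_pos (hP : P.Admissible φ Δ g)
    (hφ : φ ∈ IsManifold.maximalAtlas 𝓘(ℝ, Coord) ∞ M) (hΔφ : Δ ⊆ φ.source) {t : ℝ}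
    (ht : t ∈ P.times Δ) : ContDiffAt ℝ 1 (P.pos φ) t := by
  have h1 : ContMDiffAt 𝓘(ℝ, Coord) 𝓘(ℝ, Coord) 1 φ (P.path t) :=
    (contMDiffAt_of_mem_maximalAtlas hφ (hΔφ ht.2)).of_le (by simp)
  exact (h1.comp t (hP.2.1 t ht.1)).contDiffAt

/-- A compact `Δ` is closed in the Hausdorff manifold, so its preimage is closed in the parameter
interval. A worldline may enter and leave `Δ` repeatedly, so this set need not be an interval. -/
theorem Particle.Admissible.isCompact_times [T2Space M] (hP : P.Admissible φ Δ g) (hΔ : IsCompact Δ) :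
    IsCompact (P.times Δ) := by
  have h1 : ContinuousOn P.path (Icc P.start P.finish) := fun t ht =>
    (hP.2.1 t ht).continuousAt.continuousWithinAt
  exact isCompact_Icc.of_isClosed_subset
    (h1.preimage_isClosed_of_isClosed isClosed_Icc hΔ.isClosed) inter_subset_left

theorem Particle.Admissible.continuousOn_pos (hP : P.Admissible φ Δ g)
    (hφ : φ ∈ IsManifold.maximalAtlas 𝓘(ℝ, Coord) ∞ M) (hΔφ : Δ ⊆ φ.source) :
    ContinuousOn (P.pos φ) (P.times Δ) := fun _ ht =>
  (hP.contDiffAt_pos hφ hΔφ ht).continuousAt.continuousWithinAt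

theorem Particle.Admissible.continuousOn_vel (hP : P.Admissible φ Δ g)
    (hφ : φ ∈ IsManifold.maximalAtlas 𝓘(ℝ, Coord) ∞ M) (hΔφ : Δ ⊆ φ.source) :
    ContinuousOn (P.vel φ) (P.times Δ) := fun _ ht =>
  (((hP.contDiffAt_pos hφ hΔφ ht).fderiv_right (m := 0) (by simp)).continuousAt.clm_apply
    continuousAt_const).continuousWithinAt

theorem Particle.pos_mem_image {M : Type*} [TopologicalSpace M]
    {φ : OpenPartialHomeomorph M Coord} {Δ : Set M} {P : Particle M} {t : ℝ} (ht : t ∈ P.times Δ) : P.pos φ t ∈ φ '' Δ :=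
  mem_image_of_mem _ ht.2

end Worldlines

/-! ### Variation of the length of a curve -/

section Length

variable {T K : Set Coord} {g h : MatField} {x : Coord}

/-- Differentiating the product of the varied metric with its inverse, which has derivative `h`,
gives `-g h g`. -/
theorem IsLorentzField.hasDerivAt_varied (hg : IsLorentzField T g) (hh : IsVariation K h)
    (hx : x ∈ T) (i j : Fin 4) :
    HasDerivAt (fun ε => RandersGravity.varied g h ε x i j) (-(g x * h x * g x) i j) 0 := by
  have hd := fun i j => ((hg.varied_smooth hh i j).differentiableAt_fst (hg.isOpen_variedDomain hh)
    (hg.zero_mem_variedDomain hx)).hasDerivAt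
  set D : Matrix (Fin 4) (Fin 4) ℝ :=
    Matrix.of fun i j => deriv (fun ε => RandersGravity.varied g h ε x i j) 0 with hD
  have h1 : D * (g x)⁻¹ + g x * h x = 0 := by
    ext i k
    have h2 : HasDerivAt (fun ε => ∑ j, RandersGravity.varied g h ε x i j
        * (RandersGravity.varied g h ε x)⁻¹ j k)
        (∑ j, (D i j * (g x)⁻¹ j k + g x i j * h x j k)) 0 := by
      refine HasDerivAt.fun_sum fun j _ => ?_
      have := (hd i j).fun_mul (hg.hasDerivAt_inv_varied hh hx j k)
      rwa [hg.varied_zero hx] at this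
    have h3 : HasDerivAt (fun ε => ∑ j, RandersGravity.varied g h ε x i j
        * (RandersGravity.varied g h ε x)⁻¹ j k) 0 0 := by
      refine (hasDerivAt_const (0 : ℝ) ((1 : Matrix (Fin 4) (Fin 4) ℝ) i k)).congr_of_eventuallyEq ?_
      filter_upwards [hg.eventually_mem_variedDomain hh hx] with ε hε
      rw [← Matrix.mul_apply, Matrix.mul_nonsing_inv _
        (isUnit_iff_ne_zero.2 (det_varied_neg hε).ne)]
    rw [Matrix.add_apply, Matrix.mul_apply, Matrix.mul_apply, ← Finset.sum_add_distrib]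
    exact h2.unique h3
  have h4 : D = -(g x * h x * g x) := by
    have h5 : (D * (g x)⁻¹ + g x * h x) * g x = 0 := by rw [h1, zero_mul]
    rw [add_mul, Matrix.mul_assoc, hg.inv_mul hx, mul_one] at h5
    exact eq_neg_of_add_eq_zero_left h5
  have h6 := hd i j
  rwa [show deriv (fun ε => RandersGravity.varied g h ε x i j) 0 = D i j from rfl, h4] at h6

theorem IsLorentzField.sum_mul_mul_eq (hg : IsLorentzField T g) (hx : x ∈ T) (u : Coord) :
    ∑ i, ∑ j, (g x * h x * g x) i j * u i * u j
      = ∑ i, ∑ j, (g x).mulVec u i * (g x).mulVec u j * h x i j := by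
  have h1 : ∑ i, ∑ j, (g x * h x * g x) i j * u i * u j
      = dotProduct u ((g x * h x * g x).mulVec u) := by
    simp_rw [dotProduct, Matrix.mulVec, dotProduct, Finset.mul_sum]
    exact Finset.sum_congr rfl fun i _ => Finset.sum_congr rfl fun j _ => by ring
  have h2 : ∑ i, ∑ j, (g x).mulVec u i * (g x).mulVec u j * h x i j
      = dotProduct ((g x).mulVec u) ((h x).mulVec ((g x).mulVec u)) := by
    generalize (g x).mulVec u = w
    simp_rw [dotProduct, Matrix.mulVec, dotProduct, Finset.mul_sum]
    exact Finset.sum_congr rfl fun i _ => Finset.sum_congr rfl fun j _ => by ring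
  rw [h1, h2, ← Matrix.mulVec_mulVec, ← Matrix.mulVec_mulVec, Matrix.dotProduct_mulVec,
    ← Matrix.mulVec_transpose, (hg.symm x hx).eq]

theorem IsLorentzField.hasDerivAt_quad (hg : IsLorentzField T g) (hh : IsVariation K h)
    (hx : x ∈ T) (u : Coord) :
    HasDerivAt (fun ε => quad (RandersGravity.varied g h ε) x u)
      (-∑ i, ∑ j, (g x).mulVec u i * (g x).mulVec u j * h x i j) 0 := by
  have h1 : HasDerivAt (fun ε => quad (RandersGravity.varied g h ε) x u)
      (∑ i, ∑ j, -(g x * h x * g x) i j * u i * u j) 0 :=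
    HasDerivAt.fun_sum fun i _ => HasDerivAt.fun_sum fun j _ =>
      ((hg.hasDerivAt_varied hh hx i j).mul_const _).mul_const _
  refine h1.congr_deriv ?_
  rw [← hg.sum_mul_mul_eq hx]
  simp_rw [neg_mul, Finset.sum_neg_distrib]

theorem IsLorentzField.smooth₂_quad (hg : IsLorentzField T g) (hh : IsVariation K h) :
    ContDiffOn ℝ ∞ (fun q : (ℝ × Coord) × Coord =>
      quad (RandersGravity.varied g h q.1.1) q.1.2 q.2) (variedDomain T g h ×ˢ univ) := by
  have hu : ∀ i, ContDiff ℝ ∞ fun q : (ℝ × Coord) × Coord => q.2 i := fun i => by fun_prop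
  exact ContDiffOn.sum fun i _ => ContDiffOn.sum fun j _ =>
    ((ContDiffOn.comp (g := fun q : ℝ × Coord => RandersGravity.varied g h q.1 q.2 i j)
      (hg.varied_smooth hh i j) contDiffOn_fst fun _ hq => hq.1).mul
      (hu i).contDiffOn).mul (hu j).contDiffOn

/-- A continuous function which is positive on `{0} × I` is so on a neighbourhood. -/
theorem exists_Icc_forall_pos {X : Type*} [TopologicalSpace X] {I : Set X} (hI : IsCompact I)
    {Q : ℝ → X → ℝ} {δ : ℝ} (hδ : 0 < δ)
    (hQ : ContinuousOn (fun q : ℝ × X => Q q.1 q.2) (Icc (-δ) δ ×ˢ I))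
    (h0 : ∀ t ∈ I, 0 < Q 0 t) :
    ∃ ρ > 0, Icc (-ρ) ρ ⊆ Icc (-δ) δ ∧ ∀ ε ∈ Icc (-ρ) ρ, ∀ t ∈ I, 0 < Q ε t := by
  have hpos : ∀ᶠ ε in 𝓝 (0 : ℝ), ∀ t ∈ I, ε ∈ Icc (-δ) δ → t ∈ I → 0 < Q ε t := by
    refine hI.eventually_forall_of_forall_eventually fun t ht => ?_
    have hm : ((0 : ℝ), t) ∈ Icc (-δ) δ ×ˢ I := ⟨⟨by linarith, hδ.le⟩, ht⟩
    have h1 := (hQ _ hm).eventually_const_lt (u := 0) (h0 t ht)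
    filter_upwards [eventually_nhdsWithin_iff.1 h1] with z hz h2 h3 using hz ⟨h2, h3⟩
  obtain ⟨η, hη, hηQ⟩ := Metric.eventually_nhds_iff.1 hpos
  have hsub : Icc (-min δ (η / 2)) (min δ (η / 2)) ⊆ Icc (-δ) δ :=
    Icc_subset_Icc (neg_le_neg (min_le_left _ _)) (min_le_left _ _)
  refine ⟨min δ (η / 2), lt_min hδ (half_pos hη), hsub, fun ε hε t ht => hηQ ?_ t ht (hsub hε) ht⟩
  rw [Real.dist_eq, sub_zero]
  exact (abs_le.2 hε).trans_lt ((min_le_right _ _).trans_lt (half_lt_self hη))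

section Curve

variable {I : Set ℝ} {p u : ℝ → Coord}

theorem IsLorentzField.continuousOn_quad (hg : IsLorentzField T g) (hp : ContinuousOn p I)
    (hu : ContinuousOn u I) (hpT : MapsTo p I T) :
    ContinuousOn (fun t => quad g (p t) (u t)) I :=
  continuousOn_finsetSum _ fun i _ => continuousOn_finsetSum _ fun j _ =>
    ((ContinuousOn.comp (g := fun x => g x i j) (hg.smooth i j).continuousOn hp hpT).mul
      (continuousOn_pi.1 hu i)).mul (continuousOn_pi.1 hu j)

theorem IsLorentzField.integrableOn_stress (hg : IsLorentzField T g) (hI : IsCompact I)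
    (hp : ContinuousOn p I) (hu : ContinuousOn u I) (hpT : MapsTo p I T)
    (hq : ∀ t ∈ I, 0 < quad g (p t) (u t)) {f : Coord → ℝ} (hf : Continuous f) (i j : Fin 4) :
    IntegrableOn (fun t => (g (p t)).mulVec (u t) i * (g (p t)).mulVec (u t) j
      / Real.sqrt (quad g (p t) (u t)) * f (p t)) I := by
  have hw : ∀ i, ContinuousOn (fun t => (g (p t)).mulVec (u t) i) I := fun i => by
    simp only [Matrix.mulVec, dotProduct]
    exact continuousOn_finsetSum _ fun j _ => (ContinuousOn.comp (g := fun x => g x i j)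
      (hg.smooth i j).continuousOn hp hpT).mul (continuousOn_pi.1 hu j)
  have h1 : ContinuousOn (fun t => (g (p t)).mulVec (u t) i * (g (p t)).mulVec (u t) j
      / Real.sqrt (quad g (p t) (u t)) * f (p t)) I :=
    (((hw i).mul (hw j)).div (hg.continuousOn_quad hp hu hpT).sqrt fun t ht =>
      (Real.sqrt_pos.2 (hq t ht)).ne').mul (hf.comp_continuousOn hp)
  exact h1.integrableOn_compact hI

/-- Position and velocity enter as independent continuous functions, so differentiability is needed
in `ε` only. Positivity of the form persists for small `ε` uniformly on the compact `I`, which keeps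
the square root differentiable. -/
theorem IsLorentzField.hasDerivAt_length_aux (hg : IsLorentzField T g) (hh : IsVariation K h)
    (hK : IsCompact K) (hKT : K ⊆ T) (hI : IsCompact I)
    (hp : ContinuousOn p I) (hu : ContinuousOn u I) (hpK : MapsTo p I K)
    (hq : ∀ t ∈ I, 0 < quad g (p t) (u t)) :
    HasDerivAt (fun ε => ∫ t in I, Real.sqrt (quad (RandersGravity.varied g h ε) (p t) (u t)))
      (∫ t in I, (-∑ i, ∑ j, (g (p t)).mulVec (u t) i * (g (p t)).mulVec (u t) j * h (p t) i j)
        / (2 * Real.sqrt (quad g (p t) (u t)))) 0 := by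
  have hΩ := hg.isOpen_variedDomain hh
  have hs := hg.smooth₂_quad hh
  have hΩ' : IsOpen (variedDomain T g h ×ˢ (univ : Set Coord)) := hΩ.prod isOpen_univ
  obtain ⟨δ, hδ, hδK⟩ := hg.exists_Icc_subset_variedDomain hh hK hKT
  have hmaps : MapsTo (fun q : ℝ × ℝ => ((q.1, p q.2), u q.2)) (Icc (-δ) δ ×ˢ I)
      (variedDomain T g h ×ˢ univ) := fun q hq => ⟨hδK ⟨hq.1, hpK hq.2⟩, trivial⟩
  have hc : ContinuousOn (fun q : ℝ × ℝ => ((q.1, p q.2), u q.2)) (Icc (-δ) δ ×ˢ I) :=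
    (continuousOn_fst.prodMk (hp.comp continuousOn_snd fun _ hq => hq.2)).prodMk
      (hu.comp continuousOn_snd fun _ hq => hq.2)
  have hQc := ContinuousOn.comp hs.continuousOn hc hmaps
  have hQc' := ContinuousOn.comp (contDiffOn_fderiv_apply hΩ' hs
    (((1 : ℝ), (0 : Coord)), (0 : Coord))).continuousOn hc hmaps
  have hQd : ∀ ε ∈ Icc (-δ) δ, ∀ t ∈ I,
      HasDerivAt (fun ε => quad (RandersGravity.varied g h ε) (p t) (u t))
        (fderiv ℝ (fun q : (ℝ × Coord) × Coord =>
          quad (RandersGravity.varied g h q.1.1) q.1.2 q.2) ((ε, p t), u t)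
          (((1 : ℝ), (0 : Coord)), (0 : Coord))) ε := fun ε hε t ht => by
    have h1 := ((hs.contDiffAt (hΩ'.mem_nhds
      (hmaps (x := (ε, t)) ⟨hε, ht⟩))).differentiableAt (by simp)).hasFDerivAt
    have h2 : HasDerivAt (fun ε : ℝ => ((ε, p t), u t))
        (((1 : ℝ), (0 : Coord)), (0 : Coord)) ε :=
      ((hasDerivAt_id ε).prodMk (hasDerivAt_const ε (p t))).prodMk (hasDerivAt_const ε (u t))
    exact h1.comp_hasDerivAt (f := fun ε : ℝ => ((ε, p t), u t)) ε h2
  have hQ0 : ∀ t ∈ I, quad (RandersGravity.varied g h 0) (p t) (u t) = quad g (p t) (u t) :=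
    fun t ht => by simp only [quad, hg.varied_zero (hKT (hpK ht))]
  obtain ⟨ρ, hρ, hρδ, hρQ⟩ := exists_Icc_forall_pos
    (Q := fun ε t => quad (RandersGravity.varied g h ε) (p t) (u t)) hI hδ hQc fun t ht => by
    simpa only [hQ0 t ht] using hq t ht
  have hsub := prod_mono hρδ (Subset.refl I)
  have h1 := hasDerivAt_setIntegral_of_continuousOn (μ := (volume : Measure ℝ)) hI hρ
    (F := fun ε t => Real.sqrt (quad (RandersGravity.varied g h ε) (p t) (u t)))
    (F' := fun ε t => fderiv ℝ (fun q : (ℝ × Coord) × Coord =>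
          quad (RandersGravity.varied g h q.1.1) q.1.2 q.2) ((ε, p t), u t)
          (((1 : ℝ), (0 : Coord)), (0 : Coord))
      / (2 * Real.sqrt (quad (RandersGravity.varied g h ε) (p t) (u t))))
    (hQc.mono hsub).sqrt
    ((hQc'.mono hsub).div (continuousOn_const.mul (hQc.mono hsub).sqrt) fun q hq =>
      (mul_pos two_pos (Real.sqrt_pos.2 (hρQ _ hq.1 _ hq.2))).ne')
    fun ε hε t ht => (hQd ε (hρδ hε) t ht).sqrt (hρQ ε hε t ht).ne'
  refine h1.congr_deriv (setIntegral_congr_fun hI.measurableSet fun t ht => ?_)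
  have h2 := (hQd 0 (hρδ ⟨by linarith, hρ.le⟩) t ht).unique
    (hg.hasDerivAt_quad hh (hKT (hpK ht)) (u t))
  simp only [hQ0 t ht, h2]

theorem IsLorentzField.hasDerivAt_length (hg : IsLorentzField T g) (hh : IsVariation K h)
    (hK : IsCompact K) (hKT : K ⊆ T) (hI : IsCompact I)
    (hp : ContinuousOn p I) (hu : ContinuousOn u I) (hpK : MapsTo p I K)
    (hq : ∀ t ∈ I, 0 < quad g (p t) (u t)) :
    HasDerivAt (fun ε => ∫ t in I, Real.sqrt (quad (RandersGravity.varied g h ε) (p t) (u t)))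
      (-(1 / 2) * ∑ i, ∑ j, ∫ t in I, (g (p t)).mulVec (u t) i * (g (p t)).mulVec (u t) j
        / Real.sqrt (quad g (p t) (u t)) * h (p t) i j) 0 := by
  refine (hg.hasDerivAt_length_aux hh hK hKT hI hp hu hpK hq).congr_deriv ?_
  have hint := fun i j => hg.integrableOn_stress hI hp hu (hpK.mono_right hKT) hq
    (hh.1 i j).continuous i j
  simp_rw [← integral_finsetSum _ fun j _ => hint _ j]
  rw [← integral_finsetSum _ fun i _ => integrable_finsetSum _ fun j _ => hint i j,
    ← integral_const_mul]
  refine setIntegral_congr_fun hI.measurableSet fun t ht => ?_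
  have := (Real.sqrt_pos.2 (hq t ht)).ne'
  simp only [Finset.mul_sum, ← Finset.sum_neg_distrib, Finset.sum_div]
  refine Finset.sum_congr rfl fun i _ => Finset.sum_congr rfl fun j _ => ?_
  field_simp

end Curve

end Length

/-! ### The action of matter -/

section Matter

variable {M : Type*} [TopologicalSpace M] [T2Space M] [ChartedSpace Coord M]
  {φ : OpenPartialHomeomorph M Coord} {Δ : Set M} {g h : MatField} {A : CovField}
  {ι : Type*} [Fintype ι] {P : ι → Particle M} {c : ℝ}

/-- Each worldline contributes `-m c` times the variation `-½ ∫ ẋ_i ẋ_j δg^{ij} / ‖ẋ‖` of its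
length, and `m c / 2 = (1/(2c)) m c²`. -/
theorem IsLorentzField.hasDerivAt_actionM (hg : IsLorentzField φ.target g)
    (hφ : φ ∈ IsManifold.maximalAtlas 𝓘(ℝ, Coord) ∞ M) (hΔ : IsCompact Δ) (hΔφ : Δ ⊆ φ.source)
    (hP : ∀ a, (P a).Admissible φ Δ g) (hc : c ≠ 0) (hh : IsVariation (φ '' Δ) h) :
    HasDerivAt (fun ε : ℝ => actionM c φ Δ P (RandersGravity.varied g h ε))
      (1 / (2 * c) * ∑ i, ∑ j, matterStress c φ Δ P g i j (fun x => h x i j)) 0 := by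
  have hK : IsCompact (φ '' Δ) := hΔ.image_of_continuousOn (φ.continuousOn.mono hΔφ)
  have hKT : φ '' Δ ⊆ φ.target := image_subset_iff.2 fun _ hx => φ.map_source (hΔφ hx)
  have h1 := (HasDerivAt.fun_sum (u := Finset.univ) fun a _ =>
    (hg.hasDerivAt_length hh hK hKT ((hP a).isCompact_times hΔ)
    ((hP a).continuousOn_pos hφ hΔφ) ((hP a).continuousOn_vel hφ hΔφ)
    (fun _ ht => (P a).pos_mem_image ht) (hP a).2.2).const_mul ((P a).mass * c)).fun_neg
  refine h1.congr_deriv ?_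
  simp_rw [matterStress, Finset.mul_sum, ← Finset.sum_neg_distrib]
  rw [Finset.sum_comm' (t' := Finset.univ) (s' := fun _ => Finset.univ) (by simp)]
  refine Finset.sum_congr rfl fun i _ => ?_
  rw [Finset.sum_comm' (t' := Finset.univ) (s' := fun _ => Finset.univ) (by simp)]
  refine Finset.sum_congr rfl fun j _ => Finset.sum_congr rfl fun a _ => ?_
  field_simp

/-- The coefficients match because `m c · q/(m c²) = q/c`; compactness of the parameter set provides
the integrability needed to join the integrals. -/
theorem IsLorentzField.actionM_add_actionI (hg : IsLorentzField φ.target g)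
    (hA : ∀ i, ContDiffOn ℝ ∞ (fun x => A x i) φ.target)
    (hφ : φ ∈ IsManifold.maximalAtlas 𝓘(ℝ, Coord) ∞ M) (hΔ : IsCompact Δ) (hΔφ : Δ ⊆ φ.source)
    (hP : ∀ a, (P a).Admissible φ Δ g) (hc : c ≠ 0) :
    actionM c φ Δ P g + actionI c φ Δ P A =
      -∑ a, (P a).mass * c * ∫ t in (P a).times Δ,
        randers g A ((P a).charge / ((P a).mass * c ^ 2)) ((P a).pos φ t) ((P a).vel φ t) := by
  rw [actionM, actionI, ← neg_add, ← Finset.sum_add_distrib]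
  refine congrArg _ (Finset.sum_congr rfl fun a _ => ?_)
  have hI := (hP a).isCompact_times hΔ
  have hp := (hP a).continuousOn_pos hφ hΔφ
  have hu := continuousOn_pi.1 ((hP a).continuousOn_vel hφ hΔφ)
  have hpT : MapsTo ((P a).pos φ) ((P a).times Δ) φ.target := fun t ht =>
    φ.map_source (hΔφ ht.2)
  have h1 : IntegrableOn (fun t => Real.sqrt (quad g ((P a).pos φ t) ((P a).vel φ t)))
      ((P a).times Δ) :=
    (hg.continuousOn_quad hp ((hP a).continuousOn_vel hφ hΔφ) hpT).sqrt.integrableOn_compact hI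
  have h2 : ContinuousOn (fun t => ∑ i, A ((P a).pos φ t) i * (P a).vel φ t i)
      ((P a).times Δ) := continuousOn_finsetSum _ fun i _ =>
    (ContinuousOn.comp (g := fun x => A x i) (hA i).continuousOn hp hpT).mul (hu i)
  simp only [randers]
  rw [integral_add h1 ((h2.integrableOn_compact hI).const_mul _), integral_const_mul]
  have := (hP a).1.ne'
  field_simp

end Matter

/-! ### The field equations -/

section FieldEquations

theorem IsLorentzMetric.isLorentzField {M : Type*} [TopologicalSpace M] [ChartedSpace Coord M]
    [IsManifold 𝓘(ℝ, Coord) ∞ M] {g : BilinField M} (hg : IsLorentzMetric g)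
    {φ : OpenPartialHomeomorph M Coord} (hφ : φ ∈ IsManifold.maximalAtlas 𝓘(ℝ, Coord) ∞ M) :
    IsLorentzField φ.target (metricComp φ g) where
  isOpen := φ.open_target
  smooth := (hg φ hφ).1
  symm x hx := ((hg φ hφ).2 x hx).1
  det_neg x hx := ((hg φ hφ).2 x hx).2

variable {T K : Set Coord} {g h : MatField} {A : CovField} {x : Coord}

/-- Since `γ^m_{jm} = ∂_j log √(-g)`, this is the symmetry of the second derivatives of the volume
density. -/
theorem IsLorentzField.sum_pd_christoffel_comm (hg : IsLorentzField T g) (hx : x ∈ T)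
    (j l : Fin 4) :
    ∑ m, pd l (christoffel g m j m) x = ∑ m, pd j (christoffel g m l m) x := by
  have hd : ∀ i j k, DifferentiableAt ℝ (christoffel g i j k) x := fun i j k =>
    ((hg.christoffel_smooth i j k).contDiffAt (hg.isOpen.mem_nhds hx)).differentiableAt (by simp)
  have hv : DifferentiableAt ℝ (vol g) x :=
    (hg.vol_smooth.contDiffAt (hg.isOpen.mem_nhds hx)).differentiableAt (by simp)
  have h1 : ∀ j l, pd l (pd j (vol g)) x
      = vol g x * ((∑ m, christoffel g m l m x) * (∑ m, christoffel g m j m x)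
        + ∑ m, pd l (christoffel g m j m) x) := fun j l => by
    rw [pd_congr hg.isOpen (fun z hz => hg.pd_vol hz j) hx l,
      pd_mul hv (DifferentiableAt.fun_sum fun m _ => hd m j m),
      pd_sum _ (fun m _ => hd m j m), hg.pd_vol hx]
    ring
  have h2 : pd l (pd j (vol g)) x = pd j (pd l (vol g)) x :=
    fderiv_fderiv_comm hg.isOpen hg.vol_smooth _ _ hx
  rw [h1, h1, mul_comm (∑ m, christoffel g m l m x)] at h2
  exact add_left_cancel (mul_left_cancel₀ (hg.vol_pos hx).ne' h2)

/-- Torsion-freeness and relabelling handle everything except the derivative of the trace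
`γ^m_{im}`, which is covered by `IsLorentzField.sum_pd_christoffel_comm`. -/
theorem IsLorentzField.ricci_comm (hg : IsLorentzField T g) (hx : x ∈ T) (i j : Fin 4) :
    ricci g i j x = ricci g j i x := by
  have h1 : ∀ i j m n, pd n (christoffel g m i j) x = pd n (christoffel g m j i) x :=
    fun i j m n => pd_congr hg.isOpen (fun z hz => hg.christoffel_comm hz m i j) hx n
  have h2 : ∑ m, ∑ n, christoffel g n i m x * christoffel g m n j x
      = ∑ m, ∑ n, christoffel g n j m x * christoffel g m n i x := by
    rw [Finset.sum_comm]
    refine Finset.sum_congr rfl fun m _ => Finset.sum_congr rfl fun n _ => ?_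
    rw [hg.christoffel_comm hx m i n, hg.christoffel_comm hx n m j, mul_comm]
  simp_rw [ricci, Finset.sum_add_distrib, Finset.sum_sub_distrib]
  rw [h2, hg.sum_pd_christoffel_comm hx i j]
  simp_rw [h1 i j, hg.christoffel_comm hx _ i j]

theorem IsLorentzField.fieldTensor_comm (hg : IsLorentzField T g) (hx : x ∈ T) (κ : ℝ)
    (i j : Fin 4) : fieldTensor g A κ i j x = fieldTensor g A κ j i x := by
  rw [fieldTensor_eq, fieldTensor_eq, hg.ricci_comm hx i j, hg.apply_comm hx i j,
    hg.faradaySq_comm hx A i j]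

/-- The conformally flat vertical metric with determinant `|det g|`. -/
theorem isVerticalMetric_smul_one (hg : ∀ x ∈ K, (g x).det ≠ 0) :
    IsVerticalMetric K g fun x => |(g x).det| ^ (1 / 4 : ℝ) • (1 : Matrix (Fin 4) (Fin 4) ℝ) := by
  intro x hx
  have h0 : 0 < |(g x).det| := abs_pos.2 (hg x hx)
  refine ⟨Matrix.PosDef.one.smul (Real.rpow_pos_of_pos h0 _), ?_⟩
  rw [Matrix.det_smul, Matrix.det_one, mul_one, Fintype.card_fin, ← Real.rpow_natCast,
    ← Real.rpow_mul h0.le]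
  norm_num

/-- Stationarity quantifies over admissible vertical families, so deducing the field equations from
it requires that one exist for each test variation. -/
theorem IsLorentzField.exists_isVerticalFamily (hg : IsLorentzField T g) (hh : IsVariation K h)
    (hK : IsCompact K) (hKT : K ⊆ T) : ∃ v, IsVerticalFamily K g h v := by
  obtain ⟨δ, hδ, hδK⟩ := hg.exists_Icc_subset_variedDomain hh hK hKT
  refine ⟨fun ε x => |(RandersGravity.varied g h ε x).det| ^ (1 / 4 : ℝ) • 1, ?_⟩
  filter_upwards [Icc_mem_nhds (neg_lt_zero.2 hδ) hδ] with ε hε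
  exact isVerticalMetric_smul_one fun x hx => (det_varied_neg (hδK ⟨hε, hx⟩)).ne

theorem isVariation_smul {f : Coord → ℝ} (hf : ContDiff ℝ ∞ f) (hfK : tsupport f ⊆ interior K)
    {S : Matrix (Fin 4) (Fin 4) ℝ} (hS : S.IsSymm) : IsVariation K fun x => f x • S := by
  refine ⟨fun i j => ?_, fun x => hS.smul _, ?_⟩
  · simp only [Matrix.smul_apply, smul_eq_mul]
    exact hf.mul contDiff_const
  · exact (tsupport_smul_subset_left f fun _ => S).trans hfK

/-- The field equation `G_{ij} √(-g) = (8 π k / c⁴) T_{ij} √(-g)` as a distribution, evaluated on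
the test function `f`. -/
noncomputable def fieldEquation {M : Type*} [TopologicalSpace M] [ChartedSpace Coord M]
    {ι : Type*} [Fintype ι] (c k : ℝ) (φ : OpenPartialHomeomorph M Coord) (Δ : Set M)
    (P : ι → Particle M) (A : CovField) (g : MatField) (i j : Fin 4) (f : Coord → ℝ) : ℝ :=
  (∫ x in φ '' Δ, fieldTensor g A (k / c ^ 4) i j x * (f x * Real.sqrt (-(g x).det)))
    - 8 * Real.pi * k / c ^ 4 * matterStress c φ Δ P g i j f

/-! ### The weak form of the field equations -/

section Distribution

variable {M : Type*} [TopologicalSpace M] [ChartedSpace Coord M]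
  {φ : OpenPartialHomeomorph M Coord} {Δ : Set M}
  {ι : Type*} [Fintype ι] {P : ι → Particle M} {c k α : ℝ}

theorem fieldEquation_const_mul (i j : Fin 4) (a : ℝ) (f : Coord → ℝ) :
    fieldEquation c k φ Δ P A g i j (fun x => f x * a)
      = a * fieldEquation c k φ Δ P A g i j f := by
  have h1 : matterStress c φ Δ P g i j (fun x => f x * a) = a * matterStress c φ Δ P g i j f := by
    simp_rw [matterStress, Finset.mul_sum, ← mul_assoc, integral_mul_const]
    exact Finset.sum_congr rfl fun _ _ => by ring
  have h2 : ∀ x, fieldTensor g A (k / c ^ 4) i j x * (f x * a * Real.sqrt (-(g x).det))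
      = a * (fieldTensor g A (k / c ^ 4) i j x * (f x * Real.sqrt (-(g x).det))) :=
    fun _ => by ring
  rw [fieldEquation, fieldEquation, h1]
  simp_rw [h2, integral_const_mul]
  ring

theorem IsLorentzField.fieldEquation_comm (hg : IsLorentzField T g) (hK : IsCompact (φ '' Δ))
    (hKT : φ '' Δ ⊆ T) (i j : Fin 4) (f : Coord → ℝ) :
    fieldEquation c k φ Δ P A g i j f = fieldEquation c k φ Δ P A g j i f := by
  have h1 : matterStress c φ Δ P g i j f = matterStress c φ Δ P g j i f := by
    simp_rw [matterStress]
    refine Finset.sum_congr rfl fun a _ => ?_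
    simp_rw [mul_comm ((g _).mulVec _ i)]
  rw [fieldEquation, fieldEquation, h1]
  refine congrArg (· - _) (setIntegral_congr_fun hK.measurableSet fun x hx => ?_)
  simp only [hg.fieldTensor_comm (hKT hx) _ i j]

theorem IsLorentzField.genEinstein_eq_fieldTensor (hg : IsLorentzField T g)
    (hA : ∀ i, ContDiffOn ℝ ∞ (fun x => A x i) T) (hα : 3 * α ^ 2 / 2 = k / c ^ 4) (hx : x ∈ T)
    {y : Coord} (hy : quad g x y ≠ 0) (i j : Fin 4) :
    genEinstein g A α i j x y = (fieldTensor g A (k / c ^ 4) i j x : ℂ) :=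
  hg.genEinstein_eq hA hα ⟨hx, hy⟩ i j

theorem IsLorentzField.integral_genEinstein (hg : IsLorentzField T g)
    (hA : ∀ i, ContDiffOn ℝ ∞ (fun x => A x i) T) (hα : 3 * α ^ 2 / 2 = k / c ^ 4)
    (hK : IsCompact K) (hKT : K ⊆ T) {Y : Coord → Coord} (hY : ∀ x ∈ K, quad g x (Y x) ≠ 0)
    (i j : Fin 4) (f : Coord → ℝ) :
    ∫ x in K, genEinstein g A α i j x (Y x) * ((f x * Real.sqrt (-(g x).det) : ℝ) : ℂ)
      = ((∫ x in K, fieldTensor g A (k / c ^ 4) i j x * (f x * Real.sqrt (-(g x).det)) : ℝ) : ℂ)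
      := by
  rw [← integral_complex_ofReal]
  refine setIntegral_congr_fun hK.measurableSet fun x hx => ?_
  simp only [hg.genEinstein_eq_fieldTensor hA hα (hKT hx) (hY x hx) i j, Complex.ofReal_mul]

/-- The matter term fits under the common prefactor because `(c³/(16πk)) · (8πk/c⁴) = 1/(2c)`; the
interaction term does not contain the metric and is constant. -/
theorem IsLorentzField.hasDerivAt_totalAction [T2Space M] (hg : IsLorentzField φ.target g)
    (hA : ∀ i, ContDiffOn ℝ ∞ (fun x => A x i) φ.target)
    (hφ : φ ∈ IsManifold.maximalAtlas 𝓘(ℝ, Coord) ∞ M) (hΔ : IsCompact Δ) (hΔφ : Δ ⊆ φ.source)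
    (hP : ∀ a, (P a).Admissible φ Δ g) (hc : c ≠ 0) (hk : k ≠ 0)
    (hα : 3 * α ^ 2 / 2 = k / c ^ 4) (hh : IsVariation (φ '' Δ) h) {v : ℝ → MatField}
    (hv : IsVerticalFamily (φ '' Δ) g h v) :
    HasDerivAt (fun ε : ℝ => totalAction c k α φ Δ P A (RandersGravity.varied g h ε) (v ε))
      ((-(c ^ 3 / (16 * Real.pi * k))
        * ∑ i, ∑ j, fieldEquation c k φ Δ P A g i j (fun x => h x i j) : ℝ) : ℂ) 0 := by
  have hK : IsCompact (φ '' Δ) := hΔ.image_of_continuousOn (φ.continuousOn.mono hΔφ)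
  have hKT : φ '' Δ ⊆ φ.target := image_subset_iff.2 fun _ hx => φ.map_source (hΔφ hx)
  have h1 := hg.hasDerivAt_actionFG hh hK hKT hA c k α hv
  have h2 := ((hg.hasDerivAt_actionM hφ hΔ hΔφ hP hc hh).add_const
    (actionI c φ Δ P A)).ofReal_comp
  refine (h1.fun_add h2).congr_deriv ?_
  rw [← Complex.ofReal_add, hα]
  have hint : ∀ i j, IntegrableOn (fun x => fieldTensor g A (k / c ^ 4) i j x
      * (h x i j * Real.sqrt (-(g x).det))) (φ '' Δ) := fun i j => by
    have h3 : ContinuousOn (fun x => fieldTensor g A (k / c ^ 4) i j x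
      * (h x i j * Real.sqrt (-(g x).det))) φ.target :=
      (hg.fieldTensor_smooth hA _ i j).continuousOn.mul
        ((hh.1 i j).continuous.continuousOn.mul hg.vol_smooth.continuousOn)
    exact (h3.mono hKT).integrableOn_compact hK
  have h4 : ∫ x in φ '' Δ, (∑ i, ∑ j, h x i j * fieldTensor g A (k / c ^ 4) i j x) * vol g x
      = ∑ i, ∑ j, ∫ x in φ '' Δ, fieldTensor g A (k / c ^ 4) i j x
        * (h x i j * Real.sqrt (-(g x).det)) := by
    simp_rw [← integral_finsetSum _ fun j _ => hint _ j]
    rw [← integral_finsetSum _ fun i _ => integrable_finsetSum _ fun j _ => hint i j]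
    refine setIntegral_congr_fun hK.measurableSet fun x _ => ?_
    simp only [Finset.sum_mul]
    refine Finset.sum_congr rfl fun i _ => Finset.sum_congr rfl fun j _ => ?_
    rw [vol]
    ring
  rw [h4]
  have := Real.pi_ne_zero
  simp_rw [fieldEquation, Finset.sum_sub_distrib, ← Finset.mul_sum]
  refine congrArg _ ?_
  field_simp
  ring

theorem IsLorentzField.isStationaryMetric_iff [T2Space M] (hg : IsLorentzField φ.target g)
    (hA : ∀ i, ContDiffOn ℝ ∞ (fun x => A x i) φ.target)
    (hφ : φ ∈ IsManifold.maximalAtlas 𝓘(ℝ, Coord) ∞ M) (hΔ : IsCompact Δ) (hΔφ : Δ ⊆ φ.source)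
    (hP : ∀ a, (P a).Admissible φ Δ g) (hc : c ≠ 0) (hk : k ≠ 0)
    (hα : 3 * α ^ 2 / 2 = k / c ^ 4) :
    IsStationaryMetric (φ '' Δ) (totalAction c k α φ Δ P A) g ↔
      ∀ i j, ∀ f : Coord → ℝ, ContDiff ℝ ∞ f → tsupport f ⊆ interior (φ '' Δ) →
        fieldEquation c k φ Δ P A g i j f = 0 := by
  have hK : IsCompact (φ '' Δ) := hΔ.image_of_continuousOn (φ.continuousOn.mono hΔφ)
  have hKT : φ '' Δ ⊆ φ.target := image_subset_iff.2 fun _ hx => φ.map_source (hΔφ hx)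
  refine ⟨fun hS i j f hf hfK => ?_, fun hE h hh v hv => ?_⟩
  -- Variations must be symmetric, so component `(i, j)` is tested with `f (E_{ij} + E_{ji})`. The
  -- sum of `fieldEquation` terms is then the `(i, j)` term plus the `(j, i)` term, and by symmetry
  -- twice the former, also when `i = j`.
  · have hsymm : (Matrix.single i j (1 : ℝ) + Matrix.single j i 1).IsSymm := by
      rw [Matrix.IsSymm, Matrix.transpose_add, Matrix.transpose_single, Matrix.transpose_single,
        add_comm]
    have hh := isVariation_smul hf hfK hsymm
    obtain ⟨v, hv⟩ := hg.exists_isVerticalFamily hh hK hKT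
    have h1 := (hg.hasDerivAt_totalAction hA hφ hΔ hΔφ hP hc hk hα hh hv).unique (hS _ hh v hv)
    rw [Complex.ofReal_eq_zero] at h1
    have h2 := (mul_eq_zero.1 h1).resolve_left (neg_ne_zero.2 (div_ne_zero (pow_ne_zero 3 hc)
      (mul_ne_zero (mul_ne_zero (by norm_num) Real.pi_ne_zero) hk)))
    simp only [Matrix.smul_apply, smul_eq_mul, fieldEquation_const_mul, Matrix.add_apply,
      add_mul, Finset.sum_add_distrib, Matrix.single_apply, ite_mul, one_mul, zero_mul] at h2
    simp only [ite_and, Finset.sum_ite_eq, Finset.sum_ite_irrel, Finset.sum_const_zero,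
      Finset.mem_univ, if_true] at h2
    rw [hg.fieldEquation_comm hK hKT j i] at h2
    linarith
  · have h1 := hg.hasDerivAt_totalAction hA hφ hΔ hΔφ hP hc hk hα hh hv
    rwa [Finset.sum_eq_zero fun i _ => Finset.sum_eq_zero fun j _ => hE i j _ (hh.1 i j) ?_,
      mul_zero, Complex.ofReal_zero] at h1
    -- Each entry of `h` is an admissible test function, its support being contained in that of `h`.
    refine subset_trans ?_ hh.2.2
    exact closure_mono fun x hx h0 => hx (by simp [h0])

end Distribution

end FieldEquations

end RandersGravity


/-! ### The proposition, read in the chart -/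

theorem mainTheorem3
    {M : Type*} [TopologicalSpace M] [T2Space M] [SecondCountableTopology M]
    [ChartedSpace Coord M] [IsManifold 𝓘(ℝ, Coord) ∞ M]
    (g : BilinField M) (hg : IsLorentzMetric g)
    (A : FormField M) (hA : IsSmoothForm A)
    (c k : ℝ) (hc : 0 < c) (hk : 0 < k)
    (α : ℝ) (hα : 3 * α ^ 2 / 2 = k / c ^ 4)
    (φ : OpenPartialHomeomorph M Coord) (hφ : φ ∈ IsManifold.maximalAtlas 𝓘(ℝ, Coord) ∞ M)
    (Δ : Set M) (hΔ : IsCompact Δ) (hΔφ : Δ ⊆ φ.source)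
    {ι : Type*} [Fintype ι] (P : ι → Particle M)
    (hP : ∀ a, (P a).Admissible φ Δ (metricComp φ g)) :
    -- The matter and interaction terms through the Randers Lagrangians, `α_a = q_a / (m_a c²)`.
    (actionM c φ Δ P (metricComp φ g) + actionI c φ Δ P (formComp φ A) =
      -∑ a, (P a).mass * c * ∫ t in (P a).times Δ,
        randers (metricComp φ g) (formComp φ A) ((P a).charge / ((P a).mass * c ^ 2))
          ((P a).pos φ t) ((P a).vel φ t)) ∧
    -- The stress-energy tensor of matter is the variational derivative of `S_m`.
    (∀ h, IsVariation (φ '' Δ) h →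
      HasDerivAt (fun ε : ℝ => actionM c φ Δ P (varied (metricComp φ g) h ε))
        (1 / (2 * c) *
          ∑ i, ∑ j, matterStress c φ Δ P (metricComp φ g) i j (fun x => h x i j)) 0) ∧
    -- `𝓖` contains the electromagnetic stress-energy tensor.
    (∀ x ∈ φ.target, ∀ y, quad (metricComp φ g) x y ≠ 0 → ∀ i j,
      genEinstein (metricComp φ g) (formComp φ A) α i j x y =
        ((einstein (metricComp φ g) i j x - 8 * Real.pi * k / c ^ 4 *
          fieldStress (metricComp φ g) (formComp φ A) i j x : ℝ) : ℂ)) ∧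
    -- For every choice `Y` of nonnull fibre coordinates:
    ∀ Y : Coord → Coord, (∀ x ∈ φ '' Δ, quad (metricComp φ g) x (Y x) ≠ 0) →
      -- the variation of the total action with respect to `g^{ij}`,
      (∀ h, IsVariation (φ '' Δ) h → ∀ v, IsVerticalFamily (φ '' Δ) (metricComp φ g) h v →
        HasDerivAt
          (fun ε : ℝ => totalAction c k α φ Δ P (formComp φ A) (varied (metricComp φ g) h ε) (v ε))
          (-((c ^ 3 / (16 * Real.pi * k) : ℝ) : ℂ) * ∑ i, ∑ j,
            ((∫ x in φ '' Δ, genEinstein (metricComp φ g) (formComp φ A) α i j x (Y x) *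
                ((h x i j * Real.sqrt (-(metricComp φ g x).det) : ℝ) : ℂ)) -
              ((8 * Real.pi * k / c ^ 4 *
                matterStress c φ Δ P (metricComp φ g) i j (fun x => h x i j) : ℝ) : ℂ))) 0) ∧
      -- and the field equations `𝓖_{ij} = (8πk / c⁴) T_{ij}` in the interior of the domain.
      (IsStationaryMetric (φ '' Δ) (totalAction c k α φ Δ P (formComp φ A)) (metricComp φ g) ↔
        ∀ i j, ∀ f : Coord → ℝ, ContDiff ℝ ∞ f → tsupport f ⊆ interior (φ '' Δ) →
          ∫ x in φ '' Δ, genEinstein (metricComp φ g) (formComp φ A) α i j x (Y x) *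
              ((f x * Real.sqrt (-(metricComp φ g x).det) : ℝ) : ℂ) =
            ((8 * Real.pi * k / c ^ 4 *
              matterStress c φ Δ P (metricComp φ g) i j f : ℝ) : ℂ)) := by
  have hg' := hg.isLorentzField hφ
  have hA' := hA φ hφ
  have hK : IsCompact (φ '' Δ) := hΔ.image_of_continuousOn (φ.continuousOn.mono hΔφ)
  have hKT : φ '' Δ ⊆ φ.target := image_subset_iff.2 fun _ hx => φ.map_source (hΔφ hx)
  refine ⟨hg'.actionM_add_actionI hA' hφ hΔ hΔφ hP hc.ne',
    fun h hh => hg'.hasDerivAt_actionM hφ hΔ hΔφ hP hc.ne' hh, fun x hx y hy i j => ?_,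
    fun Y hY => ⟨fun h hh v hv => ?_, ?_⟩⟩
  · rw [mul_div_assoc]
    exact hg'.genEinstein_eq_fieldTensor hA' hα hx hy i j
  · refine (hg'.hasDerivAt_totalAction hA' hφ hΔ hΔφ hP hc.ne' hk.ne' hα hh hv).congr_deriv ?_
    simp_rw [hg'.integral_genEinstein hA' hα hK hKT hY, ← Complex.ofReal_sub]
    rw [Complex.ofReal_mul, Complex.ofReal_neg]
    simp_rw [Complex.ofReal_sum]
    rfl
  · rw [hg'.isStationaryMetric_iff hA' hφ hΔ hΔφ hP hc.ne' hk.ne' hα]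
    refine forall_congr' fun i => forall_congr' fun j => forall_congr' fun f =>
      forall_congr' fun _ => forall_congr' fun _ => ?_
    rw [hg'.integral_genEinstein hA' hα hK hKT hY, Complex.ofReal_inj, fieldEquation, sub_eq_zero]
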